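/- Let $(\Omega,\mathscr F,\mathbb P)$ be a probability space, $(J,\mathscr J,\nu)$ a $\sigma$-finite measure space, and $N$ a Poisson random measure on $\mathbb R_+\times J$ with intensity measure $dt\times\nu$. That is, $N(\omega,\cdot)$ is an $\mathbb N\cup\{\infty\}$-valued measure for every $\omega\in\Omega$, each $N(B)$ is a Poisson random variable with parameter $\mu(B)=(dt\times\nu)(B)$ (meaning $N(B)=\infty$ almost surely if $\mu(B)=\infty$), and $N(B_1),\dots,N(B_n)$ are independent for pairwise disjoint measurable $B_1,\dots,B_n$. Put $\tilde N(B)=N(B)-\mu(B)$ if $\mu(B)<\infty$, and let $\mathscr F_t$ be the $\sigma$-algebra generated by the random variables $N((a,b]\times A)$ with $0\le a<b\le t$ and $A\in\mathscr J$. A simple, adapted $X$-valued process is a function of the form $$\phi=\sum_{i=1}^l\sum_{j=1}^m\sum_{k=1}^n F_{ijk}\,\mathbf 1_{(t_i,t_{i+1}]}\,\mathbf 1_{A_j}\,x_{ijk},$$ where $0=t_1<\dots<t_{l+1}<\infty$, $F_{ijk}\in L^\infty(\Omega,\mathscr F_{t_i})$ are scalar-valued, $A_1,\dots,A_m\in\mathscr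 J$ are disjoint with $\nu(A_j)<\infty$, and $x_{ijk}\in X$. For $B\in\mathscr J$, $$\int_{\mathbb R_+\times B}\phi\,d\tilde N=\sum_{i,j,k}F_{ijk}\,\tilde N\big((t_i,t_{i+1}]\times(A_j\cap B)\big)\,x_{ijk}.$$ A Banach space $X$ has martingale cotype $s\in[2,\infty)$ if there is a constant $c$ such that every finite martingale difference sequence $(d_i)$ in $L^s(\Omega';X)$, on any probability space $\Omega'$, satisfies $$\Big(\sum_i\mathbb E\|d_i\|^s\Big)^{1/s}\le c\,\Big(\mathbb E\Big\|\sum_i d_i\Big\|^s\Big)^{1/s}.$$ For $1\le p,q<\infty$ write $\mathscr D^p_{q}=L^p(\Omega;L^q(\mathbb R_+\times J;X))$, with norm $$\|f\|_{\mathscr D^p_q}=\Big(\mathbb E\Big(\int_{\mathbb R_+\times J}\|f\|^q\,dt\,d\nu\Big)^{p/q}\Big)^{1/p}.$$ Let $\|f\|_{\mathscr D^p_s\cap\mathscr D^p_p}=\max\{\|f\|_{\mathscr D^p_s},\|f\|_{\mathscr D^p_p}\}$, and let $\|f\|_{\mathscr D^p_s+\mathscr D^p_p}$ be the infimum of $\|g\|_{\mathscr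 D^p_s}+\|h\|_{\mathscr D^p_p}$ over all decompositions $f=g+h$ with $g\in\mathscr D^p_s$ and $h\in\mathscr D^p_p$. **Theorem (lower bounds and finite martingale cotype).** Let $X$ be a Banach space with martingale cotype $s\in[2,\infty)$. 1. If $s\le p<\infty$, there is a constant $C$ depending only on $p$, $s$ and $X$ such that, for every simple, adapted $X$-valued process $\phi$ and every $B\in\mathscr J$, $$\|\phi\mathbf 1_B\|_{\mathscr D^p_s\cap\mathscr D^p_p}\le C\Big(\mathbb E\Big\|\int_{\mathbb R_+\times B}\phi\,d\tilde N\Big\|^p\Big)^{1/p}.$$ 2. If $1<p<s$, there is a constant $C$ depending only on $p$, $s$ and $X$ such that, for every simple, adapted $X$-valued process $\phi$ and every $B\in\mathscr J$, $$\|\phi\mathbf 1_B\|_{\mathscr D^p_s+\mathscr D^p_p}\le C\Big(\mathbb E\Big\|\int_{\mathbb R_+\times B}\phi\,d\tilde N\Big\|^p\Big)^{1/p}.$$ -/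

import Mathlib

open MeasureTheory ProbabilityTheory Set
open scoped NNReal ENNReal

universe u v w z

/-- Lebesgue measure on `ℝ₊ = [0, ∞)`. -/
noncomputable def lebesgueNNReal : Measure ℝ≥0 :=
  Measure.comap ((↑) : ℝ≥0 → ℝ) volume

theorem measurableEmbedding_coe_NNReal : MeasurableEmbedding ((↑) : ℝ≥0 → ℝ) :=
  MeasurableEmbedding.subtype_coe measurableSet_Ici

theorem lebesgueNNReal_Ioc (a b : ℝ≥0) :
    lebesgueNNReal (Ioc a b) = ENNReal.ofReal ((b : ℝ) - a) := by
  have h : ((↑) : ℝ≥0 → ℝ) '' Ioc a b = Ioc (a : ℝ) b := by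
    ext x
    constructor
    · rintro ⟨y, hy, rfl⟩
      exact hy
    · intro hx
      exact ⟨⟨x, (a.2.trans_lt hx.1).le⟩, hx, rfl⟩
  rw [lebesgueNNReal, measurableEmbedding_coe_NNReal.comap_apply, h, Real.volume_Ioc]

instance : SigmaFinite lebesgueNNReal := by
  refine SigmaFinite.of_map _ measurableEmbedding_coe_NNReal.measurable.aemeasurable ?_
  rw [lebesgueNNReal, measurableEmbedding_coe_NNReal.map_comap]
  infer_instance

/-- A real Banach space `X` has martingale cotype `r` if there is a constant `C` such that
`(∑ i, E ‖d i‖ ^ r) ^ (1 / r) ≤ C * (E ‖∑ i, d i‖ ^ r) ^ (1 / r)`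
for every finite martingale difference sequence `d 0, …, d (n - 1)` in `L^r(Ω; X)`, on every
probability space `Ω`.  The difference `d i` is measurable with respect to `ℱ (i + 1)` and has
vanishing conditional expectation given `ℱ i`. -/
def HasMartingaleCotype (X : Type u) [NormedAddCommGroup X] [NormedSpace ℝ X] [CompleteSpace X]
    (r : ℝ) : Prop :=
  ∃ C : ℝ≥0, ∀ (Ω : Type w) [mΩ : MeasurableSpace Ω] (P : Measure Ω) [IsProbabilityMeasure P]
    (ℱ : Filtration ℕ mΩ) (n : ℕ) (d : ℕ → Ω → X),
    (∀ i < n, StronglyMeasurable[ℱ (i + 1)] (d i)) →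
    (∀ i < n, MemLp (d i) (ENNReal.ofReal r) P) →
    (∀ i < n, P[d i | ℱ i] =ᵐ[P] 0) →
    (∑ i ∈ Finset.range n, ∫⁻ ω, ‖d i ω‖ₑ ^ r ∂P) ^ (1 / r) ≤
      C * (∫⁻ ω, ‖∑ i ∈ Finset.range n, d i ω‖ₑ ^ r ∂P) ^ (1 / r)

/-- `N` is a Poisson random measure on the measurable space `E`, over the probability space
`(Ω, P)`, with (σ-finite) intensity measure `μ`.  The random variable `N(B)` has the Poisson law
with parameter `μ B`, which for `μ B = ∞` means that `N(B) = ∞` almost surely. -/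
structure IsPoissonRandomMeasure {Ω : Type w} [MeasurableSpace Ω] (P : Measure Ω)
    {E : Type v} [MeasurableSpace E] (N : Ω → Measure E) (μ : Measure E) : Prop where
  measurable : ∀ B, MeasurableSet B → Measurable fun ω => N ω B
  integer_valued : ∀ ω B, MeasurableSet B → ∃ k : ℕ∞, N ω B = (k : ℝ≥0∞)
  sigmaFinite : SigmaFinite μ
  intensity : ∀ B, MeasurableSet B → ∫⁻ ω, N ω B ∂P = μ B
  law : ∀ B, MeasurableSet B → μ B ≠ ∞ →
    P.map (fun ω => N ω B) = (poissonMeasure (μ B).toNNReal).map (fun k : ℕ => (k : ℝ≥0∞))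
  law_top : ∀ B, MeasurableSet B → μ B = ∞ → ∀ᵐ ω ∂P, N ω B = ∞
  indep : ∀ (n : ℕ) (B : Fin n → Set E), (∀ i, MeasurableSet (B i)) →
    Pairwise (fun i j => Disjoint (B i) (B j)) → iIndepFun (fun i ω => N ω (B i)) P

/-- The compensated random measure `Ñ(B) = N(B) - μ(B)`, used on sets `B` with `μ B < ∞`
(where `N(B) < ∞` almost surely). -/
noncomputable def compensated {Ω : Type w} {E : Type v} [MeasurableSpace E] (N : Ω → Measure E)
    (μ : Measure E) (B : Set E) (ω : Ω) : ℝ :=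
  (N ω B).toReal - (μ B).toReal

/-- The σ-algebra `ℱ_t` generated by the random variables `N((a, b] × A)`, where
`0 ≤ a < b ≤ t` and `A` is a measurable subset of `J`.  (For `t = 0` it is trivial.) -/
@[reducible]
def poissonPast {Ω : Type w} {J : Type v} [MeasurableSpace J] (N : Ω → Measure (ℝ≥0 × J))
    (t : ℝ≥0) : MeasurableSpace Ω :=
  ⨆ (a : ℝ≥0) (b : ℝ≥0) (A : Set J) (_ : a < b ∧ b ≤ t ∧ MeasurableSet A),
    MeasurableSpace.comap (fun ω => N ω (Ioc a b ×ˢ A)) inferInstance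

/-- The data of a simple, adapted `X`-valued process
`∑ i j k, F i j k • 1_{(t i, t (i + 1)]} 1_{A j} x i j k`, with `0 = t 0 < t 1 < … < t l < ∞`. -/
structure SimpleAdaptedProcess {Ω : Type w} [MeasurableSpace Ω] (P : Measure Ω)
    {J : Type v} [MeasurableSpace J] (ν : Measure J) (N : Ω → Measure (ℝ≥0 × J))
    (𝕜 : Type z) [RCLike 𝕜] (X : Type u) where
  l : ℕ
  m : ℕ
  n : ℕ
  t : Fin (l + 1) → ℝ≥0
  t_zero : t 0 = 0
  t_strictMono : StrictMono t
  A : Fin m → Set J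
  measurableSet_A : ∀ j, MeasurableSet (A j)
  disjoint_A : Pairwise fun i j => Disjoint (A i) (A j)
  measure_A_lt_top : ∀ j, ν (A j) < ∞
  F : Fin l → Fin m → Fin n → Ω → 𝕜
  measurable_F : ∀ i j k, Measurable[poissonPast N (t i.castSucc)] (F i j k)
  memLp_F : ∀ i j k, MemLp (F i j k) ∞ P
  x : Fin l → Fin m → Fin n → X

namespace SimpleAdaptedProcess

variable {Ω : Type w} [MeasurableSpace Ω] {P : Measure Ω} {J : Type v} [MeasurableSpace J]
  {ν : Measure J} {N : Ω → Measure (ℝ≥0 × J)} {𝕜 : Type z} [RCLike 𝕜] {X : Type u}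
  [NormedAddCommGroup X] [NormedSpace 𝕜 X]

/-- The time interval `(t i, t (i + 1)]`. -/
def interval (φ : SimpleAdaptedProcess P ν N 𝕜 X) (i : Fin φ.l) : Set ℝ≥0 :=
  Ioc (φ.t i.castSucc) (φ.t i.succ)

/-- The function `Ω × ℝ₊ × J → X` given by a simple, adapted process. -/
noncomputable def toFun (φ : SimpleAdaptedProcess P ν N 𝕜 X) (ω : Ω) (e : ℝ≥0 × J) : X :=
  ∑ i, ∑ j, ∑ k, (φ.interval i ×ˢ φ.A j).indicator (fun _ => φ.F i j k ω • φ.x i j k) e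

/-- The function `φ 1_B`, for `B ⊆ J`. -/
noncomputable def restrict (φ : SimpleAdaptedProcess P ν N 𝕜 X) (B : Set J) (ω : Ω)
    (e : ℝ≥0 × J) : X :=
  ((univ : Set ℝ≥0) ×ˢ B).indicator (φ.toFun ω) e

/-- The compensated Poisson stochastic integral of `φ` over `ℝ₊ × B`. -/
noncomputable def stochIntegral (φ : SimpleAdaptedProcess P ν N 𝕜 X) (B : Set J) (ω : Ω) : X :=
  ∑ i, ∑ j, ∑ k, φ.F i j k ω •
    ((compensated N (lebesgueNNReal.prod ν) (φ.interval i ×ˢ (φ.A j ∩ B)) ω : ℝ) : 𝕜) • φ.x i j k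

end SimpleAdaptedProcess

section Norms

variable {Ω : Type w} [MeasurableSpace Ω] {E : Type v} [MeasurableSpace E] {X : Type u}
  [NormedAddCommGroup X]

/-- The norm of `L^p(Ω; L^q(E; X))` on functions `Ω × E → X`. -/
noncomputable def mixedNorm (P : Measure Ω) (μ : Measure E) (p q : ℝ) (f : Ω → E → X) : ℝ≥0∞ :=
  (∫⁻ ω, (∫⁻ e, ‖f ω e‖ₑ ^ q ∂μ) ^ (p / q) ∂P) ^ (1 / p)

/-- The norm of `L^p(Ω; L^s(E; X)) ∩ L^p(Ω; L^p(E; X))`. -/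
noncomputable def interNorm (P : Measure Ω) (μ : Measure E) (p s : ℝ) (f : Ω → E → X) : ℝ≥0∞ :=
  max (mixedNorm P μ p s f) (mixedNorm P μ p p f)

/-- The norm of `L^p(Ω; L^s(E; X)) + L^p(Ω; L^p(E; X))`: the infimum of
`‖g‖_{L^p(L^s)} + ‖h‖_{L^p(L^p)}` over all decompositions `f = g + h` (almost everywhere). -/
noncomputable def sumNorm (P : Measure Ω) (μ : Measure E) (p s : ℝ) (f : Ω → E → X) : ℝ≥0∞ :=
  ⨅ (g : Ω × E → X) (h : Ω × E → X) (_ : AEStronglyMeasurable g (P.prod μ))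
    (_ : AEStronglyMeasurable h (P.prod μ))
    (_ : ∀ᵐ a ∂(P.prod μ), f a.1 a.2 = g a + h a),
    mixedNorm P μ p s (fun ω e => g (ω, e)) + mixedNorm P μ p p (fun ω e => h (ω, e))

end Norms

/-! Cut the support of `φ 1_B` into finitely many disjoint cells `Q k` with `μ (Q k) ≤ 1/2`, ordered
by starting time. Then `φ 1_B = ∑ 1_{Q k} F k` and the stochastic integral is almost surely `∑ Ñ(Q
k) F k`. The coefficient `F k` depends only on `N` restricted to a set `D k` disjoint from `Q k`, so
independence makes the summands a martingale difference sequence. Since `N(Q k)` is integer-valued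
and its mean is at most `1/2`, one has `N(Q k) ≤ 2 |Ñ(Q k)|`. Hence the jumps `‖F k‖ N(Q k)` are
controlled by the martingale differences (`HasMartingaleCotype.exists_lintegral_jumps_le`).

This uses a fact about martingales alone: cotype `s` gives `E (∑ ‖d k‖^s)^(p/s) ≤ C E ‖∑ d k‖^p` for
all `1 < p < ∞` (`HasMartingaleCotype.exists_lintegral_rpow_le`). The device is to multiply `d k` by
predictable weights, apply the case `p = s` to the transform, and bound the transform pathwise by
Abel summation. For `p > s` the weights are powers of the partial sums of `‖d i‖^s`, and the
estimate is closed by Doob's maximal inequality and absorption. For `p < s` they are negative powers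
of a predictable majorant of the martingale; Davis' decomposition removes the large jumps that may
prevent an integrable majorant from existing.

It remains to pass from jumps to intensity, using `E[W N(Q k)] = E[W μ(Q k)]` for predictable `W ≥
0`. If `p ≥ s`, integrality gives `N ≤ N^s` and `N ≤ N^p`; the second bound yields the `L^p(L^p)`
norm, and the first, with the dual Doob inequality, the `L^p(L^s)` norm. If `p < s`, put `r = p/s`,
let `S k` be the sum of the `s`-th powers of the jumps before `k`, and call `F k` large if `‖F k‖^s
> S k`. Concavity of `x^r` shows that `S (k+1)^r - S k^r` dominates a multiple of `‖F k‖^p N(Q k)`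
for large `F k`, and of `‖F k‖^s (S k)^(r-1) N(Q k)` for small nonzero `F k`. The large part is thus
bounded in `L^p(L^p)` and the small part, after Hölder, in `L^p(L^s)`. -/

/-! ### Elementary inequalities for powers -/

theorem NNReal.add_rpow_le_rpow_add_mul {r : ℝ} (hr : 1 ≤ r) (a b : ℝ≥0) :
    (b + a) ^ r ≤ b ^ r + r.toNNReal * (a * (b + a) ^ (r - 1)) := by
  rcases eq_or_ne (b + a) 0 with h | h
  · rw [h, NNReal.zero_rpow (by linarith)]
    exact zero_le
  have hy : 0 < b + a := pos_iff_ne_zero.mpr h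
  rw [← NNReal.coe_le_coe]
  push_cast
  rw [Real.coe_toNNReal r (by linarith)]
  have hy' : (0 : ℝ) < b + a := by exact_mod_cast hy
  have hb : (b : ℝ) / (b + a) = 1 + -(a / (b + a)) := by
    field_simp
    ring
  -- Bernoulli's inequality at `-a/(a+b)`, scaled by `(a+b)^r`: the convex function `y^r` lies above
  -- its tangent at `a+b`.
  have key := one_add_mul_self_le_rpow_one_add (s := -((a : ℝ) / (b + a))) (by
    rw [neg_le_neg_iff, div_le_one hy']
    linarith [b.coe_nonneg]) hr
  rw [← hb, Real.div_rpow b.coe_nonneg hy'.le, le_div_iff₀ (Real.rpow_pos_of_pos hy' r)] at key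
  rw [Real.rpow_sub_one hy'.ne']
  have : (1 + r * -((a : ℝ) / (b + a))) * ((b : ℝ) + a) ^ r
    = ((b : ℝ) + a) ^ r - r * (a * (((b : ℝ) + a) ^ r / (b + a))) := by
    field_simp
    ring
  linarith

theorem NNReal.rpow_add_mul_le_add_rpow {r : ℝ} (hr0 : 0 ≤ r) (hr : r ≤ 1) (a b : ℝ≥0) :
    b ^ r + r.toNNReal * (a * (b + a) ^ (r - 1)) ≤ (b + a) ^ r := by
  rcases eq_or_ne (b + a) 0 with h | h
  · obtain ⟨rfl, rfl⟩ := add_eq_zero.mp h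
    simp
  have hy : 0 < b + a := pos_iff_ne_zero.mpr h
  rw [← NNReal.coe_le_coe]
  push_cast
  rw [Real.coe_toNNReal r (by linarith)]
  have hy' : (0 : ℝ) < b + a := by exact_mod_cast hy
  have hb : (b : ℝ) / (b + a) = 1 + -(a / (b + a)) := by
    field_simp
    ring
  have key := rpow_one_add_le_one_add_mul_self (s := -((a : ℝ) / (b + a))) (by
    rw [neg_le_neg_iff, div_le_one hy']
    linarith [b.coe_nonneg]) hr0 hr
  rw [← hb, Real.div_rpow b.coe_nonneg hy'.le, div_le_iff₀ (Real.rpow_pos_of_pos hy' r)] at key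
  rw [Real.rpow_sub_one hy'.ne']
  have : (1 + r * -((a : ℝ) / (b + a))) * ((b : ℝ) + a) ^ r
    = ((b : ℝ) + a) ^ r - r * (a * (((b : ℝ) + a) ^ r / (b + a))) := by
    field_simp
    ring
  linarith

theorem ENNReal.add_rpow_le_rpow_add_mul {r : ℝ} (hr : 1 ≤ r) (a b : ℝ≥0∞) :
    (b + a) ^ r ≤ b ^ r + ENNReal.ofReal r * (a * (b + a) ^ (r - 1)) := by
  have hr0 : 0 < r := by linarith
  rcases eq_or_ne b ⊤ with rfl | hb
  · simp [ENNReal.top_rpow_of_pos hr0]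
  rcases eq_or_ne a ⊤ with rfl | ha
  · have : (⊤ : ℝ≥0∞) ^ (r - 1) ≠ 0 := by
      rcases hr.eq_or_lt with rfl | h
      · simp
      · simp [ENNReal.top_rpow_of_pos (sub_pos.mpr h)]
    simp [ENNReal.top_mul this, ENNReal.mul_top, hr0]
  lift a to ℝ≥0 using ha
  lift b to ℝ≥0 using hb
  have := NNReal.add_rpow_le_rpow_add_mul hr a b
  rw [← ENNReal.coe_add, ← ENNReal.coe_rpow_of_nonneg _ (by linarith),
    ← ENNReal.coe_rpow_of_nonneg _ (by linarith), ← ENNReal.coe_rpow_of_nonneg _ (by linarith),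
    ENNReal.ofReal]
  exact_mod_cast this

/-- The tangent inequality telescopes. The partial sum in the `k`-th term includes `a k` itself,
which does no harm to measurability when `a` is predictable. -/
theorem ENNReal.sum_rpow_le_mul_sum {r : ℝ} (hr : 1 ≤ r) (a : ℕ → ℝ≥0∞) (n : ℕ) :
    (∑ i ∈ Finset.range n, a i) ^ r ≤ ENNReal.ofReal r *
      ∑ k ∈ Finset.range n, a k * (∑ i ∈ Finset.range (k + 1), a i) ^ (r - 1) := by
  induction n with
  | zero => simp [ENNReal.zero_rpow_of_pos (show 0 < r by linarith)]
  | succ n ih =>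
    rw [Finset.sum_range_succ a n, Finset.sum_range_succ, mul_add]
    refine (ENNReal.add_rpow_le_rpow_add_mul hr _ _).trans ?_
    rw [Finset.sum_range_succ a n]
    gcongr

/-- Division by `x ^ (1 - θ)`, legitimate because `x` is finite. Both Doob inequalities are closed
in this way after Hölder. -/
theorem ENNReal.le_rpow_mul_of_le_mul_rpow {x y c : ℝ≥0∞} {θ : ℝ} (hθ : 0 < θ)
    (hx : x ≠ ⊤) (h : x ≤ c * (y ^ θ * x ^ (1 - θ))) : x ≤ c ^ θ⁻¹ * y := by
  rcases eq_or_ne x 0 with rfl | hx0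
  · exact zero_le
  have h1 : x = x ^ θ * x ^ (1 - θ) := by
    rw [← ENNReal.rpow_add _ _ hx0 hx, add_sub_cancel, ENNReal.rpow_one]
  have h2 : x ^ (1 - θ) ≠ 0 := by simp [ENNReal.rpow_eq_zero_iff, hx0, hx]
  have h3 : x ^ (1 - θ) ≠ ⊤ := by simp [ENNReal.rpow_eq_top_iff, hx0, hx]
  have h4 : x ^ θ ≤ c * y ^ θ := by
    rw [← ENNReal.mul_le_mul_iff_left h2 h3, ← h1, mul_assoc]
    exact h
  calc x = (x ^ θ) ^ θ⁻¹ := by rw [← ENNReal.rpow_mul, mul_inv_cancel₀ hθ.ne', ENNReal.rpow_one]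
    _ ≤ (c * y ^ θ) ^ θ⁻¹ := by gcongr
    _ = c ^ θ⁻¹ * y := by
      rw [ENNReal.mul_rpow_of_nonneg _ _ (by positivity), ← ENNReal.rpow_mul,
        mul_inv_cancel₀ hθ.ne', ENNReal.rpow_one]

/-! ### Doob's maximal inequality and its dual -/

theorem MeasureTheory.lintegral_mul_rpow_sub_one_le {Ω : Type w} [MeasurableSpace Ω]
    {P : Measure Ω} {r : ℝ} (hr : 1 ≤ r) {f g : Ω → ℝ≥0∞} (hf : AEMeasurable f P)
    (hg : AEMeasurable g P) :
    ∫⁻ ω, f ω * g ω ^ (r - 1) ∂P ≤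
      (∫⁻ ω, f ω ^ r ∂P) ^ r⁻¹ * (∫⁻ ω, g ω ^ r ∂P) ^ (1 - r⁻¹) := by
  have hr0 : 0 < r := by linarith
  have := ENNReal.lintegral_mul_norm_pow_le (μ := P) (hf.pow_const r) (hg.pow_const r)
    (p := r⁻¹) (q := 1 - r⁻¹) (by positivity) (sub_nonneg.mpr (inv_le_one_of_one_le₀ hr))
    (by ring)
  refine le_of_eq_of_le ?_ this
  refine lintegral_congr fun ω => ?_
  rw [← ENNReal.rpow_mul, ← ENNReal.rpow_mul, mul_inv_cancel₀ hr0.ne', ENNReal.rpow_one, mul_sub,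
    mul_inv_cancel₀ hr0.ne', mul_one]

/-- The dual form of Doob's inequality. -/
theorem MeasureTheory.lintegral_sum_rpow_le_of_predictable {Ω : Type w} {mΩ : MeasurableSpace Ω}
    {P : Measure Ω} {ℱ : Filtration ℕ mΩ} {r : ℝ} (hr : 1 ≤ r) {α a : ℕ → Ω → ℝ≥0∞}
    (hα : ∀ k, Measurable[ℱ k] (α k)) (ha : ∀ k, AEMeasurable (a k) P)
    (h : ∀ k, ∀ W : Ω → ℝ≥0∞, Measurable[ℱ k] W → ∫⁻ ω, α k ω * W ω ∂P ≤ ∫⁻ ω, a k ω * W ω ∂P)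
    (n : ℕ) (hfin : ∫⁻ ω, (∑ i ∈ Finset.range n, α i ω) ^ r ∂P ≠ ⊤) :
    ∫⁻ ω, (∑ i ∈ Finset.range n, α i ω) ^ r ∂P ≤
      ENNReal.ofReal r ^ r * ∫⁻ ω, (∑ i ∈ Finset.range n, a i ω) ^ r ∂P := by
  have hr0 : 0 < r := by linarith
  have hα' : ∀ k, Measurable (α k) := fun k => (hα k).mono (ℱ.le k) le_rfl
  have hA : ∀ k, Measurable fun ω => ∑ i ∈ Finset.range k, α i ω :=
    fun k => Finset.measurable_fun_sum _ fun i _ => hα' i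
  have key : ∫⁻ ω, (∑ i ∈ Finset.range n, α i ω) ^ r ∂P ≤ ENNReal.ofReal r *
      ((∫⁻ ω, (∑ i ∈ Finset.range n, a i ω) ^ r ∂P) ^ r⁻¹ *
        (∫⁻ ω, (∑ i ∈ Finset.range n, α i ω) ^ r ∂P) ^ (1 - r⁻¹)) := by
    calc ∫⁻ ω, (∑ i ∈ Finset.range n, α i ω) ^ r ∂P
        ≤ ∫⁻ ω, ENNReal.ofReal r * ∑ k ∈ Finset.range n,
            α k ω * (∑ i ∈ Finset.range (k + 1), α i ω) ^ (r - 1) ∂P :=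
          lintegral_mono fun ω => ENNReal.sum_rpow_le_mul_sum hr _ _
      _ = ENNReal.ofReal r * ∑ k ∈ Finset.range n,
            ∫⁻ ω, α k ω * (∑ i ∈ Finset.range (k + 1), α i ω) ^ (r - 1) ∂P := by
          rw [lintegral_const_mul _ (by fun_prop), lintegral_finsetSum _ (by fun_prop)]
      _ ≤ ENNReal.ofReal r * ∑ k ∈ Finset.range n,
            ∫⁻ ω, a k ω * (∑ i ∈ Finset.range n, α i ω) ^ (r - 1) ∂P := by
          refine mul_le_mul_right (Finset.sum_le_sum fun k hk => ?_) _
          -- The partial sum through `α k` is still `ℱ k`-measurable, so it can serve as the test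
          -- function `W`; only afterwards is it enlarged to the full sum.
          refine (h k _ ?_).trans ?_
          · refine (Finset.measurable_fun_sum _ fun i hi => ?_).pow_const _
            exact (hα i).mono (ℱ.mono (Finset.mem_range_succ_iff.mp hi)) le_rfl
          · refine lintegral_mono fun ω => ?_
            gcongr
            exact Finset.mem_range.mp hk
      _ = ENNReal.ofReal r * ∫⁻ ω, (∑ k ∈ Finset.range n, a k ω) *
            (∑ i ∈ Finset.range n, α i ω) ^ (r - 1) ∂P := by
          simp_rw [Finset.sum_mul]
          rw [lintegral_finsetSum' (f := fun k ω => a k ω *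
            (∑ i ∈ Finset.range n, α i ω) ^ (r - 1)) _
            (fun k _ => (ha k).mul ((hA n).pow_const _).aemeasurable)]
      _ ≤ _ := by
          gcongr
          exact lintegral_mul_rpow_sub_one_le hr
            (Finset.aemeasurable_fun_sum _ fun i _ => ha i) (hA n).aemeasurable
  simpa using ENNReal.le_rpow_mul_of_le_mul_rpow (inv_pos.mpr hr0) hfin key

/-- For `x > m` this is Young's inequality for `x * m ^ (p - 1)`, multiplied by the conjugate
exponent. It is the pathwise form of Doob's inequality: the correction vanishes unless `x` sets a
new maximum. -/
theorem NNReal.rpow_le_add_mul_sub {p : ℝ} (hp : 1 < p) {m x : ℝ≥0} :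
    max m x ^ p ≤ m ^ p +
      (p / (p - 1)).toNNReal * (x * (max m x ^ (p - 1) - m ^ (p - 1))) := by
  rcases le_total x m with h | h
  · simp [max_eq_left h]
  rw [max_eq_right h, ← NNReal.coe_le_coe]
  have h1 : m ^ (p - 1) ≤ x ^ (p - 1) := NNReal.rpow_le_rpow h (by linarith)
  push_cast [NNReal.coe_sub h1]
  have hp1 : 0 < p - 1 := by linarith
  rw [Real.coe_toNNReal _ (by positivity)]
  have hy := Real.young_inequality_of_nonneg x.coe_nonneg
    (show (0 : ℝ) ≤ (m : ℝ) ^ (p - 1) by positivity)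
    (Real.HolderConjugate.conjExponent hp)
  rw [Real.conjExponent, ← Real.rpow_mul m.coe_nonneg, mul_div_cancel₀ _ hp1.ne'] at hy
  have hx : (x : ℝ) * (x : ℝ) ^ (p - 1) = (x : ℝ) ^ p := by
    rcases eq_or_ne (x : ℝ) 0 with h0 | h0
    · rw [h0, Real.zero_rpow (show p ≠ 0 by linarith), zero_mul]
    · rw [Real.rpow_sub_one h0]
      field_simp
  rw [mul_sub, hx]
  have := mul_le_mul_of_nonneg_left hy (show 0 ≤ p / (p - 1) by positivity)
  have e : p / (p - 1) * ((x : ℝ) ^ p / p + (m : ℝ) ^ p / (p / (p - 1))) =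
    (p / (p - 1)) * (x : ℝ) ^ p - (x : ℝ) ^ p + (m : ℝ) ^ p := by
    field_simp
    ring
  change _ ≤ p / (p - 1) * ((x : ℝ) ^ p / p + (m : ℝ) ^ p / (p / (p - 1))) at this
  rw [e] at this
  change p / (p - 1) * ((x : ℝ) * (m : ℝ) ^ (p - 1)) ≤ _ at this
  linarith

/-- The running maximum `max (x 0, …, x n)`. -/
def runningMax (x : ℕ → ℝ≥0) (n : ℕ) : ℝ≥0 :=
  (Finset.range (n + 1)).sup x

theorem runningMax_zero (x : ℕ → ℝ≥0) : runningMax x 0 = x 0 := by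
  simp [runningMax]

theorem runningMax_succ (x : ℕ → ℝ≥0) (n : ℕ) :
    runningMax x (n + 1) = max (runningMax x n) (x (n + 1)) := by
  rw [runningMax, Finset.range_add_one, Finset.sup_insert, sup_comm]
  rfl

theorem runningMax_mono (x : ℕ → ℝ≥0) : Monotone (runningMax x) := fun _ _ h =>
  Finset.sup_mono (Finset.range_subset_range.mpr (by omega))

theorem le_runningMax (x : ℕ → ℝ≥0) {k n : ℕ} (h : k ≤ n) : x k ≤ runningMax x n :=
  Finset.le_sup (f := x) (Finset.mem_range.mpr (by omega))

theorem measurable_runningMax {Ω : Type w} {m : MeasurableSpace Ω} {x : ℕ → Ω → ℝ≥0} {n : ℕ}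
    (hx : ∀ k ≤ n, Measurable (x k)) : Measurable fun ω => runningMax (fun k => x k ω) n := by
  induction n with
  | zero =>
    simp_rw [runningMax_zero]
    exact hx 0 le_rfl
  | succ n ih =>
    simp_rw [runningMax_succ]
    exact (ih fun k hk => hx k (by omega)).max (hx _ le_rfl)

theorem runningMax_rpow_le {p : ℝ} (hp : 1 < p) (x : ℕ → ℝ≥0) (h0 : x 0 = 0) (n : ℕ) :
    runningMax x n ^ p ≤ (p / (p - 1)).toNNReal * ∑ k ∈ Finset.range n,
      x (k + 1) * (runningMax x (k + 1) ^ (p - 1) - runningMax x k ^ (p - 1)) := by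
  induction n with
  | zero => simp [runningMax_zero, h0, NNReal.zero_rpow (show p ≠ 0 by linarith)]
  | succ n ih =>
    rw [Finset.sum_range_succ, mul_add, runningMax_succ]
    exact (NNReal.rpow_le_add_mul_sub hp).trans (by gcongr)

/-- Doob's maximal inequality in `L^p`, for a nonnegative process `x` started at `0` which is
dominated by its terminal value in the sense of a submartingale. -/
theorem MeasureTheory.lintegral_runningMax_rpow_le {Ω : Type w} {mΩ : MeasurableSpace Ω}
    {P : Measure Ω} {ℱ : Filtration ℕ mΩ} {p : ℝ} (hp : 1 < p) {x : ℕ → Ω → ℝ≥0}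
    (hx : ∀ k, Measurable[ℱ k] (x k)) (h0 : ∀ ω, x 0 ω = 0) (n : ℕ)
    (h : ∀ k ≤ n, ∀ W : Ω → ℝ≥0∞, Measurable[ℱ k] W →
      ∫⁻ ω, x k ω * W ω ∂P ≤ ∫⁻ ω, x n ω * W ω ∂P)
    (hfin : ∫⁻ ω, (runningMax (fun k => x k ω) n : ℝ≥0∞) ^ p ∂P ≠ ⊤) :
    ∫⁻ ω, (runningMax (fun k => x k ω) n : ℝ≥0∞) ^ p ∂P ≤
      ENNReal.ofReal (p / (p - 1)) ^ p * ∫⁻ ω, (x n ω : ℝ≥0∞) ^ p ∂P := by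
  have hp0 : 0 < p := by linarith
  have hx' : ∀ k, Measurable (x k) := fun k => (hx k).mono (ℱ.le k) le_rfl
  have hm : ∀ k, Measurable[ℱ k] fun ω => runningMax (fun k => x k ω) k := fun k =>
    measurable_runningMax fun i hi => (hx i).mono (ℱ.mono hi) le_rfl
  have hm' : ∀ k, Measurable fun ω => runningMax (fun k => x k ω) k :=
    fun k => (hm k).mono (ℱ.le k) le_rfl
  have key : ∫⁻ ω, (runningMax (fun k => x k ω) n : ℝ≥0∞) ^ p ∂P ≤
      ENNReal.ofReal (p / (p - 1)) * ((∫⁻ ω, (x n ω : ℝ≥0∞) ^ p ∂P) ^ p⁻¹ *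
        (∫⁻ ω, (runningMax (fun k => x k ω) n : ℝ≥0∞) ^ p ∂P) ^ (1 - p⁻¹)) := by
    calc ∫⁻ ω, (runningMax (fun k => x k ω) n : ℝ≥0∞) ^ p ∂P
        ≤ ∫⁻ ω, ENNReal.ofReal (p / (p - 1)) * ∑ k ∈ Finset.range n, (x (k + 1) ω : ℝ≥0∞) *
            ((runningMax (fun k => x k ω) (k + 1) ^ (p - 1) -
              runningMax (fun k => x k ω) k ^ (p - 1) : ℝ≥0) : ℝ≥0∞) ∂P := by
          refine lintegral_mono fun ω => ?_
          have := runningMax_rpow_le hp (fun k => x k ω) (h0 ω) n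
          beta_reduce
          rw [← ENNReal.coe_rpow_of_nonneg _ hp0.le, ENNReal.ofReal]
          refine (ENNReal.coe_le_coe.mpr this).trans_eq ?_
          push_cast
          rfl
      _ = ENNReal.ofReal (p / (p - 1)) * ∑ k ∈ Finset.range n, ∫⁻ ω, (x (k + 1) ω : ℝ≥0∞) *
            ((runningMax (fun k => x k ω) (k + 1) ^ (p - 1) -
              runningMax (fun k => x k ω) k ^ (p - 1) : ℝ≥0) : ℝ≥0∞) ∂P := by
          rw [lintegral_const_mul _ (by fun_prop), lintegral_finsetSum _ (by fun_prop)]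
      _ ≤ ENNReal.ofReal (p / (p - 1)) * ∑ k ∈ Finset.range n, ∫⁻ ω, (x n ω : ℝ≥0∞) *
            ((runningMax (fun k => x k ω) (k + 1) ^ (p - 1) -
              runningMax (fun k => x k ω) k ^ (p - 1) : ℝ≥0) : ℝ≥0∞) ∂P := by
          refine mul_le_mul_right (Finset.sum_le_sum fun k hk => ?_) _
          -- The increment of the maximum's power is nonnegative and known at time `k + 1`, so the
          -- submartingale property replaces `x (k + 1)` by `x n`. The increments then telescope.
          refine h (k + 1) (Finset.mem_range.mp hk) _ ?_
          exact (((hm (k + 1)).pow_const _).sub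
            (((hm k).mono (ℱ.mono k.le_succ) le_rfl).pow_const _)).coe_nnreal_ennreal
      _ = ENNReal.ofReal (p / (p - 1)) * ∫⁻ ω, (x n ω : ℝ≥0∞) * ∑ k ∈ Finset.range n,
            ((runningMax (fun k => x k ω) (k + 1) ^ (p - 1) -
              runningMax (fun k => x k ω) k ^ (p - 1) : ℝ≥0) : ℝ≥0∞) ∂P := by
          rw [← lintegral_finsetSum _ (by fun_prop)]
          simp_rw [Finset.mul_sum]
      _ ≤ ENNReal.ofReal (p / (p - 1)) * ∫⁻ ω, (x n ω : ℝ≥0∞) *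
            (runningMax (fun k => x k ω) n : ℝ≥0∞) ^ (p - 1) ∂P := by
          gcongr with ω
          rw [← ENNReal.coe_rpow_of_nonneg _ (by linarith), ← ENNReal.ofNNReal_finsetSum,
            ENNReal.coe_le_coe, Finset.sum_range_tsub
              (f := fun k => runningMax (fun k => x k ω) k ^ (p - 1))]
          · exact tsub_le_self
          · exact fun i j hij => NNReal.rpow_le_rpow (runningMax_mono _ hij) (by linarith)
      _ ≤ _ := by
          gcongr
          exact lintegral_mul_rpow_sub_one_le hp.le (hx' n).coe_nnreal_ennreal.aemeasurable
            (hm' n).coe_nnreal_ennreal.aemeasurable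
  simpa using ENNReal.le_rpow_mul_of_le_mul_rpow (inv_pos.mpr hp0) hfin key

/-! ### Conditional expectations and martingale differences -/

/-- The hypothesis is an inequality between the measures with densities `f` and `g`, trimmed to `m`;
integrating `W` against them gives the claim. -/
theorem MeasureTheory.lintegral_mul_le_of_setLIntegral_le {Ω : Type w} {m mΩ : MeasurableSpace Ω}
    (hm : m ≤ mΩ) {P : Measure Ω} {f g : Ω → ℝ≥0∞} (hf : AEMeasurable f P) (hg : AEMeasurable g P)
    (h : ∀ A, MeasurableSet[m] A → ∫⁻ ω in A, f ω ∂P ≤ ∫⁻ ω in A, g ω ∂P)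
    {W : Ω → ℝ≥0∞} (hW : Measurable[m] W) :
    ∫⁻ ω, f ω * W ω ∂P ≤ ∫⁻ ω, g ω * W ω ∂P := by
  have hW' := hW.mono hm le_rfl
  have e : ∀ {f : Ω → ℝ≥0∞}, AEMeasurable f P →
      ∫⁻ ω, f ω * W ω ∂P = ∫⁻ ω, W ω ∂((P.withDensity f).trim hm) := fun {f} hf => by
    rw [lintegral_trim hm hW, lintegral_withDensity_eq_lintegral_mul₀ hf hW'.aemeasurable]
    rfl
  rw [e hf, e hg]
  refine lintegral_mono' (Measure.le_iff.mpr fun A hA => ?_) le_rfl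
  rw [trim_measurableSet_eq hm hA, trim_measurableSet_eq hm hA, withDensity_apply _ (hm _ hA),
    withDensity_apply _ (hm _ hA)]
  exact h A hA

theorem MeasureTheory.lintegral_enorm_condExp_mul_le {Ω : Type w} {m mΩ : MeasurableSpace Ω}
    (hm : m ≤ mΩ) {P : Measure Ω} {X : Type u} [NormedAddCommGroup X] [NormedSpace ℝ X]
    [CompleteSpace X] {f : Ω → X} (hf : Integrable f P) {W : Ω → ℝ≥0∞} (hW : Measurable[m] W) :
    ∫⁻ ω, ‖P[f | m] ω‖ₑ * W ω ∂P ≤ ∫⁻ ω, ‖f ω‖ₑ * W ω ∂P := by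
  refine lintegral_mul_le_of_setLIntegral_le hm integrable_condExp.1.enorm hf.1.enorm
    (fun A hA => ?_) hW
  rw [← ofReal_integral_norm_eq_lintegral_enorm integrable_condExp.integrableOn,
    ← ofReal_integral_norm_eq_lintegral_enorm hf.integrableOn]
  exact ENNReal.ofReal_le_ofReal (setIntegral_norm_condExp_le hA f)

/-- A martingale difference sequence: `d i` is measurable with respect to `ℱ (i + 1)` and has
vanishing conditional expectation given `ℱ i`. -/
structure IsMartingaleDifference {Ω : Type w} {mΩ : MeasurableSpace Ω} (P : Measure Ω)
    (ℱ : Filtration ℕ mΩ) {X : Type u} [NormedAddCommGroup X] [NormedSpace ℝ X] [CompleteSpace X]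
    (d : ℕ → Ω → X) : Prop where
  adapted : ∀ i, StronglyMeasurable[ℱ (i + 1)] (d i)
  integrable : ∀ i, Integrable (d i) P
  condExp_eq_zero : ∀ i, P[d i | ℱ i] =ᵐ[P] 0

/-- Multiplication by predictable weights preserves martingale differences. Only the weighted
differences need finite `s`-th moments, so cotype becomes usable for differences that are merely in
`L^p` with `p < s`. -/
theorem HasMartingaleCotype.exists_weighted {X : Type u} [NormedAddCommGroup X] [NormedSpace ℝ X]
    [CompleteSpace X] {s : ℝ} (hs : 0 < s) (hX : HasMartingaleCotype.{u, w} X s) :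
    ∃ K : ℝ≥0, ∀ (Ω : Type w) [mΩ : MeasurableSpace Ω] (P : Measure Ω) [IsProbabilityMeasure P]
      (ℱ : Filtration ℕ mΩ) (d : ℕ → Ω → X) (_ : IsMartingaleDifference P ℱ d) (W : ℕ → Ω → ℝ)
      (_ : ∀ i, StronglyMeasurable[ℱ i] (W i)) (n : ℕ)
      (_ : ∀ i < n, ∫⁻ ω, ‖W i ω • d i ω‖ₑ ^ s ∂P ≠ ⊤) (_ : 1 ≤ s),
      ∫⁻ ω, ∑ i ∈ Finset.range n, ‖W i ω • d i ω‖ₑ ^ s ∂P ≤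
        K * ∫⁻ ω, ‖∑ i ∈ Finset.range n, W i ω • d i ω‖ₑ ^ s ∂P := by
  obtain ⟨C, hC⟩ := hX
  refine ⟨C ^ s, fun Ω mΩ P _ ℱ d hd W hW n hfin hs1 => ?_⟩
  have hmeas : ∀ i, StronglyMeasurable[ℱ (i + 1)] fun ω => W i ω • d i ω := fun i =>
    ((hW i).mono (ℱ.mono i.le_succ)).smul (hd.adapted i)
  have hmeas' : ∀ i, StronglyMeasurable fun ω => W i ω • d i ω := fun i =>
    (hmeas i).mono (ℱ.le _)
  have hs0 : ENNReal.ofReal s ≠ 0 := by simpa using hs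
  have hLp : ∀ i < n, MemLp (fun ω => W i ω • d i ω) (ENNReal.ofReal s) P := fun i hi => by
    refine ⟨(hmeas' i).aestronglyMeasurable, ?_⟩
    rw [eLpNorm_lt_top_iff_lintegral_rpow_enorm_lt_top hs0 ENNReal.ofReal_ne_top,
      ENNReal.toReal_ofReal hs.le]
    exact (hfin i hi).lt_top
  have h := hC Ω P ℱ n (fun i ω => W i ω • d i ω) (fun i _ => hmeas i) hLp fun i hi => by
    refine (condExp_smul_of_aestronglyMeasurable_left (hW i).aestronglyMeasurable
      ((hLp i hi).integrable (by simpa using hs1)) (hd.integrable i)).trans ?_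
    filter_upwards [hd.condExp_eq_zero i] with ω hω
    simp [hω]
  rw [lintegral_finsetSum _ fun i _ => (hmeas' i).enorm.pow_const _]
  have h' := ENNReal.rpow_le_rpow h hs.le
  rw [ENNReal.mul_rpow_of_nonneg _ _ hs.le, ← ENNReal.rpow_mul, ← ENNReal.rpow_mul,
    one_div_mul_cancel hs.ne', ENNReal.rpow_one, ENNReal.rpow_one,
    ← ENNReal.coe_rpow_of_nonneg _ hs.le] at h'
  exact h'

/-- Abel summation: a transform costs the last weight plus the variation of the weights, each
multiplied by partial sums. -/
theorem norm_sum_smul_le_of_partialSum {X : Type u} [NormedAddCommGroup X] [NormedSpace ℝ X]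
    (a : ℕ → ℝ) (d : ℕ → X) (n : ℕ) :
    ‖∑ k ∈ Finset.range n, a k • d k‖ ≤ |a n| * ‖∑ k ∈ Finset.range n, d k‖ +
      ∑ k ∈ Finset.range n, |a k - a (k + 1)| * ‖∑ i ∈ Finset.range (k + 1), d i‖ := by
  have h : ∑ k ∈ Finset.range n, a k • d k = a n • (∑ k ∈ Finset.range n, d k) +
      ∑ k ∈ Finset.range n, (a k - a (k + 1)) • ∑ i ∈ Finset.range (k + 1), d i := by
    induction n with
    | zero => simp
    | succ n ih =>
      rw [Finset.sum_range_succ, ih, Finset.sum_range_succ _ n,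
        Finset.sum_range_succ (fun k => (a k - a (k + 1)) • ∑ i ∈ Finset.range (k + 1), d i),
        Finset.sum_range_succ d]
      module
  rw [h]
  refine (norm_add_le _ _).trans (add_le_add ?_ ((norm_sum_le _ _).trans ?_))
  · rw [norm_smul, Real.norm_eq_abs]
  · exact Finset.sum_le_sum fun k _ => by rw [norm_smul, Real.norm_eq_abs]

theorem MeasureTheory.MemLp.lintegral_sum_enorm_rpow_ne_top {Ω : Type w} [MeasurableSpace Ω]
    {P : Measure Ω} {X : Type u} [NormedAddCommGroup X] {p : ℝ} (hp : 0 < p) {f : ℕ → Ω → X}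
    (n : ℕ) (hf : ∀ i < n, MemLp (f i) (ENNReal.ofReal p) P) :
    ∫⁻ ω, (∑ i ∈ Finset.range n, ‖f i ω‖ₑ) ^ p ∂P ≠ ⊤ := by
  have h : MemLp (fun ω => ∑ i ∈ Finset.range n, ‖f i ω‖) (ENNReal.ofReal p) P :=
    memLp_finsetSum _ fun i hi => (hf i (Finset.mem_range.mp hi)).norm
  have := lintegral_rpow_enorm_lt_top_of_eLpNorm_lt_top (by simpa using hp) ENNReal.ofReal_ne_top
    h.eLpNorm_lt_top
  rw [ENNReal.toReal_ofReal hp.le] at this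
  refine ((lintegral_congr fun ω => ?_).trans_lt this).ne
  congr 1
  rw [Real.enorm_of_nonneg (by positivity), ENNReal.ofReal_sum_of_nonneg fun _ _ => norm_nonneg _]
  simp

namespace IsMartingaleDifference

variable {Ω : Type w} {mΩ : MeasurableSpace Ω} {P : Measure Ω} {ℱ : Filtration ℕ mΩ} {X : Type u}
  [NormedAddCommGroup X] {d : ℕ → Ω → X}

theorem runningMax_le_sum (n : ℕ) (ω : Ω) :
    (runningMax (fun k => ‖∑ i ∈ Finset.range k, d i ω‖₊) n : ℝ≥0∞) ≤
      ∑ i ∈ Finset.range n, ‖d i ω‖ₑ := by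
  have : runningMax (fun k => ‖∑ i ∈ Finset.range k, d i ω‖₊) n ≤
      ∑ i ∈ Finset.range n, ‖d i ω‖₊ := by
    refine Finset.sup_le fun k hk => (nnnorm_sum_le _ _).trans ?_
    exact Finset.sum_le_sum_of_subset (Finset.range_subset_range.mpr
      (Finset.mem_range_succ_iff.mp hk))
  refine (ENNReal.coe_le_coe.mpr this).trans_eq ?_
  push_cast
  rfl

theorem lintegral_runningMax_rpow_ne_top {p : ℝ} (hp : 1 < p) (n : ℕ)
    (hLp : ∀ i < n, MemLp (d i) (ENNReal.ofReal p) P) :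
    ∫⁻ ω, (runningMax (fun k => ‖∑ i ∈ Finset.range k, d i ω‖₊) n : ℝ≥0∞) ^ p ∂P ≠ ⊤ :=
  ((lintegral_mono fun ω => ENNReal.rpow_le_rpow (runningMax_le_sum n ω)
    (by linarith)).trans_lt
      (MemLp.lintegral_sum_enorm_rpow_ne_top (by linarith) n hLp).lt_top).ne

variable [NormedSpace ℝ X] [CompleteSpace X]

theorem stronglyMeasurable_sum (hd : IsMartingaleDifference P ℱ d) (n : ℕ) :
    StronglyMeasurable[ℱ n] fun ω => ∑ i ∈ Finset.range n, d i ω :=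
  Finset.stronglyMeasurable_fun_sum _ fun i hi =>
    (hd.adapted i).mono (ℱ.mono (Finset.mem_range.mp hi))

theorem measurable_nnnorm_sum (hd : IsMartingaleDifference P ℱ d) (n : ℕ) :
    Measurable[ℱ n] fun ω => ‖∑ i ∈ Finset.range n, d i ω‖₊ :=
  (hd.stronglyMeasurable_sum n).nnnorm.measurable

theorem measurable_runningMax (hd : IsMartingaleDifference P ℱ d) (n : ℕ) :
    Measurable[ℱ n] fun ω => runningMax (fun k => ‖∑ i ∈ Finset.range k, d i ω‖₊) n :=
  _root_.measurable_runningMax fun k hk =>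
    (hd.measurable_nnnorm_sum k).mono (ℱ.mono hk) le_rfl

variable [IsProbabilityMeasure P]

theorem condExp_sum (hd : IsMartingaleDifference P ℱ d) {k n : ℕ} (h : k ≤ n) :
    P[fun ω => ∑ i ∈ Finset.range n, d i ω | ℱ k] =ᵐ[P]
      fun ω => ∑ i ∈ Finset.range k, d i ω := by
  have e : (fun ω => ∑ i ∈ Finset.range n, d i ω) = ∑ i ∈ Finset.range n, d i := by
    ext ω
    simp
  rw [e]
  refine (condExp_finsetSum (fun i _ => hd.integrable i) _).trans ?_
  have h1 : ∀ i, ∀ᵐ ω ∂P, (P[d i | ℱ k]) ω = if i < k then d i ω else 0 := fun i => by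
    split_ifs with hi
    · rw [condExp_of_stronglyMeasurable (ℱ.le k) ((hd.adapted i).mono (ℱ.mono hi))
        (hd.integrable i)]
      exact ae_of_all _ fun _ => rfl
    · have h2 := condExp_condExp_of_le (μ := P) (f := d i) (ℱ.mono (not_lt.mp hi)) (ℱ.le i)
      have h3 : P[P[d i | ℱ i] | ℱ k] =ᵐ[P] P[(0 : Ω → X) | ℱ k] :=
        condExp_congr_ae (hd.condExp_eq_zero i)
      rw [condExp_zero] at h3
      exact h2.symm.trans h3
  filter_upwards [ae_all_iff.mpr h1] with ω hω
  rw [Finset.sum_apply, Finset.sum_congr rfl fun i _ => hω i, ← Finset.sum_filter]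
  congr 1
  ext i
  simp only [Finset.mem_filter, Finset.mem_range]
  omega

theorem lintegral_enorm_sum_mul_le (hd : IsMartingaleDifference P ℱ d) {k n : ℕ} (h : k ≤ n)
    {W : Ω → ℝ≥0∞} (hW : Measurable[ℱ k] W) :
    ∫⁻ ω, ‖∑ i ∈ Finset.range k, d i ω‖ₑ * W ω ∂P ≤
      ∫⁻ ω, ‖∑ i ∈ Finset.range n, d i ω‖ₑ * W ω ∂P := by
  refine le_of_eq_of_le (lintegral_congr_ae ?_) (lintegral_enorm_condExp_mul_le (ℱ.le k)
    (integrable_finsetSum _ fun i _ => hd.integrable i) hW)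
  filter_upwards [hd.condExp_sum h] with ω hω
  rw [hω]

/-- Doob's maximal inequality in `L^p`. -/
theorem lintegral_runningMax_rpow_le (hd : IsMartingaleDifference P ℱ d) {p : ℝ} (hp : 1 < p)
    (n : ℕ) (hLp : ∀ i < n, MemLp (d i) (ENNReal.ofReal p) P) :
    ∫⁻ ω, (runningMax (fun k => ‖∑ i ∈ Finset.range k, d i ω‖₊) n : ℝ≥0∞) ^ p ∂P ≤
      ENNReal.ofReal (p / (p - 1)) ^ p * ∫⁻ ω, ‖∑ i ∈ Finset.range n, d i ω‖ₑ ^ p ∂P :=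
  MeasureTheory.lintegral_runningMax_rpow_le hp (x := fun k ω => ‖∑ i ∈ Finset.range k, d i ω‖₊)
    hd.measurable_nnnorm_sum (by simp) n (fun _ hk _ hW => hd.lintegral_enorm_sum_mul_le hk hW)
    (lintegral_runningMax_rpow_ne_top hp n hLp)

end IsMartingaleDifference

/-! ### The `s`-function in `L^p` for `p ≥ s` -/

/-- Young's inequality with a small coefficient on `x`, so that this term can be absorbed. Either `y
^ b ≤ δ * x ^ b`, or `x` is bounded by a multiple of `y`. -/
theorem ENNReal.exists_rpow_mul_rpow_le {a b : ℝ} (ha : 0 ≤ a) (hb : 0 < b) (δ : ℝ≥0)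
    (hδ : δ ≠ 0) : ∃ C : ℝ≥0, ∀ x y : ℝ≥0∞, x ^ a * y ^ b ≤ δ * x ^ (a + b) + C * y ^ (a + b) := by
  refine ⟨(δ⁻¹ ^ b⁻¹) ^ a, fun x y => ?_⟩
  rw [ENNReal.rpow_add_of_nonneg _ _ ha hb.le, ENNReal.rpow_add_of_nonneg _ _ ha hb.le]
  rcases le_total (y ^ b) (δ * x ^ b) with h | h
  · refine le_add_right ?_
    calc x ^ a * y ^ b ≤ x ^ a * (δ * x ^ b) := by gcongr
      _ = _ := by ring
  · refine le_add_left ?_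
    have h1 : x ≤ (δ⁻¹ ^ b⁻¹ : ℝ≥0) * y := by
      have h2 : x ^ b ≤ (δ⁻¹ : ℝ≥0) * y ^ b := by
        calc x ^ b = (δ⁻¹ : ℝ≥0) * (δ * x ^ b) := by
              rw [← mul_assoc, ← ENNReal.coe_mul, inv_mul_cancel₀ hδ, ENNReal.coe_one, one_mul]
          _ ≤ _ := by gcongr
      have h3 := ENNReal.rpow_le_rpow h2 (inv_nonneg.mpr hb.le)
      rwa [ENNReal.mul_rpow_of_nonneg _ _ (inv_nonneg.mpr hb.le), ← ENNReal.rpow_mul,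
        ← ENNReal.rpow_mul, mul_inv_cancel₀ hb.ne', ENNReal.rpow_one, ENNReal.rpow_one,
        ← ENNReal.coe_rpow_of_nonneg _ (inv_nonneg.mpr hb.le)] at h3
    calc x ^ a * y ^ b ≤ ((δ⁻¹ ^ b⁻¹ : ℝ≥0) * y) ^ a * y ^ b := by gcongr
      _ = _ := by rw [ENNReal.mul_rpow_of_nonneg _ _ ha, ← ENNReal.coe_rpow_of_nonneg _ ha]; ring

theorem ENNReal.le_two_mul_of_le_half_mul_add {x y : ℝ≥0∞} (hx : x ≠ ⊤) (h : x ≤ 2⁻¹ * x + y) :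
    x ≤ 2 * y := by
  have h1 : x = 2⁻¹ * x + 2⁻¹ * x := by
    rw [← add_mul, ENNReal.inv_two_add_inv_two, one_mul]
  have h2 : 2⁻¹ * x ≠ ⊤ := ENNReal.mul_ne_top (by simp) hx
  have h3 : 2⁻¹ * x ≤ y := by
    rw [← ENNReal.add_le_add_iff_left h2, ← h1]
    exact h
  calc x = 2 * (2⁻¹ * x) := by
        rw [← mul_assoc, ENNReal.mul_inv_cancel (by simp) (by simp), one_mul]
    _ ≤ 2 * y := by gcongr

theorem ENNReal.sum_rpow_le_rpow_sum {p : ℝ} (hp : 1 ≤ p) {ι : Type*} (t : Finset ι)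
    (f : ι → ℝ≥0∞) : ∑ i ∈ t, f i ^ p ≤ (∑ i ∈ t, f i) ^ p := by
  classical
  induction t using Finset.induction_on with
  | empty => simp [ENNReal.zero_rpow_of_pos (show 0 < p by linarith)]
  | insert a t ha ih =>
    rw [Finset.sum_insert ha, Finset.sum_insert ha]
    exact (by gcongr : _ ≤ _).trans (ENNReal.add_rpow_le_rpow_add _ _ hp)

theorem nnnorm_le_two_mul_runningMax {X : Type u} [NormedAddCommGroup X] (d : ℕ → X) {k n : ℕ}
    (hk : k < n) :
    ‖d k‖₊ ≤ 2 * runningMax (fun k => ‖∑ i ∈ Finset.range k, d i‖₊) n := by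
  have h : d k = ∑ i ∈ Finset.range (k + 1), d i - ∑ i ∈ Finset.range k, d i := by
    rw [Finset.sum_range_succ, add_sub_cancel_left]
  rw [h, two_mul]
  exact (nnnorm_sub_le _ _).trans (add_le_add
    (le_runningMax (fun k => ‖∑ i ∈ Finset.range k, d i‖₊) hk)
    (le_runningMax (fun k => ‖∑ i ∈ Finset.range k, d i‖₊) hk.le))

/-- The variation of an increasing nonnegative weight is at most its last value, hence the factor
`2`. -/
theorem norm_sum_smul_le_of_monotone {X : Type u} [NormedAddCommGroup X] [NormedSpace ℝ X]
    (a : ℕ → ℝ) (ha : Monotone a) (ha0 : 0 ≤ a 0) (d : ℕ → X) (n : ℕ) :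
    ‖∑ k ∈ Finset.range n, a k • d k‖ ≤
      a n * (2 * runningMax (fun k => ‖∑ i ∈ Finset.range k, d i‖₊) n : ℝ≥0) := by
  set m := runningMax (fun k => ‖∑ i ∈ Finset.range k, d i‖₊) n with hm
  have hM : ∀ k ≤ n, ‖∑ i ∈ Finset.range k, d i‖ ≤ m := fun k hk =>
    NNReal.coe_le_coe.mpr (le_runningMax (fun k => ‖∑ i ∈ Finset.range k, d i‖₊) hk)
  have han : 0 ≤ a n := ha0.trans (ha n.zero_le)
  calc ‖∑ k ∈ Finset.range n, a k • d k‖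
      ≤ |a n| * ‖∑ k ∈ Finset.range n, d k‖ +
        ∑ k ∈ Finset.range n, |a k - a (k + 1)| * ‖∑ i ∈ Finset.range (k + 1), d i‖ :=
        norm_sum_smul_le_of_partialSum a d n
    _ ≤ a n * m + ∑ k ∈ Finset.range n, (a (k + 1) - a k) * m := by
        refine add_le_add ?_ (Finset.sum_le_sum fun k hk => ?_)
        · rw [abs_of_nonneg han]
          exact mul_le_mul_of_nonneg_left (hM n le_rfl) han
        · rw [abs_sub_comm, abs_of_nonneg (sub_nonneg.mpr (ha k.le_succ))]
          exact mul_le_mul_of_nonneg_left (hM _ (Finset.mem_range.mp hk))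
            (sub_nonneg.mpr (ha k.le_succ))
    _ = a n * m + (a n - a 0) * m := by
        rw [← Finset.sum_mul, Finset.sum_range_sub]
    _ ≤ a n * (2 * m : ℝ≥0) := by
        push_cast
        nlinarith [mul_nonneg ha0 m.coe_nonneg]

/-- With `r = p/s` and `S k = ∑ i < k, ‖d i‖^s`, the weights `S k ^ ((r-1)/s)` turn the sum of
`s`-th powers into `∑ S k^(r-1) ‖d k‖^s`. This is comparable to `S n ^ r` up to replacing the
non-predictable `S (k+1)` by `S k`, an error controlled by the maximal function because `‖d k‖ ≤ 2
m`. The transform has norm at most `S n ^ ((r-1)/s) * 2 m`. Young's inequality, absorption of `E (S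
n)^r` and Doob's inequality finish. -/
theorem HasMartingaleCotype.exists_lintegral_rpow_le_of_le {X : Type u} [NormedAddCommGroup X]
    [NormedSpace ℝ X] [CompleteSpace X] {s : ℝ} (hs : 1 ≤ s) (hX : HasMartingaleCotype.{u, w} X s)
    {p : ℝ} (hp : 1 < p) (hsp : s ≤ p) :
    ∃ C : ℝ≥0, ∀ (Ω : Type w) [mΩ : MeasurableSpace Ω] (P : Measure Ω) [IsProbabilityMeasure P]
      (ℱ : Filtration ℕ mΩ) (d : ℕ → Ω → X) (_ : IsMartingaleDifference P ℱ d) (n : ℕ)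
      (_ : ∀ i < n, MemLp (d i) (ENNReal.ofReal p) P),
      ∫⁻ ω, (∑ i ∈ Finset.range n, ‖d i ω‖ₑ ^ s) ^ (p / s) ∂P ≤
        C * ∫⁻ ω, ‖∑ i ∈ Finset.range n, d i ω‖ₑ ^ p ∂P := by
  have hs0 : 0 < s := by linarith
  obtain ⟨K, hK⟩ := hX.exists_weighted hs0
  rcases hsp.eq_or_lt with rfl | hsp
  · refine ⟨K, fun Ω mΩ P _ ℱ d hd n hLp => ?_⟩
    have h := hK Ω P ℱ d hd (fun _ _ => 1) (fun _ => stronglyMeasurable_const) n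
      (fun i hi => by
        have := MemLp.lintegral_sum_enorm_rpow_ne_top hs0 1 (f := fun _ => d i)
          fun _ _ => hLp i hi
        simpa using this) hs
    simpa [div_self hs0.ne'] using h
  set r := p / s with hr_def
  have hr : 1 < r := (one_lt_div hs0).mpr hsp
  have hr0 : 0 < r := by linarith
  have hrs : s * r = p := mul_div_cancel₀ p hs0.ne'
  have hr1 : 0 < r - 1 := by linarith
  set c : ℝ≥0 := r.toNNReal * 2 ^ (r - 1) with hc_def
  have hc : 0 < c := by positivity
  -- The small coefficient enters once with the factor `c * K` and once with `c`; this choice makes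
  -- the total coefficient of `E (S n)^r` equal to `1/2`.
  obtain ⟨C₁, hC₁⟩ := ENNReal.exists_rpow_mul_rpow_le hr1.le one_pos (2 * (c * (K + 1)))⁻¹
    (by positivity)
  obtain ⟨C₂, hC₂⟩ := ENNReal.exists_rpow_mul_rpow_le zero_le_one hr1 (2 * (c * (K + 1)))⁻¹
    (by positivity)
  simp only [sub_add_cancel, add_sub_cancel, ENNReal.rpow_one] at hC₁ hC₂
  refine ⟨2 * (c * (K * C₁ + C₂)) * (2 ^ p * (p / (p - 1)).toNNReal ^ p),
    fun Ω mΩ P _ ℱ d hd n hLp => ?_⟩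
  set S : ℕ → Ω → ℝ≥0 := fun k ω => ∑ i ∈ Finset.range k, ‖d i ω‖₊ ^ s with hS
  set m : Ω → ℝ≥0 := fun ω => runningMax (fun k => ‖∑ i ∈ Finset.range k, d i ω‖₊) n with hm
  have hSmeas : ∀ k, Measurable[ℱ k] (S k) := fun k => Finset.measurable_fun_sum _ fun i hi =>
    (((hd.adapted i).mono (ℱ.mono (Finset.mem_range.mp hi))).nnnorm.measurable).pow_const s
  have hSmeas' : ∀ k, Measurable (S k) := fun k => (hSmeas k).mono (ℱ.le k) le_rfl
  have hmm : Measurable m := (hd.measurable_runningMax n).mono (ℱ.le n) le_rfl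
  have hSmono : ∀ ω, Monotone fun k => S k ω := fun ω i j hij =>
    Finset.sum_le_sum_of_subset (Finset.range_subset_range.mpr hij)
  set W : ℕ → Ω → ℝ := fun k ω => (S k ω ^ ((r - 1) / s) : ℝ≥0) with hW
  set Y : Ω → ℝ≥0∞ := fun ω => ((2 * m ω : ℝ≥0) : ℝ≥0∞) ^ s with hY
  have hScoe : ∀ k ω, (S k ω : ℝ≥0∞) = ∑ i ∈ Finset.range k, ‖d i ω‖ₑ ^ s := fun k ω => by
    simp only [hS, ENNReal.ofNNReal_finsetSum]
    refine Finset.sum_congr rfl fun i _ => ?_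
    rw [ENNReal.coe_rpow_of_nonneg _ hs0.le]
    rfl
  have hWe : ∀ k ω, ‖W k ω‖ₑ = (S k ω ^ ((r - 1) / s) : ℝ≥0) := fun k ω => by
    rw [Real.enorm_of_nonneg (NNReal.coe_nonneg _), ENNReal.ofReal_coe_nnreal]
  have hWs : ∀ k ω, ‖W k ω‖ₑ ^ s = (S k ω : ℝ≥0∞) ^ (r - 1) := fun k ω => by
    rw [hWe, ENNReal.coe_rpow_of_nonneg _ (by positivity), ← ENNReal.rpow_mul,
      div_mul_cancel₀ _ hs0.ne']
  have hWd : ∀ k ω, ‖W k ω • d k ω‖ₑ ^ s = (S k ω : ℝ≥0∞) ^ (r - 1) * ‖d k ω‖ₑ ^ s :=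
    fun k ω => by rw [enorm_smul, ENNReal.mul_rpow_of_nonneg _ _ hs0.le, hWs]
  have hdY : ∀ k < n, ∀ ω, ‖d k ω‖ₑ ^ s ≤ Y ω := fun k hk ω => by
    refine ENNReal.rpow_le_rpow ?_ hs0.le
    exact ENNReal.coe_le_coe.mpr (nnnorm_le_two_mul_runningMax (fun i => d i ω) hk)
  have hT : ∀ ω, ‖∑ k ∈ Finset.range n, W k ω • d k ω‖ₑ ^ s ≤ (S n ω : ℝ≥0∞) ^ (r - 1) * Y ω := by
    intro ω
    have h := norm_sum_smul_le_of_monotone (fun k => W k ω)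
      (fun i j hij => NNReal.coe_le_coe.mpr
        (NNReal.rpow_le_rpow (hSmono ω hij) (by positivity))) (NNReal.coe_nonneg _)
      (fun k => d k ω) n
    rw [← hWs, ← ENNReal.mul_rpow_of_nonneg _ _ hs0.le]
    refine ENNReal.rpow_le_rpow ?_ hs0.le
    have h' : ‖∑ k ∈ Finset.range n, W k ω • d k ω‖₊ ≤
        (S n ω ^ ((r - 1) / s)) * (2 * m ω) := by exact_mod_cast h
    refine (ENNReal.coe_le_coe.mpr h').trans_eq ?_
    rw [ENNReal.coe_mul, hWe]
  -- Finiteness is what permits the final absorption.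
  have hSn : ∫⁻ ω, (S n ω : ℝ≥0∞) ^ r ∂P ≠ ⊤ := by
    refine ((lintegral_mono fun ω => ?_).trans_lt
      (MemLp.lintegral_sum_enorm_rpow_ne_top (by linarith) n hLp).lt_top).ne
    rw [hScoe, ← hrs, ENNReal.rpow_mul]
    exact ENNReal.rpow_le_rpow (ENNReal.sum_rpow_le_rpow_sum hs _ _) hr0.le
  have hpath : ∀ ω, (S n ω : ℝ≥0∞) ^ r ≤ c * (∑ k ∈ Finset.range n, ‖W k ω • d k ω‖ₑ ^ s +
      S n ω * Y ω ^ (r - 1)) := by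
    intro ω
    have h := ENNReal.sum_rpow_le_mul_sum hr.le (fun i => ‖d i ω‖ₑ ^ s) n
    rw [← hScoe] at h
    refine h.trans ?_
    rw [hc_def, ENNReal.coe_mul, mul_assoc, hScoe n, Finset.sum_mul, ← Finset.sum_add_distrib]
    refine mul_le_mul_right ?_ _
    rw [Finset.mul_sum]
    refine (Finset.sum_le_sum fun k hk => ?_)
    rw [Finset.sum_range_succ, ← hScoe, hWd, mul_comm (‖d k ω‖ₑ ^ s) (Y ω ^ (r - 1)), ← add_mul,
      ← mul_assoc, mul_comm]
    gcongr
    rw [ENNReal.coe_rpow_of_nonneg _ hr1.le]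
    refine (ENNReal.add_rpow_le_two_rpow_mul_rpow_add_rpow _ _ hr1.le).trans ?_
    gcongr
    · simp
    · exact hdY k (Finset.mem_range.mp hk) ω
  set x := ∫⁻ ω, (S n ω : ℝ≥0∞) ^ r ∂P with hx
  set y := ∫⁻ ω, Y ω ^ r ∂P with hy
  have hI : ∀ C : ℝ≥0, ∀ δ : ℝ≥0, ∫⁻ ω, (δ * (S n ω : ℝ≥0∞) ^ r + C * Y ω ^ r) ∂P =
      δ * x + C * y := fun C δ => by
    rw [lintegral_add_left (by fun_prop), lintegral_const_mul _ (by fun_prop),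
      lintegral_const_mul _ (by fun_prop)]
  have h1 : ∫⁻ ω, ∑ k ∈ Finset.range n, ‖W k ω • d k ω‖ₑ ^ s ∂P ≤
      K * (((2 * (c * (K + 1)))⁻¹ : ℝ≥0) * x + C₁ * y) := by
    refine (hK Ω P ℱ d hd W (fun k => ((hSmeas k).pow_const _).coe_nnreal_real.stronglyMeasurable)
      n (fun k hk => ?_) hs).trans ?_
    · refine ((lintegral_mono fun ω => ?_).trans_lt hSn.lt_top).ne
      rw [hWd]
      have e : r = (r - 1) + 1 := by ring
      conv_rhs => rw [e, ENNReal.rpow_add_of_nonneg _ _ hr1.le zero_le_one, ENNReal.rpow_one]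
      gcongr
      · exact hSmono ω hk.le
      · rw [hScoe]
        exact Finset.single_le_sum (f := fun i => ‖d i ω‖ₑ ^ s) (fun _ _ => zero_le)
          (Finset.mem_range.mpr hk)
    · rw [← hI]
      gcongr with ω
      exact (hT ω).trans (hC₁ _ _)
  have h2 : ∫⁻ ω, S n ω * Y ω ^ (r - 1) ∂P ≤
      ((2 * (c * (K + 1)))⁻¹ : ℝ≥0) * x + C₂ * y := by
    rw [← hI]
    exact lintegral_mono fun ω => hC₂ _ _
  have h3 : x ≤ 2⁻¹ * x + c * (K * C₁ + C₂) * y := by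
    calc x ≤ ∫⁻ ω, c * (∑ k ∈ Finset.range n, ‖W k ω • d k ω‖ₑ ^ s +
          S n ω * Y ω ^ (r - 1)) ∂P := lintegral_mono hpath
      _ = c * (∫⁻ ω, ∑ k ∈ Finset.range n, ‖W k ω • d k ω‖ₑ ^ s ∂P +
          ∫⁻ ω, S n ω * Y ω ^ (r - 1) ∂P) := by
        have hmeas : Measurable fun ω => (S n ω : ℝ≥0∞) * Y ω ^ (r - 1) := by fun_prop
        rw [lintegral_const_mul', lintegral_add_right _ hmeas]
        simp
      _ ≤ c * (K * (((2 * (c * (K + 1)))⁻¹ : ℝ≥0) * x + C₁ * y) +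
          (((2 * (c * (K + 1)))⁻¹ : ℝ≥0) * x + C₂ * y)) := by gcongr
      _ = (c * (K + 1) * (2 * (c * (K + 1)))⁻¹ : ℝ≥0) * x + c * (K * C₁ + C₂) * y := by
        push_cast
        ring
      _ = _ := by
        congr 2
        rw [show c * (K + 1) * (2 * (c * (K + 1)))⁻¹ = (2 : ℝ≥0)⁻¹ by field_simp]
        simp
  have h4 : y ≤ 2 ^ p * (ENNReal.ofReal (p / (p - 1)) ^ p *
      ∫⁻ ω, ‖∑ i ∈ Finset.range n, d i ω‖ₑ ^ p ∂P) := by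
    refine le_trans (le_of_eq ?_) (mul_le_mul_right (hd.lintegral_runningMax_rpow_le hp n hLp) _)
    rw [← lintegral_const_mul _ (hmm.coe_nnreal_ennreal.pow_const p)]
    refine lintegral_congr fun ω => ?_
    rw [hY]
    beta_reduce
    rw [← ENNReal.rpow_mul, hrs, ENNReal.coe_mul, ENNReal.mul_rpow_of_nonneg _ _ (by linarith)]
    rfl
  simp_rw [hScoe] at hx
  rw [← hx]
  refine (ENNReal.le_two_mul_of_le_half_mul_add hSn h3).trans ?_
  refine (mul_le_mul_right (mul_le_mul_right h4 _) _).trans_eq ?_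
  rw [ENNReal.ofReal]
  push_cast [ENNReal.coe_rpow_of_nonneg _ (show 0 ≤ p by linarith)]
  ring

/-! ### The `s`-function in `L^p` for `p < s`: majorants and Davis' decomposition -/

/-- Weighted AM–GM for `x * y ^ (r - 1)` and `y ^ r`. It converts the variation of the decreasing
weights `Z ^ (r - 1)` into telescoping increments of `Z ^ r`. -/
theorem Real.mul_sub_rpow_le {r x y : ℝ} (hr0 : 0 < r) (hr1 : r ≤ 1) (hx : 0 < x) (hy : 0 < y) :
    (x ^ (r - 1) - y ^ (r - 1)) * x ≤ (1 - r) / r * (y ^ r - x ^ r) := by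
  have h := Real.geom_mean_le_arith_mean2_weighted hr0.le (sub_nonneg.mpr hr1)
    (show 0 ≤ x * y ^ (r - 1) by positivity) (show 0 ≤ y ^ r by positivity) (by ring)
  rw [Real.mul_rpow hx.le (by positivity), ← Real.rpow_mul hy.le, ← Real.rpow_mul hy.le, mul_assoc,
    ← Real.rpow_add hy, show (r - 1) * r + r * (1 - r) = 0 by ring, Real.rpow_zero, mul_one] at h
  have hxx : x ^ (r - 1) * x = x ^ r := by
    rw [Real.rpow_sub_one hx.ne']
    field_simp
  rw [sub_mul, hxx, div_mul_eq_mul_div, le_div_iff₀ hr0]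
  nlinarith

/-- The boundary term of the Abel summation contributes `1` and the variation `(1 - r) / r`, with
sum `1 / r`. The weight `Z k` must dominate the partial sum that already contains `d k`. -/
theorem norm_sum_rpow_smul_le {X : Type u} [NormedAddCommGroup X] [NormedSpace ℝ X] {r : ℝ}
    (hr0 : 0 < r) (hr1 : r ≤ 1) (Z : ℕ → ℝ) (hZ : Monotone Z) (hZ0 : ∀ k, 0 < Z k) (d : ℕ → X)
    (n : ℕ) (hn : ‖∑ i ∈ Finset.range n, d i‖ ≤ Z n)
    (hd : ∀ k < n, ‖∑ i ∈ Finset.range (k + 1), d i‖ ≤ Z k) :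
    ‖∑ k ∈ Finset.range n, Z k ^ (r - 1) • d k‖ ≤ r⁻¹ * Z n ^ r := by
  refine (norm_sum_smul_le_of_partialSum (fun k => Z k ^ (r - 1)) d n).trans ?_
  have h1 : |Z n ^ (r - 1)| * ‖∑ k ∈ Finset.range n, d k‖ ≤ Z n ^ r := by
    rw [abs_of_pos (Real.rpow_pos_of_pos (hZ0 n) _)]
    calc Z n ^ (r - 1) * ‖∑ k ∈ Finset.range n, d k‖ ≤ Z n ^ (r - 1) * Z n :=
          mul_le_mul_of_nonneg_left hn (Real.rpow_pos_of_pos (hZ0 n) _).le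
      _ = Z n ^ r := by
          rw [Real.rpow_sub_one (hZ0 n).ne', div_mul_cancel₀ _ (hZ0 n).ne']
  have h2 : ∑ k ∈ Finset.range n, |Z k ^ (r - 1) - Z (k + 1) ^ (r - 1)| *
      ‖∑ i ∈ Finset.range (k + 1), d i‖ ≤ (1 - r) / r * (Z n ^ r - Z 0 ^ r) := by
    rw [← Finset.sum_range_sub (fun k => Z k ^ r), Finset.mul_sum]
    refine Finset.sum_le_sum fun k hk => ?_
    have h3 : 0 ≤ Z k ^ (r - 1) - Z (k + 1) ^ (r - 1) :=
      sub_nonneg.mpr (Real.rpow_le_rpow_of_nonpos (hZ0 k) (hZ k.le_succ) (by linarith))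
    rw [abs_of_nonneg h3]
    exact (mul_le_mul_of_nonneg_left (hd k (Finset.mem_range.mp hk)) h3).trans
      (Real.mul_sub_rpow_le hr0 hr1 (hZ0 k) (hZ0 _))
  have h4 : 0 ≤ (1 - r) / r * Z 0 ^ r :=
    mul_nonneg (div_nonneg (by linarith) hr0.le) (Real.rpow_pos_of_pos (hZ0 0) _).le
  have h5 : r⁻¹ * Z n ^ r = Z n ^ r + (1 - r) / r * Z n ^ r := by
    field_simp
    ring
  linarith

/-- The weights `U k ^ (r - 1)`, `r = p/s`, make the `s`-th power of the transform at most a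
multiple of `U n ^ p`, so cotype applies in `L^s` although `p < s`. Hölder with exponents `r` and `1
- r` then removes the weights. Predictability of `U` is essential, as `U k` must bound the
martingale at time `k + 1`. -/
theorem HasMartingaleCotype.exists_lintegral_rpow_le_of_majorant {X : Type u}
    [NormedAddCommGroup X] [NormedSpace ℝ X] [CompleteSpace X] {s : ℝ}
    (hX : HasMartingaleCotype.{u, w} X s) {p : ℝ} (hp : 1 < p) (hps : p < s) :
    ∃ C : ℝ≥0, ∀ (Ω : Type w) [mΩ : MeasurableSpace Ω] (P : Measure Ω) [IsProbabilityMeasure P]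
      (ℱ : Filtration ℕ mΩ) (d : ℕ → Ω → X) (_ : IsMartingaleDifference P ℱ d)
      (U : ℕ → Ω → ℝ≥0) (_ : ∀ k, Measurable[ℱ k] (U k)) (_ : ∀ ω, Monotone fun k => U k ω) (n : ℕ)
      (_ : ∀ k ω, ‖∑ i ∈ Finset.range k, d i ω‖₊ ≤ U k ω)
      (_ : ∀ k ω, ‖∑ i ∈ Finset.range (k + 1), d i ω‖₊ ≤ U k ω)
      (_ : ∫⁻ ω, (U n ω : ℝ≥0∞) ^ p ∂P ≠ ⊤),
      ∫⁻ ω, (∑ i ∈ Finset.range n, ‖d i ω‖ₑ ^ s) ^ (p / s) ∂P ≤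
        C * ∫⁻ ω, (U n ω : ℝ≥0∞) ^ p ∂P := by
  have hs0 : 0 < s := by linarith
  have hs : 1 ≤ s := by linarith
  have hp0 : 0 < p := by linarith
  obtain ⟨K, hK⟩ := hX.exists_weighted hs0
  set r := p / s with hr_def
  have hr1 : r < 1 := (div_lt_one hs0).mpr hps
  have hr0 : 0 < r := by positivity
  have hrs : r * s = p := div_mul_cancel₀ p hs0.ne'
  set A : ℝ≥0 := (K * (r⁻¹).toNNReal ^ s) ^ r * 2 ^ p with hA
  refine ⟨A, fun Ω mΩ P _ ℱ d hd U hU hUmono n hM hM' hfin => ?_⟩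
  have hdm : ∀ i, StronglyMeasurable (d i) := fun i => (hd.adapted i).mono (ℱ.le _)
  have hUm : ∀ k, Measurable (U k) := fun k => (hU k).mono (ℱ.le k) le_rfl
  have key : ∀ ε : ℝ≥0, 0 < ε → ∫⁻ ω, (∑ i ∈ Finset.range n, ‖d i ω‖ₑ ^ s) ^ r ∂P ≤
      A * ((ε : ℝ≥0∞) ^ p + ∫⁻ ω, (U n ω : ℝ≥0∞) ^ p ∂P) := by
    intro ε hε
    -- The shift by `ε` keeps the negative powers finite; it is removed at the end by letting `ε`
    -- tend to `0`.
    set Z : ℕ → Ω → ℝ≥0 := fun k ω => ε + U k ω with hZ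
    have hZpos : ∀ k ω, 0 < Z k ω := fun k ω => add_pos_of_pos_of_nonneg hε zero_le
    have hZmono : ∀ ω, Monotone fun k => Z k ω := fun ω i j hij => by
      simpa [hZ] using hUmono ω hij
    have hZmeas : ∀ k, Measurable[ℱ k] (Z k) := fun k => (hU k).const_add ε
    have hZm : ∀ k, Measurable (Z k) := fun k => (hUm k).const_add ε
    have hZp : ∫⁻ ω, (Z n ω : ℝ≥0∞) ^ p ∂P ≤
        2 ^ p * ((ε : ℝ≥0∞) ^ p + ∫⁻ ω, (U n ω : ℝ≥0∞) ^ p ∂P) := by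
      calc ∫⁻ ω, (Z n ω : ℝ≥0∞) ^ p ∂P
          ≤ ∫⁻ ω, 2 ^ p * ((ε : ℝ≥0∞) ^ p + (U n ω : ℝ≥0∞) ^ p) ∂P := by
            refine lintegral_mono fun ω => ?_
            simp only [hZ, ENNReal.coe_add]
            exact ENNReal.add_rpow_le_two_rpow_mul_rpow_add_rpow _ _ hp0.le
        _ = _ := by
            rw [lintegral_const_mul _ (by fun_prop), lintegral_add_left (by fun_prop),
              lintegral_const, measure_univ, mul_one]
    have hZfin : ∫⁻ ω, (Z n ω : ℝ≥0∞) ^ p ∂P ≠ ⊤ := by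
      refine (hZp.trans_lt ?_).ne
      refine (ENNReal.mul_ne_top (by simp) (ENNReal.add_ne_top.mpr ⟨?_, hfin⟩)).lt_top
      simp [hp0.le]
    set W : ℕ → Ω → ℝ := fun k ω => (Z k ω : ℝ) ^ (r - 1) with hW
    have hWe : ∀ k ω, ‖W k ω‖ₑ = (Z k ω : ℝ≥0∞) ^ (r - 1) := fun k ω => by
      rw [Real.enorm_of_nonneg (Real.rpow_nonneg (NNReal.coe_nonneg _) _),
        ← NNReal.coe_rpow, ENNReal.ofReal_coe_nnreal, ENNReal.coe_rpow_of_ne_zero (hZpos k ω).ne']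
    have hWd : ∀ k ω, ‖d k ω‖ₑ = (Z k ω : ℝ≥0∞) ^ (1 - r) * ‖W k ω • d k ω‖ₑ := fun k ω => by
      rw [enorm_smul, hWe, ← mul_assoc, ← ENNReal.rpow_add _ _
        (ENNReal.coe_ne_zero.mpr (hZpos k ω).ne') ENNReal.coe_ne_top]
      simp
    have hd2 : ∀ k ω, ‖d k ω‖ₑ ≤ 2 * (Z k ω : ℝ≥0∞) := fun k ω => by
      have h : d k ω = ∑ i ∈ Finset.range (k + 1), d i ω - ∑ i ∈ Finset.range k, d i ω := by
        rw [Finset.sum_range_succ, add_sub_cancel_left]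
      have h' : ‖d k ω‖₊ ≤ 2 * Z k ω := by
        rw [h, two_mul]
        exact (nnnorm_sub_le _ _).trans (add_le_add ((hM' k ω).trans (by simp [hZ]))
          ((hM k ω).trans (by simp [hZ])))
      exact_mod_cast h'
    have hWn : ∀ k < n, ∀ ω, ‖W k ω • d k ω‖ₑ ^ s ≤ 2 ^ s * (Z n ω : ℝ≥0∞) ^ p := fun k hk ω => by
      rw [← hrs, ENNReal.rpow_mul, ← ENNReal.mul_rpow_of_nonneg _ _ hs0.le]
      refine ENNReal.rpow_le_rpow ?_ hs0.le
      calc ‖W k ω • d k ω‖ₑ ≤ (Z k ω : ℝ≥0∞) ^ (r - 1) * (2 * (Z k ω : ℝ≥0∞)) := by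
            rw [enorm_smul, hWe]
            gcongr
            exact hd2 k ω
        _ = 2 * (Z k ω : ℝ≥0∞) ^ r := by
            rw [mul_left_comm]
            congr 1
            nth_rw 2 [← ENNReal.rpow_one (Z k ω : ℝ≥0∞)]
            rw [← ENNReal.rpow_add _ _ (ENNReal.coe_ne_zero.mpr (hZpos k ω).ne')
              ENNReal.coe_ne_top, sub_add_cancel]
        _ ≤ 2 * (Z n ω : ℝ≥0∞) ^ r := by
            gcongr
            exact hZmono ω hk.le
    have hT : ∀ ω, ‖∑ k ∈ Finset.range n, W k ω • d k ω‖ₑ ^ s ≤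
        (r⁻¹).toNNReal ^ s * (Z n ω : ℝ≥0∞) ^ p := fun ω => by
      have h := norm_sum_rpow_smul_le hr0 hr1.le (fun k => (Z k ω : ℝ))
        (fun i j hij => NNReal.coe_le_coe.mpr (hZmono ω hij))
        (fun k => NNReal.coe_pos.mpr (hZpos k ω)) (fun k => d k ω) n
        (NNReal.coe_le_coe.mpr ((hM n ω).trans (by simp [hZ])))
        (fun k _ => NNReal.coe_le_coe.mpr ((hM' k ω).trans (by simp [hZ])))
      rw [← hrs, ENNReal.rpow_mul, ← ENNReal.mul_rpow_of_nonneg _ _ hs0.le]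
      refine ENNReal.rpow_le_rpow ?_ hs0.le
      rw [← ofReal_norm]
      refine (ENNReal.ofReal_le_ofReal h).trans_eq ?_
      rw [ENNReal.ofReal_mul (by positivity), ← NNReal.coe_rpow, ENNReal.ofReal_coe_nnreal,
        ENNReal.coe_rpow_of_nonneg _ hr0.le]
      rfl
    have hV : ∫⁻ ω, ∑ k ∈ Finset.range n, ‖W k ω • d k ω‖ₑ ^ s ∂P ≤
        (K * (r⁻¹).toNNReal ^ s : ℝ≥0) * ∫⁻ ω, (Z n ω : ℝ≥0∞) ^ p ∂P := by
      refine (hK Ω P ℱ d hd W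
        (fun k => ((hZmeas k).coe_nnreal_real.pow_const _).stronglyMeasurable) n
        (fun k hk => ?_) hs).trans ?_
      · refine ((lintegral_mono (hWn k hk)).trans_lt ?_).ne
        rw [lintegral_const_mul _ (by fun_prop)]
        exact (ENNReal.mul_ne_top (by simp) hZfin).lt_top
      · refine (mul_le_mul_right (lintegral_mono hT) _).trans_eq ?_
        rw [lintegral_const_mul _ (by fun_prop), ENNReal.coe_mul, mul_assoc,
          ENNReal.coe_rpow_of_nonneg _ hs0.le]
    have hpath : ∀ ω, (∑ i ∈ Finset.range n, ‖d i ω‖ₑ ^ s) ^ r ≤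
        (∑ k ∈ Finset.range n, ‖W k ω • d k ω‖ₑ ^ s) ^ r * ((Z n ω : ℝ≥0∞) ^ p) ^ (1 - r) :=
      fun ω => by
        have h : ∑ i ∈ Finset.range n, ‖d i ω‖ₑ ^ s ≤ ((Z n ω : ℝ≥0∞) ^ (1 - r)) ^ s *
            ∑ k ∈ Finset.range n, ‖W k ω • d k ω‖ₑ ^ s := by
          rw [Finset.mul_sum]
          refine Finset.sum_le_sum fun k hk => ?_
          rw [hWd k ω, ENNReal.mul_rpow_of_nonneg _ _ hs0.le]
          gcongr
          exact hZmono ω (Finset.mem_range.mp hk).le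
        refine (ENNReal.rpow_le_rpow h hr0.le).trans_eq ?_
        rw [ENNReal.mul_rpow_of_nonneg _ _ hr0.le, mul_comm, ← ENNReal.rpow_mul,
          ← ENNReal.rpow_mul, ← ENNReal.rpow_mul, ← hrs]
        congr 2
        ring
    have hWm : ∀ k, Measurable (W k) := fun k => (hZm k).coe_nnreal_real.pow_const _
    calc ∫⁻ ω, (∑ i ∈ Finset.range n, ‖d i ω‖ₑ ^ s) ^ r ∂P
        ≤ ∫⁻ ω, (∑ k ∈ Finset.range n, ‖W k ω • d k ω‖ₑ ^ s) ^ r *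
            ((Z n ω : ℝ≥0∞) ^ p) ^ (1 - r) ∂P := lintegral_mono hpath
      _ ≤ (∫⁻ ω, ∑ k ∈ Finset.range n, ‖W k ω • d k ω‖ₑ ^ s ∂P) ^ r *
            (∫⁻ ω, (Z n ω : ℝ≥0∞) ^ p ∂P) ^ (1 - r) := by
          refine ENNReal.lintegral_mul_norm_pow_le ?_ (by fun_prop) hr0.le (by linarith) (by ring)
          exact (Finset.measurable_fun_sum _ fun k _ =>
            ((hWm k).stronglyMeasurable.smul (hdm k)).enorm.pow_const _).aemeasurable
      _ ≤ ((K * (r⁻¹).toNNReal ^ s : ℝ≥0) * ∫⁻ ω, (Z n ω : ℝ≥0∞) ^ p ∂P) ^ r *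
            (∫⁻ ω, (Z n ω : ℝ≥0∞) ^ p ∂P) ^ (1 - r) := by gcongr
      _ = ((K * (r⁻¹).toNNReal ^ s) ^ r : ℝ≥0) * ∫⁻ ω, (Z n ω : ℝ≥0∞) ^ p ∂P := by
          rw [ENNReal.mul_rpow_of_nonneg _ _ hr0.le, mul_assoc,
            ← ENNReal.rpow_add_of_nonneg _ _ hr0.le (by linarith), add_sub_cancel,
            ENNReal.rpow_one, ENNReal.coe_rpow_of_nonneg _ hr0.le]
      _ ≤ ((K * (r⁻¹).toNNReal ^ s) ^ r : ℝ≥0) *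
            (2 ^ p * ((ε : ℝ≥0∞) ^ p + ∫⁻ ω, (U n ω : ℝ≥0∞) ^ p ∂P)) := by gcongr
      _ = _ := by
          rw [hA, ENNReal.coe_mul, mul_assoc]
          congr 2
          rw [ENNReal.coe_rpow_of_nonneg _ hp0.le]
          simp
  refine ENNReal.le_of_forall_pos_le_add fun η hη _ => ?_
  have hη' : 0 < (η / (A + 1)) ^ p⁻¹ := NNReal.rpow_pos (by positivity)
  refine (key _ hη').trans ?_
  rw [← ENNReal.coe_rpow_of_nonneg _ hp0.le, ← NNReal.rpow_mul, inv_mul_cancel₀ hp0.ne',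
    NNReal.rpow_one, mul_add, add_comm]
  gcongr
  rw [← ENNReal.coe_mul, ENNReal.coe_le_coe]
  calc A * (η / (A + 1)) ≤ (A + 1) * (η / (A + 1)) := by gcongr; simp
    _ = η := mul_div_cancel₀ _ (by positivity)

/-- The large jumps in Davis' decomposition are controlled by the running maximum. -/
theorem sum_nnnorm_large_le {X : Type u} [NormedAddCommGroup X] (d a : ℕ → X)
    (ha : ∀ k, a k = 0 ∨ a k = d k ∧
      4 * runningMax (fun k => ‖∑ i ∈ Finset.range k, d i‖₊) k < ‖d k‖₊) (n : ℕ) :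
    ∑ k ∈ Finset.range n, ‖a k‖₊ ≤
      2 * runningMax (fun k => ‖∑ i ∈ Finset.range k, d i‖₊) n := by
  set m := runningMax (fun k => ‖∑ i ∈ Finset.range k, d i‖₊) with hm
  induction n with
  | zero => simp
  | succ n ih =>
    rw [Finset.sum_range_succ]
    rcases ha n with h | ⟨h1, h2⟩
    · rw [h, nnnorm_zero, add_zero]
      exact ih.trans (mul_le_mul_right (runningMax_mono _ n.le_succ) _)
    · rw [h1]
      -- Together with `4 * m n < ‖d n‖` this gives `2 * m (n + 1) ≥ 2 * ‖d n‖ - 2 * m n ≥ ‖d n‖ + 2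
      -- * m n`, which pays for the new jump and all earlier ones. This fixes the threshold `4`.
      have h3 : ‖d n‖₊ ≤ m (n + 1) + m n := by
        have h : d n = ∑ i ∈ Finset.range (n + 1), d i - ∑ i ∈ Finset.range n, d i := by
          rw [Finset.sum_range_succ, add_sub_cancel_left]
        rw [h]
        exact (nnnorm_sub_le _ _).trans (add_le_add
          (le_runningMax (fun k => ‖∑ i ∈ Finset.range k, d i‖₊) le_rfl)
          (le_runningMax (fun k => ‖∑ i ∈ Finset.range k, d i‖₊) le_rfl))
      rw [← NNReal.coe_le_coe] at ih h3 ⊢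
      rw [← NNReal.coe_lt_coe] at h2
      push_cast at ih h2 h3 ⊢
      linarith

/-- Davis' decomposition `d = d' + (a - c)`: `a` collects the jumps exceeding four times the running
maximum and `c` is its conditional expectation. The remaining martingale `d'` has jumps bounded by
predictable quantities, hence an integrable predictable majorant. The sum of `‖a k‖` is bounded by
the maximum, that of `‖c k‖` by the dual Doob inequality. The index `n + 1` on the right arises
because the majorant `U n` contains `c n`, which is controlled through `a n`. -/
theorem HasMartingaleCotype.exists_lintegral_rpow_le_of_lt {X : Type u} [NormedAddCommGroup X]
    [NormedSpace ℝ X] [CompleteSpace X] {s : ℝ} (hX : HasMartingaleCotype.{u, w} X s)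
    {p : ℝ} (hp : 1 < p) (hps : p < s) :
    ∃ C : ℝ≥0, ∀ (Ω : Type w) [mΩ : MeasurableSpace Ω] (P : Measure Ω) [IsProbabilityMeasure P]
      (ℱ : Filtration ℕ mΩ) (d : ℕ → Ω → X) (_ : IsMartingaleDifference P ℱ d)
      (_ : ∀ i, MemLp (d i) (ENNReal.ofReal p) P) (n : ℕ),
      ∫⁻ ω, (∑ i ∈ Finset.range n, ‖d i ω‖ₑ ^ s) ^ (p / s) ∂P ≤
        C * ∫⁻ ω, ‖∑ i ∈ Finset.range (n + 1), d i ω‖ₑ ^ p ∂P := by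
  have hs0 : 0 < s := by linarith
  have hs : 1 ≤ s := by linarith
  have hp0 : 0 < p := by linarith
  obtain ⟨C₁, hC₁⟩ := hX.exists_lintegral_rpow_le_of_majorant hp hps
  set r := p / s with hr_def
  have hr1 : r < 1 := (div_lt_one hs0).mpr hps
  have hr0 : 0 < r := by positivity
  have hrs : s * r = p := mul_div_cancel₀ p hs0.ne'
  -- Here `7 ^ p` comes from the maximum in `U`, `p ^ p` from the dual Doob inequality, the inner `2
  -- ^ p` from the bound on the large jumps, and the outer one from splitting a sum.
  set B : ℝ≥0 := 2 ^ p * (7 ^ p + p.toNNReal ^ p * 2 ^ p) with hB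
  refine ⟨2 ^ p * (C₁ + 1) * (B * (p / (p - 1)).toNNReal ^ p),
    fun Ω mΩ P _ ℱ d hd hLp n => ?_⟩
  set m : ℕ → Ω → ℝ≥0 := fun k ω => runningMax (fun k => ‖∑ i ∈ Finset.range k, d i ω‖₊) k with hm
  have hmm : ∀ k, Measurable[ℱ k] (m k) := fun k => hd.measurable_runningMax k
  have hmm' : ∀ k, Measurable (m k) := fun k => (hmm k).mono (ℱ.le k) le_rfl
  set L : ℕ → Set Ω := fun k => {ω | 4 * m k ω < ‖d k ω‖₊} with hL
  have hLm : ∀ k, MeasurableSet[ℱ (k + 1)] (L k) := fun k =>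
    @measurableSet_lt _ _ _ _ _ (ℱ (k + 1)) _ _ _ _ _
      (((hmm k).mono (ℱ.mono k.le_succ) le_rfl).const_mul 4) (hd.adapted k).nnnorm.measurable
  set a : ℕ → Ω → X := fun k => (L k).indicator (d k) with ha
  have ham : ∀ k, StronglyMeasurable[ℱ (k + 1)] (a k) := fun k =>
    (hd.adapted k).indicator (hLm k)
  have haLp : ∀ k, MemLp (a k) (ENNReal.ofReal p) P := fun k =>
    (hLp k).indicator (ℱ.le _ _ (hLm k))
  have hp1 : 1 ≤ ENNReal.ofReal p := by simpa using hp.le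
  have hai : ∀ k, Integrable (a k) P := fun k => (haLp k).integrable hp1
  have ha_cases : ∀ ω k, a k ω = 0 ∨ a k ω = d k ω ∧ 4 * m k ω < ‖d k ω‖₊ := fun ω k => by
    by_cases h : ω ∈ L k
    · exact Or.inr ⟨indicator_of_mem h _, h⟩
    · exact Or.inl (indicator_of_notMem h _)
  have hda : ∀ ω k, ‖d k ω - a k ω‖₊ ≤ 4 * m k ω := fun ω k => by
    by_cases h : ω ∈ L k
    · simp [ha, indicator_of_mem h]
    · simp only [ha, indicator_of_notMem h, sub_zero]
      exact not_lt.mp h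
  have hasum : ∀ ω k, ∑ i ∈ Finset.range k, ‖a i ω‖₊ ≤ 2 * m k ω := fun ω k =>
    sum_nnnorm_large_le (fun i => d i ω) (fun i => a i ω) (ha_cases ω) k
  set c : ℕ → Ω → X := fun k => P[a k | ℱ k] with hc
  have hcm : ∀ k, StronglyMeasurable[ℱ k] (c k) := fun k => stronglyMeasurable_condExp
  have hcLp : ∀ k, MemLp (c k) (ENNReal.ofReal p) P := fun k => (haLp k).condExp hp1
  have hci : ∀ k, Integrable (c k) P := fun k => integrable_condExp
  set d' : ℕ → Ω → X := fun k => d k - a k + c k with hd'_def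
  have hd' : IsMartingaleDifference P ℱ d' := by
    refine ⟨fun k => ((hd.adapted k).sub (ham k)).add ((hcm k).mono (ℱ.mono k.le_succ)),
      fun k => ((hd.integrable k).sub (hai k)).add (hci k), fun k => ?_⟩
    filter_upwards [condExp_add ((hd.integrable k).sub (hai k)) (hci k) (ℱ k),
      condExp_sub (hd.integrable k) (hai k) (ℱ k), hd.condExp_eq_zero k] with ω h1 h2 h3
    rw [h1, Pi.add_apply, h2, Pi.sub_apply, h3,
      condExp_of_stronglyMeasurable (ℱ.le k) (hcm k) (hci k)]
    simp [hc]
  -- `7 = 1 + 2 + 4`: the martingale itself, the large jumps removed so far, and the next small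
  -- jump. The sum of `‖c i‖` includes `i = k` and is still `ℱ k`-measurable.
  set U : ℕ → Ω → ℝ≥0 := fun k ω => 7 * m k ω + ∑ i ∈ Finset.range (k + 1), ‖c i ω‖₊ with hU
  have hUm : ∀ k, Measurable[ℱ k] (U k) := fun k =>
    ((hmm k).const_mul 7).add (Finset.measurable_fun_sum _ fun i hi =>
      ((hcm i).mono (ℱ.mono (Finset.mem_range_succ_iff.mp hi))).nnnorm.measurable)
  have hmmono : ∀ ω, Monotone fun k => m k ω := fun ω => runningMax_mono _
  have hUmono : ∀ ω, Monotone fun k => U k ω := fun ω i j hij =>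
    add_le_add (mul_le_mul_right (hmmono ω hij) _)
      (Finset.sum_le_sum_of_subset (Finset.range_subset_range.mpr (by omega)))
  have hM0 : ∀ k ω, ‖∑ i ∈ Finset.range k, d' i ω‖₊ ≤
      3 * m k ω + ∑ i ∈ Finset.range k, ‖c i ω‖₊ := fun k ω => by
    have e : ∑ i ∈ Finset.range k, d' i ω = ∑ i ∈ Finset.range k, d i ω -
        ∑ i ∈ Finset.range k, a i ω + ∑ i ∈ Finset.range k, c i ω := by
      simp [hd'_def, Finset.sum_add_distrib, Finset.sum_sub_distrib]
    rw [e]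
    have h1 : ‖∑ i ∈ Finset.range k, d i ω‖₊ ≤ m k ω :=
      le_runningMax (fun k => ‖∑ i ∈ Finset.range k, d i ω‖₊) le_rfl
    calc _ ≤ ‖∑ i ∈ Finset.range k, d i ω‖₊ + ‖∑ i ∈ Finset.range k, a i ω‖₊ +
          ‖∑ i ∈ Finset.range k, c i ω‖₊ :=
          (nnnorm_add_le _ _).trans (add_le_add (nnnorm_sub_le _ _) le_rfl)
      _ ≤ m k ω + 2 * m k ω + ∑ i ∈ Finset.range k, ‖c i ω‖₊ :=
          add_le_add (add_le_add h1 ((nnnorm_sum_le _ _).trans (hasum ω k))) (nnnorm_sum_le _ _)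
      _ = _ := by ring
  have hM : ∀ k ω, ‖∑ i ∈ Finset.range k, d' i ω‖₊ ≤ U k ω := fun k ω => by
    refine (hM0 k ω).trans (add_le_add ?_ ?_)
    · gcongr
      norm_num
    · exact Finset.sum_le_sum_of_subset (Finset.range_subset_range.mpr (by omega))
  have hM' : ∀ k ω, ‖∑ i ∈ Finset.range (k + 1), d' i ω‖₊ ≤ U k ω := fun k ω => by
    rw [Finset.sum_range_succ]
    calc _ ≤ ‖∑ i ∈ Finset.range k, d' i ω‖₊ + (‖d k ω - a k ω‖₊ + ‖c k ω‖₊) :=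
          (nnnorm_add_le _ _).trans (add_le_add le_rfl (nnnorm_add_le _ _))
      _ ≤ 3 * m k ω + ∑ i ∈ Finset.range k, ‖c i ω‖₊ + (4 * m k ω + ‖c k ω‖₊) :=
          add_le_add (hM0 k ω) (add_le_add (hda ω k) le_rfl)
      _ = U k ω := by
          simp only [hU]
          rw [Finset.sum_range_succ]
          ring
  have hcint : ∫⁻ ω, (∑ i ∈ Finset.range (n + 1), ‖c i ω‖ₑ) ^ p ∂P ≤
      ENNReal.ofReal p ^ p * (2 ^ p * ∫⁻ ω, (m (n + 1) ω : ℝ≥0∞) ^ p ∂P) := by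
    refine (lintegral_sum_rpow_le_of_predictable (ℱ := ℱ) hp.le (α := fun k ω => ‖c k ω‖ₑ)
      (a := fun k ω => ‖a k ω‖ₑ) (fun k => (hcm k).enorm) (fun k => (haLp k).1.enorm)
      (fun k W hW => lintegral_enorm_condExp_mul_le (ℱ.le k) (hai k) hW) (n + 1)
      (MemLp.lintegral_sum_enorm_rpow_ne_top hp0 _ fun i _ => hcLp i)).trans ?_
    gcongr
    rw [← lintegral_const_mul _ ((hmm' _).coe_nnreal_ennreal.pow_const p)]
    refine lintegral_mono fun ω => ?_
    rw [← ENNReal.mul_rpow_of_nonneg _ _ hp0.le]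
    refine ENNReal.rpow_le_rpow ?_ hp0.le
    refine le_trans (le_of_eq ?_) ((ENNReal.coe_le_coe.mpr (hasum ω (n + 1))).trans_eq ?_)
    · push_cast
      rfl
    · push_cast
      rfl
  have hcm' : ∀ k, StronglyMeasurable (c k) := fun k => (hcm k).mono (ℱ.le k)
  have hUint : ∫⁻ ω, (U n ω : ℝ≥0∞) ^ p ∂P ≤ B * ∫⁻ ω, (m (n + 1) ω : ℝ≥0∞) ^ p ∂P := by
    have hmeas : Measurable fun ω => (∑ i ∈ Finset.range (n + 1), ‖c i ω‖ₑ) ^ p :=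
      (Finset.measurable_fun_sum _ fun i _ => (hcm' i).enorm).pow_const p
    calc ∫⁻ ω, (U n ω : ℝ≥0∞) ^ p ∂P
        ≤ ∫⁻ ω, 2 ^ p * (7 ^ p * (m (n + 1) ω : ℝ≥0∞) ^ p +
            (∑ i ∈ Finset.range (n + 1), ‖c i ω‖ₑ) ^ p) ∂P := by
          refine lintegral_mono fun ω => ?_
          rw [← ENNReal.mul_rpow_of_nonneg _ _ hp0.le]
          refine le_trans (ENNReal.rpow_le_rpow ?_ hp0.le)
            (ENNReal.add_rpow_le_two_rpow_mul_rpow_add_rpow _ _ hp0.le)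
          simp only [hU, ENNReal.coe_add, ENNReal.coe_mul, ENNReal.ofNNReal_finsetSum]
          gcongr
          · exact le_rfl
          · exact hmmono ω n.le_succ
          · exact le_rfl
      _ = 2 ^ p * (7 ^ p * ∫⁻ ω, (m (n + 1) ω : ℝ≥0∞) ^ p ∂P +
            ∫⁻ ω, (∑ i ∈ Finset.range (n + 1), ‖c i ω‖ₑ) ^ p ∂P) := by
          rw [lintegral_const_mul' _ _ (by simp), lintegral_add_right _ hmeas,
            lintegral_const_mul' _ _ (by simp)]
      _ ≤ 2 ^ p * (7 ^ p * ∫⁻ ω, (m (n + 1) ω : ℝ≥0∞) ^ p ∂P +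
            ENNReal.ofReal p ^ p * (2 ^ p * ∫⁻ ω, (m (n + 1) ω : ℝ≥0∞) ^ p ∂P)) := by gcongr
      _ = _ := by
          rw [hB, ENNReal.ofReal]
          push_cast [ENNReal.coe_rpow_of_nonneg _ hp0.le]
          ring
  have hUfin : ∫⁻ ω, (U n ω : ℝ≥0∞) ^ p ∂P ≠ ⊤ :=
    (hUint.trans_lt (ENNReal.mul_ne_top ENNReal.coe_ne_top
      (IsMartingaleDifference.lintegral_runningMax_rpow_ne_top hp _ fun i _ => hLp i)).lt_top).ne
  have hpath : ∀ ω, (∑ i ∈ Finset.range n, ‖d i ω‖ₑ ^ s) ^ r ≤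
      2 ^ p * ((∑ i ∈ Finset.range n, ‖d' i ω‖ₑ ^ s) ^ r + (U n ω : ℝ≥0∞) ^ p) := fun ω => by
    have h1 : ∀ k, ‖d k ω‖ₑ ≤ ‖d' k ω‖ₑ + (‖a k ω‖ₑ + ‖c k ω‖ₑ) := fun k => by
      have e : d k ω = d' k ω + (a k ω - c k ω) := by
        simp only [hd'_def, Pi.add_apply, Pi.sub_apply]
        abel
      rw [e]
      exact (enorm_add_le _ _).trans (add_le_add le_rfl enorm_sub_le)
    have h2 : ∑ k ∈ Finset.range n, (‖a k ω‖ₑ + ‖c k ω‖ₑ) ≤ U n ω := by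
      have h3 : ∑ k ∈ Finset.range n, (‖a k ω‖₊ + ‖c k ω‖₊) ≤ U n ω := by
        rw [Finset.sum_add_distrib]
        refine add_le_add ((hasum ω n).trans ?_)
          (Finset.sum_le_sum_of_subset (Finset.range_subset_range.mpr n.le_succ))
        gcongr
        norm_num
      refine le_trans (le_of_eq ?_) (ENNReal.coe_le_coe.mpr h3)
      push_cast
      rfl
    have h4 : ∑ k ∈ Finset.range n, ‖d k ω‖ₑ ^ s ≤
        2 ^ s * (∑ k ∈ Finset.range n, ‖d' k ω‖ₑ ^ s + (U n ω : ℝ≥0∞) ^ s) := by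
      calc ∑ k ∈ Finset.range n, ‖d k ω‖ₑ ^ s
          ≤ ∑ k ∈ Finset.range n, 2 ^ s * (‖d' k ω‖ₑ ^ s + (‖a k ω‖ₑ + ‖c k ω‖ₑ) ^ s) :=
            Finset.sum_le_sum fun k _ => (ENNReal.rpow_le_rpow (h1 k) hs0.le).trans
              (ENNReal.add_rpow_le_two_rpow_mul_rpow_add_rpow _ _ hs0.le)
        _ = 2 ^ s * (∑ k ∈ Finset.range n, ‖d' k ω‖ₑ ^ s +
              ∑ k ∈ Finset.range n, (‖a k ω‖ₑ + ‖c k ω‖ₑ) ^ s) := by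
            rw [← Finset.mul_sum, Finset.sum_add_distrib]
        _ ≤ _ := by
            gcongr
            exact (ENNReal.sum_rpow_le_rpow_sum hs _ _).trans (ENNReal.rpow_le_rpow h2 hs0.le)
    refine (ENNReal.rpow_le_rpow h4 hr0.le).trans ?_
    rw [ENNReal.mul_rpow_of_nonneg _ _ hr0.le, ← ENNReal.rpow_mul, hrs]
    gcongr
    refine (ENNReal.rpow_add_le_add_rpow _ _ hr0.le hr1.le).trans_eq ?_
    rw [← ENNReal.rpow_mul, hrs]
  calc ∫⁻ ω, (∑ i ∈ Finset.range n, ‖d i ω‖ₑ ^ s) ^ r ∂P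
      ≤ ∫⁻ ω, 2 ^ p * ((∑ i ∈ Finset.range n, ‖d' i ω‖ₑ ^ s) ^ r + (U n ω : ℝ≥0∞) ^ p) ∂P :=
        lintegral_mono hpath
    _ = 2 ^ p * (∫⁻ ω, (∑ i ∈ Finset.range n, ‖d' i ω‖ₑ ^ s) ^ r ∂P +
          ∫⁻ ω, (U n ω : ℝ≥0∞) ^ p ∂P) := by
        rw [lintegral_const_mul' _ _ (by simp), lintegral_add_right _ (by fun_prop)]
    _ ≤ 2 ^ p * (C₁ * ∫⁻ ω, (U n ω : ℝ≥0∞) ^ p ∂P + ∫⁻ ω, (U n ω : ℝ≥0∞) ^ p ∂P) := by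
        gcongr
        exact hC₁ Ω P ℱ d' hd' U hUm hUmono n hM hM' hUfin
    _ = 2 ^ p * (C₁ + 1) * ∫⁻ ω, (U n ω : ℝ≥0∞) ^ p ∂P := by ring
    _ ≤ 2 ^ p * (C₁ + 1) * (B * (ENNReal.ofReal (p / (p - 1)) ^ p *
          ∫⁻ ω, ‖∑ i ∈ Finset.range (n + 1), d i ω‖ₑ ^ p ∂P)) := by
        refine mul_le_mul_right (hUint.trans (mul_le_mul_right ?_ _)) _
        exact hd.lintegral_runningMax_rpow_le hp (n + 1) fun i _ => hLp i
    _ = _ := by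
        rw [ENNReal.ofReal]
        push_cast [ENNReal.coe_rpow_of_nonneg _ hp0.le]
        ring

/-- Martingale cotype `s` implies an `L^p`-estimate of the `s`-function for every `1 < p < ∞`. -/
theorem HasMartingaleCotype.exists_lintegral_rpow_le {X : Type u} [NormedAddCommGroup X]
    [NormedSpace ℝ X] [CompleteSpace X] {s : ℝ} (hs : 1 ≤ s)
    (hX : HasMartingaleCotype.{u, w} X s) {p : ℝ} (hp : 1 < p) :
    ∃ C : ℝ≥0, ∀ (Ω : Type w) [mΩ : MeasurableSpace Ω] (P : Measure Ω) [IsProbabilityMeasure P]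
      (ℱ : Filtration ℕ mΩ) (d : ℕ → Ω → X) (_ : IsMartingaleDifference P ℱ d)
      (_ : ∀ i, MemLp (d i) (ENNReal.ofReal p) P) (n : ℕ) (_ : ∀ i, n ≤ i → d i = 0),
      ∫⁻ ω, (∑ i ∈ Finset.range n, ‖d i ω‖ₑ ^ s) ^ (p / s) ∂P ≤
        C * ∫⁻ ω, ‖∑ i ∈ Finset.range n, d i ω‖ₑ ^ p ∂P := by
  rcases le_or_gt s p with h | h
  · obtain ⟨C, hC⟩ := hX.exists_lintegral_rpow_le_of_le hs hp h
    exact ⟨C, fun Ω _ P _ ℱ d hd hLp n _ => hC Ω P ℱ d hd n fun i _ => hLp i⟩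
  · obtain ⟨C, hC⟩ := hX.exists_lintegral_rpow_le_of_lt hp h
    refine ⟨C, fun Ω _ P _ ℱ d hd hLp n h0 => ?_⟩
    -- The extra term on the right vanishes since `d n = 0`.
    simpa [Finset.sum_range_succ, h0 n le_rfl] using hC Ω P ℱ d hd hLp n

/-! ### Independence and moments of a Poisson random measure -/

/-- The σ-algebra generated by the random variables `N C`, where `C` ranges over the measurable
subsets of `D`. -/
@[reducible]
def countingSigma {Ω : Type w} {E : Type v} [MeasurableSpace E] (N : Ω → Measure E) (D : Set E) :
    MeasurableSpace Ω :=
  ⨆ C : {C : Set E // MeasurableSet C ∧ C ⊆ D},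
    MeasurableSpace.comap (fun ω => N ω C.1) inferInstance

theorem countingSigma_mono {Ω : Type w} {E : Type v} [MeasurableSpace E] (N : Ω → Measure E)
    {D D' : Set E} (h : D ⊆ D') : countingSigma N D ≤ countingSigma N D' :=
  iSup_le fun C => le_iSup_of_le ⟨C.1, C.2.1, C.2.2.trans h⟩ le_rfl

theorem measurable_countingSigma {Ω : Type w} {E : Type v} [MeasurableSpace E] (N : Ω → Measure E)
    {C D : Set E} (hC : MeasurableSet C) (h : C ⊆ D) :
    Measurable[countingSigma N D] fun ω => N ω C :=
  (comap_measurable _).mono (le_iSup_of_le (⟨C, hC, h⟩ : {C : Set E // MeasurableSet C ∧ C ⊆ D})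
    le_rfl) le_rfl

theorem poissonPast_le_countingSigma {Ω : Type w} {J : Type v} [MeasurableSpace J]
    (N : Ω → Measure (ℝ≥0 × J)) (t : ℝ≥0) :
    poissonPast N t ≤ countingSigma N (Iic t ×ˢ univ) :=
  iSup_le fun _ => iSup_le fun _ => iSup_le fun _ => iSup_le fun h =>
    (measurable_countingSigma N (measurableSet_Ioc.prod h.2.2)
      (prod_mono (fun _ hx => hx.2.trans h.2.1) (subset_univ _))).comap_le

/-- The atom `t` of the algebra generated by a finite collection `c` of sets. -/
theorem measurableSet_atom {E : Type v} [MeasurableSpace E] {ι : Type*} {A : ι → Set E}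
    (hA : ∀ i, MeasurableSet (A i)) (c t : Finset ι) :
    MeasurableSet {x | ∀ i ∈ c, x ∈ A i ↔ i ∈ t} := by
  have : {x | ∀ i ∈ c, x ∈ A i ↔ i ∈ t} = ⋂ i ∈ c, {x | x ∈ A i ↔ i ∈ t} := by
    ext x
    simp
  rw [this]
  refine Finset.measurableSet_biInter _ fun i _ => ?_
  by_cases h : i ∈ t
  · simpa [h] using hA i
  · simp only [h, iff_false]
    exact (hA i).compl

theorem disjoint_atom {E : Type v} {ι : Type*} {A : ι → Set E} {c t t' : Finset ι} (ht : t ⊆ c)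
    (ht' : t' ⊆ c) (h : t ≠ t') :
    Disjoint {x | ∀ i ∈ c, x ∈ A i ↔ i ∈ t} {x | ∀ i ∈ c, x ∈ A i ↔ i ∈ t'} := by
  refine Set.disjoint_left.mpr fun x hx hx' => h ?_
  ext i
  exact ⟨fun hi => (hx' i (ht hi)).mp ((hx i (ht hi)).mpr hi),
    fun hi => (hx i (ht' hi)).mp ((hx' i (ht' hi)).mpr hi)⟩

namespace IsPoissonRandomMeasure

variable {Ω : Type w} [mΩ : MeasurableSpace Ω] {P : Measure Ω} {E : Type v}
  [MeasurableSpace E] {N : Ω → Measure E} {μ : Measure E}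

theorem countingSigma_le (hN : IsPoissonRandomMeasure P N μ) (D : Set E) :
    countingSigma N D ≤ mΩ :=
  iSup_le fun C => (hN.measurable C.1 C.2.1).comap_le

theorem iIndepFun_of_fintype (hN : IsPoissonRandomMeasure P N μ) {κ : Type*} [Fintype κ]
    (B : κ → Set E) (hB : ∀ i, MeasurableSet (B i))
    (hd : Pairwise fun i j => Disjoint (B i) (B j)) : iIndepFun (fun i ω => N ω (B i)) P := by
  have h := hN.indep _ (fun i => B ((Fintype.equivFin κ).symm i)) (fun i => hB _)
    fun i j hij => hd fun h => hij ((Fintype.equivFin κ).symm.injective h)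
  have h' := h.precomp (Fintype.equivFin κ).injective
  simpa using h'

/-- Independence is assumed only for disjoint sets, while the generators of `countingSigma` overlap.
For finitely many generators, each `N C` is a sum over atoms of the algebra they generate; these
atoms and `Q` are disjoint, and a directed supremum reaches all generators. -/
theorem indep_countingSigma [IsProbabilityMeasure P] (hN : IsPoissonRandomMeasure P N μ)
    {D Q : Set E} (hQ : MeasurableSet Q) (hDQ : Disjoint D Q) :
    Indep (countingSigma N D) (MeasurableSpace.comap (fun ω => N ω Q) inferInstance) P := by
  classical
  set β := {C : Set E // MeasurableSet C ∧ C ⊆ D}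
  have e : countingSigma N D = ⨆ c : Finset β, ⨆ C ∈ c,
      MeasurableSpace.comap (fun ω => N ω C.1) inferInstance :=
    le_antisymm (iSup_le fun C => le_iSup_of_le {C} (le_iSup₂_of_le C
      (Finset.mem_singleton_self C) le_rfl))
      (iSup_le fun c => iSup₂_le fun C _ => le_iSup_of_le C le_rfl)
  rw [e]
  refine indep_iSup_of_directed_le (fun c => ?_)
    (fun c => iSup₂_le fun C _ => (hN.measurable C.1 C.2.1).comap_le)
    (hN.measurable Q hQ).comap_le
    (Monotone.directed_le fun c c' h => iSup₂_le fun C hC => le_iSup₂_of_le C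
      (Finset.mem_of_subset h hC) le_rfl)
  set atom : Finset β → Set E := fun t => {x | ∀ C ∈ c, x ∈ C.1 ↔ C ∈ t} with hatom
  have hatom_meas : ∀ t, MeasurableSet (atom t) := fun t =>
    measurableSet_atom (A := fun C : β => C.1) (fun C => C.2.1) c t
  -- The empty index set is excluded: its atom lies outside all generators, so it contains `Q`. The
  -- other atoms lie in `D`.
  set T : Finset (Finset β) := c.powerset.filter Finset.Nonempty with hT
  set B : Option T → Set E := fun o => o.elim Q fun t => atom t.1 with hB
  have hQatom : ∀ t : T, Disjoint Q (atom t.1) := fun t => by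
    obtain ⟨ht, C, hC⟩ := Finset.mem_filter.mp t.2
    refine Set.disjoint_left.mpr fun x hxQ hx => Set.disjoint_left.mp hDQ ?_ hxQ
    exact C.2.2 ((hx C (Finset.mem_powerset.mp ht hC)).mpr hC)
  have hind := hN.iIndepFun_of_fintype B
    (fun o => by
      cases o with
      | none => exact hQ
      | some t => exact hatom_meas t.1)
    (fun o o' h => by
      cases o with
      | none =>
        cases o' with
        | none => exact absurd rfl h
        | some t => exact hQatom t
      | some t =>
        cases o' with
        | none => exact (hQatom t).symm
        | some t' =>
          refine disjoint_atom (Finset.mem_powerset.mp (Finset.mem_filter.mp t.2).1)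
            (Finset.mem_powerset.mp (Finset.mem_filter.mp t'.2).1) fun h' => h ?_
          rw [Subtype.ext h'])
  have hBm : ∀ o, MeasurableSet (B o) := fun o => by
    cases o with
    | none => exact hQ
    | some t => exact hatom_meas t.1
  have key := indep_iSup_of_disjoint (fun o => (hN.measurable (B o) (hBm o)).comap_le)
    hind (S := {none}ᶜ) (T := {none}) disjoint_compl_left
  refine indep_of_indep_of_le_left (indep_of_indep_of_le_right key ?_) ?_
  · exact le_iSup₂_of_le none rfl le_rfl
  · refine iSup₂_le fun C hC => Measurable.comap_le ?_
    have hCeq : C.1 = ⋃ t ∈ T.filter (C ∈ ·), atom t := by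
      ext x
      simp only [Set.mem_iUnion, Finset.mem_filter, exists_prop, hT, Finset.mem_powerset]
      constructor
      · intro hx
        refine ⟨c.filter fun C' => x ∈ C'.1, ⟨⟨Finset.filter_subset _ _, C, ?_⟩, ?_⟩, ?_⟩
        · exact Finset.mem_filter.mpr ⟨hC, hx⟩
        · exact Finset.mem_filter.mpr ⟨hC, hx⟩
        · intro C' hC'
          simp [hC']
      · rintro ⟨t, ⟨-, hCt⟩, hx⟩
        exact (hx C hC).mpr hCt
    have hsum : (fun ω => N ω C.1) = fun ω => ∑ t ∈ T.filter (C ∈ ·), N ω (atom t) := by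
      ext ω
      rw [hCeq, measure_biUnion_finset _ fun t _ => hatom_meas t]
      intro t ht t' ht' h
      exact disjoint_atom (Finset.mem_powerset.mp (Finset.mem_filter.mp
        (Finset.mem_filter.mp ht).1).1) (Finset.mem_powerset.mp (Finset.mem_filter.mp
        (Finset.mem_filter.mp ht').1).1) h
    rw [hsum]
    refine Finset.measurable_fun_sum _ fun t ht => ?_
    have htT := (Finset.mem_filter.mp ht).1
    exact (comap_measurable _).mono (le_iSup₂_of_le (some ⟨t, htT⟩) (by simp) le_rfl) le_rfl

theorem lintegral_mul_count [IsProbabilityMeasure P] (hN : IsPoissonRandomMeasure P N μ)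
    {D Q : Set E} (hQ : MeasurableSet Q) (hDQ : Disjoint D Q) {W : Ω → ℝ≥0∞}
    (hW : Measurable[countingSigma N D] W) :
    ∫⁻ ω, W ω * N ω Q ∂P = (∫⁻ ω, W ω ∂P) * μ Q := by
  rw [lintegral_mul_eq_lintegral_mul_lintegral_of_independent_measurableSpace
    (hN.countingSigma_le D) (hN.measurable Q hQ).comap_le (hN.indep_countingSigma hQ hDQ) hW
    (comap_measurable _), hN.intensity Q hQ]

theorem ae_count_ne_top (hN : IsPoissonRandomMeasure P N μ) {Q : Set E} (hQ : MeasurableSet Q)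
    (hμ : μ Q ≠ ∞) : ∀ᵐ ω ∂P, N ω Q ≠ ∞ := by
  have := ae_lt_top (hN.measurable Q hQ) (by rwa [hN.intensity Q hQ])
  filter_upwards [this] with ω hω using hω.ne

/-- Since `n ^ m ≤ m! * e ^ n`, the series is dominated by an exponential series with parameter `e *
r`. -/
theorem integrable_pow_poissonMeasure (r : ℝ≥0) (m : ℕ) :
    Integrable (fun n : ℕ => (n : ℝ) ^ m) (poissonMeasure r) := by
  rw [integrable_poissonMeasure_iff]
  have h := (Real.summable_pow_div_factorial (Real.exp 1 * r)).mul_left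
    (Real.exp (-r) * m.factorial)
  refine Summable.of_nonneg_of_le (fun n => by positivity) (fun n => ?_) h
  have h1 := Real.pow_div_factorial_le_exp (n : ℝ) (Nat.cast_nonneg n) m
  rw [div_le_iff₀ (by positivity), ← Real.exp_one_pow] at h1
  rw [Real.norm_of_nonneg (by positivity), mul_pow]
  calc Real.exp (-r) * r ^ n / n.factorial * (n : ℝ) ^ m
      ≤ Real.exp (-r) * r ^ n / n.factorial * (Real.exp 1 ^ n * m.factorial) := by gcongr
    _ = _ := by ring

theorem memLp_count [IsProbabilityMeasure P] (hN : IsPoissonRandomMeasure P N μ) {Q : Set E}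
    (hQ : MeasurableSet Q) (hμ : μ Q ≠ ∞) (p : ℝ) :
    MemLp (fun ω => (N ω Q).toReal) (ENNReal.ofReal p) P := by
  obtain ⟨m, hm⟩ := exists_nat_ge p
  have hNm : Measurable fun ω => (N ω Q).toReal := (hN.measurable Q hQ).ennreal_toReal
  have h1 : Integrable (fun ω => (N ω Q).toReal ^ (m + 1)) P := by
    have hg : Measurable fun x : ℝ≥0∞ => x.toReal ^ (m + 1) :=
      ENNReal.measurable_toReal.pow_const _
    refine (integrable_map_measure (g := fun x : ℝ≥0∞ => x.toReal ^ (m + 1))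
      hg.aestronglyMeasurable (hN.measurable Q hQ).aemeasurable).mp ?_
    rw [hN.law Q hQ hμ]
    refine (integrable_map_measure hg.aestronglyMeasurable .of_discrete).mpr ?_
    simpa [Function.comp_def] using integrable_pow_poissonMeasure (μ Q).toNNReal (m + 1)
  have h2 : MemLp (fun ω => (N ω Q).toReal) ((m + 1 : ℕ) : ℝ≥0∞) P := by
    rw [← integrable_norm_rpow_iff hNm.aestronglyMeasurable (by simp) (ENNReal.natCast_ne_top _)]
    simpa only [Real.norm_of_nonneg ENNReal.toReal_nonneg, ENNReal.toReal_natCast,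
      Real.rpow_natCast] using h1
  refine h2.mono_exponent ?_
  rw [← ENNReal.ofReal_natCast]
  refine ENNReal.ofReal_le_ofReal (hm.trans ?_)
  push_cast
  linarith

end IsPoissonRandomMeasure

/-! ### Predictable cells, and the passage from jumps to intensity -/

/-- Finitely many cells `Q k` of small measure, exhausted by the increasing sets `D k`, and
coefficients `F k` which only depend on the random measure on `D k`. -/
structure IsPredictableCells {Ω : Type w} [MeasurableSpace Ω] (P : Measure Ω) {E : Type v}
    [MeasurableSpace E] (N : Ω → Measure E) (μ : Measure E) {X : Type u} [NormedAddCommGroup X]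
    (n : ℕ) (D Q : ℕ → Set E) (F : ℕ → Ω → X) : Prop where
  monotone : Monotone D
  measurableSet : ∀ k, MeasurableSet (Q k)
  measure_le : ∀ k, μ (Q k) ≤ 2⁻¹
  subset : ∀ k, Q k ⊆ D (k + 1)
  disjoint : ∀ k, Disjoint (D k) (Q k)
  stronglyMeasurable : ∀ k, StronglyMeasurable[countingSigma N (D k)] (F k)
  memLp : ∀ k, MemLp (F k) ∞ P
  eq_zero : ∀ k, n ≤ k → F k = 0

/-- Either `k = 0`, or `m ≤ 1/2 ≤ k/2`. This is where the bound `1/2` on the measure of a cell comes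
from. -/
theorem coe_le_two_mul_enorm_sub {k : ℕ∞} (hk : (k : ℝ≥0∞) ≠ ∞) {m : ℝ≥0∞} (hm : m ≤ 2⁻¹) :
    (k : ℝ≥0∞) ≤ 2 * ‖(k : ℝ≥0∞).toReal - m.toReal‖ₑ := by
  have hm' : m.toReal ≤ 1 / 2 := by
    have := ENNReal.toReal_mono (by simp) hm
    simpa using this
  induction k with
  | top => simp at hk
  | coe k =>
    rcases Nat.eq_zero_or_pos k with rfl | h
    · simp
    · have h1 : (1 : ℝ) ≤ k := by exact_mod_cast h
      have e : ((k : ℕ∞) : ℝ≥0∞) = ENNReal.ofReal k := by simp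
      have h2 : (0 : ℝ) ≤ k - m.toReal := by linarith
      rw [e, ENNReal.toReal_ofReal (by positivity), Real.enorm_of_nonneg h2,
        show (2 : ℝ≥0∞) = ENNReal.ofReal 2 by simp, ← ENNReal.ofReal_mul (by norm_num)]
      exact ENNReal.ofReal_le_ofReal (by linarith)

theorem ENat.le_rpow_toENNReal {k : ℕ∞} {p : ℝ} (hp : 1 ≤ p) :
    (k : ℝ≥0∞) ≤ (k : ℝ≥0∞) ^ p := by
  rcases eq_or_ne k 0 with rfl | h
  · simp
  · have h1 : (1 : ℝ≥0∞) ≤ k := by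
      exact_mod_cast Order.one_le_iff_ne_zero.mpr h
    exact ENNReal.le_rpow_self_of_one_le h1 hp

namespace IsPredictableCells

variable {Ω : Type w} [mΩ : MeasurableSpace Ω] {P : Measure Ω} {E : Type v}
  [MeasurableSpace E] {N : Ω → Measure E} {μ : Measure E} {X : Type u} [NormedAddCommGroup X]
  {n : ℕ} {D Q : ℕ → Set E} {F : ℕ → Ω → X}

/-- The filtration generated by the random measure on the sets `D k`. -/
def filtration (hN : IsPoissonRandomMeasure P N μ) (hQ : IsPredictableCells P N μ n D Q F) :
    Filtration ℕ mΩ where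
  seq k := countingSigma N (D k)
  mono' _ _ h := countingSigma_mono N (hQ.monotone h)
  le' k := hN.countingSigma_le (D k)

theorem measure_ne_top (hQ : IsPredictableCells P N μ n D Q F) (k : ℕ) : μ (Q k) ≠ ∞ :=
  ((hQ.measure_le k).trans_lt (by simp)).ne

theorem measurable_count (hQ : IsPredictableCells P N μ n D Q F) (k : ℕ) :
    Measurable[countingSigma N (D (k + 1))] fun ω => N ω (Q k) :=
  measurable_countingSigma N (hQ.measurableSet k) (hQ.subset k)

theorem pairwise_disjoint (hQ : IsPredictableCells P N μ n D Q F) :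
    Pairwise fun i j => Disjoint (Q i) (Q j) := by
  have h : ∀ i j, i < j → Disjoint (Q i) (Q j) := fun i j hij =>
    (hQ.disjoint j).mono_left ((hQ.subset i).trans (hQ.monotone hij))
  intro i j hij
  rcases lt_or_gt_of_ne hij with h' | h'
  · exact h i j h'
  · exact (h j i h').symm

theorem memLp_compensated_smul [NormedSpace ℝ X] [IsProbabilityMeasure P]
    (hN : IsPoissonRandomMeasure P N μ)
    (hQ : IsPredictableCells P N μ n D Q F) (k : ℕ) (p : ℝ) :
    MemLp (fun ω => compensated N μ (Q k) ω • F k ω) (ENNReal.ofReal p) P := by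
  have h1 : MemLp (fun ω => compensated N μ (Q k) ω) (ENNReal.ofReal p) P :=
    (hN.memLp_count (hQ.measurableSet k) (hQ.measure_ne_top k) p).sub (memLp_const _)
  exact (hQ.memLp k).smul h1

theorem isMartingaleDifference [NormedSpace ℝ X] [CompleteSpace X] [IsProbabilityMeasure P]
    (hN : IsPoissonRandomMeasure P N μ) (hQ : IsPredictableCells P N μ n D Q F) :
    IsMartingaleDifference P (hQ.filtration hN)
      (fun k ω => compensated N μ (Q k) ω • F k ω) := by
  have hc : ∀ k, Measurable[countingSigma N (D (k + 1))] (compensated N μ (Q k)) := fun k =>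
    (hQ.measurable_count k).ennreal_toReal.sub_const _
  have hint : ∀ k, Integrable (fun ω => compensated N μ (Q k) ω • F k ω) P := fun k =>
    (hQ.memLp_compensated_smul hN k 1).integrable (by simp)
  have hcount : ∀ k, Integrable (fun ω => (N ω (Q k)).toReal) P := fun k =>
    (hN.memLp_count (hQ.measurableSet k) (hQ.measure_ne_top k) 1).integrable (by simp)
  have hcint : ∀ k, Integrable (compensated N μ (Q k)) P := fun k =>
    (hcount k).sub (integrable_const _)
  refine ⟨fun k => (hc k).stronglyMeasurable.smul
    ((hQ.stronglyMeasurable k).mono (countingSigma_mono N (hQ.monotone k.le_succ))), hint,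
    fun k => ?_⟩
  have h0 : ∫ ω, compensated N μ (Q k) ω ∂P = 0 := by
    simp only [compensated]
    rw [integral_sub (hcount k) (integrable_const _), integral_toReal
      (hN.measurable _ (hQ.measurableSet k)).aemeasurable, hN.intensity _ (hQ.measurableSet k)]
    · simp
    · filter_upwards [hN.ae_count_ne_top (hQ.measurableSet k) (hQ.measure_ne_top k)] with ω hω
      exact hω.lt_top
  have h1 : P[compensated N μ (Q k) | countingSigma N (D k)] =ᵐ[P]
      fun _ => ∫ ω, compensated N μ (Q k) ω ∂P :=
    condExp_indep_eq (hN.measurable _ (hQ.measurableSet k)).comap_le (hN.countingSigma_le _)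
      (((comap_measurable _).ennreal_toReal.sub_const _).stronglyMeasurable)
      (hN.indep_countingSigma (hQ.measurableSet k) (hQ.disjoint k)).symm
  refine (condExp_smul_of_aestronglyMeasurable_right (f := compensated N μ (Q k))
    (hcint k) (hint k) (hQ.stronglyMeasurable k).aestronglyMeasurable).trans ?_
  filter_upwards [h1] with ω hω
  exact smul_eq_zero_of_left (hω.trans h0) _

theorem lintegral_mul_count [IsProbabilityMeasure P] (hN : IsPoissonRandomMeasure P N μ)
    (hQ : IsPredictableCells P N μ n D Q F) (k : ℕ) {W : Ω → ℝ≥0∞}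
    (hW : Measurable[countingSigma N (D k)] W) :
    ∫⁻ ω, W ω * N ω (Q k) ∂P = ∫⁻ ω, W ω * μ (Q k) ∂P := by
  rw [hN.lintegral_mul_count (hQ.measurableSet k) (hQ.disjoint k) hW,
    lintegral_mul_const _ (hW.mono (hN.countingSigma_le _) le_rfl)]

theorem ae_count_ne_top (hN : IsPoissonRandomMeasure P N μ)
    (hQ : IsPredictableCells P N μ n D Q F) : ∀ᵐ ω ∂P, ∀ k, N ω (Q k) ≠ ∞ :=
  ae_all_iff.mpr fun k => hN.ae_count_ne_top (hQ.measurableSet k) (hQ.measure_ne_top k)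

/-- The `s`-th powers of the jumps of the stochastic integral. -/
theorem _root_.HasMartingaleCotype.exists_lintegral_jumps_le {X : Type u}
    [NormedAddCommGroup X] [NormedSpace ℝ X] [CompleteSpace X] {s : ℝ} (hs : 1 ≤ s)
    (hX : HasMartingaleCotype.{u, w} X s) {p : ℝ} (hp : 1 < p) :
    ∃ C : ℝ≥0, ∀ (Ω : Type w) [MeasurableSpace Ω] (P : Measure Ω) [IsProbabilityMeasure P]
      (E : Type v) [MeasurableSpace E] (N : Ω → Measure E) (μ : Measure E)
      (_ : IsPoissonRandomMeasure P N μ) (n : ℕ) (D Q : ℕ → Set E) (F : ℕ → Ω → X)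
      (_ : IsPredictableCells P N μ n D Q F),
      ∫⁻ ω, (∑ k ∈ Finset.range n, (‖F k ω‖ₑ * N ω (Q k)) ^ s) ^ (p / s) ∂P ≤
        C * ∫⁻ ω, ‖∑ k ∈ Finset.range n, compensated N μ (Q k) ω • F k ω‖ₑ ^ p ∂P := by
  obtain ⟨C, hC⟩ := hX.exists_lintegral_rpow_le hs hp
  have hs0 : 0 < s := by linarith
  have hp0 : 0 < p := by linarith
  refine ⟨2 ^ p * C, fun Ω _ P _ E _ N μ hN n D Q F hQ => ?_⟩
  have h := hC Ω P (hQ.filtration hN) _ (hQ.isMartingaleDifference hN)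
    (fun k => hQ.memLp_compensated_smul hN k p) n fun i hi => by
      ext ω
      simp [hQ.eq_zero i hi]
  have h1 : ∀ᵐ ω ∂P, (∑ k ∈ Finset.range n, (‖F k ω‖ₑ * N ω (Q k)) ^ s) ^ (p / s) ≤
      2 ^ p * (∑ k ∈ Finset.range n, ‖compensated N μ (Q k) ω • F k ω‖ₑ ^ s) ^ (p / s) := by
    filter_upwards [hQ.ae_count_ne_top hN] with ω hω
    have h2 : ∑ k ∈ Finset.range n, (‖F k ω‖ₑ * N ω (Q k)) ^ s ≤
        2 ^ s * ∑ k ∈ Finset.range n, ‖compensated N μ (Q k) ω • F k ω‖ₑ ^ s := by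
      rw [Finset.mul_sum]
      refine Finset.sum_le_sum fun k _ => ?_
      rw [← ENNReal.mul_rpow_of_nonneg _ _ hs0.le]
      refine ENNReal.rpow_le_rpow ?_ hs0.le
      obtain ⟨j, hj⟩ := hN.integer_valued ω (Q k) (hQ.measurableSet k)
      rw [enorm_smul, ← mul_assoc, mul_comm]
      gcongr
      rw [compensated, hj]
      exact coe_le_two_mul_enorm_sub (hj ▸ hω k) (hQ.measure_le k)
    refine (ENNReal.rpow_le_rpow h2 (by positivity)).trans_eq ?_
    rw [ENNReal.mul_rpow_of_nonneg _ _ (by positivity), ← ENNReal.rpow_mul,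
      mul_div_cancel₀ p hs0.ne']
  refine (lintegral_mono_ae h1).trans ?_
  rw [lintegral_const_mul' _ _ (by simp), ENNReal.coe_mul, mul_assoc,
    ENNReal.coe_rpow_of_nonneg _ hp0.le]
  exact mul_le_mul_right h _

theorem measurable_jumps (hQ : IsPredictableCells P N μ n D Q F) (s : ℝ) (k : ℕ) :
    Measurable[countingSigma N (D (k + 1))] fun ω => (‖F k ω‖ₑ * N ω (Q k)) ^ s :=
  (((hQ.stronglyMeasurable k).mono
    (countingSigma_mono N (hQ.monotone k.le_succ))).enorm.mul (hQ.measurable_count k)).pow_const s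

theorem measurable_sum_jumps (hQ : IsPredictableCells P N μ n D Q F) (s : ℝ) (k : ℕ) :
    Measurable[countingSigma N (D k)] fun ω =>
      ∑ i ∈ Finset.range k, (‖F i ω‖ₑ * N ω (Q i)) ^ s :=
  Finset.measurable_fun_sum _ fun i hi => (hQ.measurable_jumps s i).mono
    (countingSigma_mono N (hQ.monotone (Finset.mem_range.mp hi))) le_rfl

theorem mul_count_le_rpow (hN : IsPoissonRandomMeasure P N μ)
    (hQ : IsPredictableCells P N μ n D Q F) {p : ℝ} (hp : 1 ≤ p) (k : ℕ) (ω : Ω) :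
    ‖F k ω‖ₑ ^ p * N ω (Q k) ≤ (‖F k ω‖ₑ * N ω (Q k)) ^ p := by
  rw [ENNReal.mul_rpow_of_nonneg _ _ (by linarith)]
  gcongr
  obtain ⟨j, hj⟩ := hN.integer_valued ω (Q k) (hQ.measurableSet k)
  rw [hj]
  exact ENat.le_rpow_toENNReal hp

/-- In expectation `μ (Q k)` may be replaced by `N (Q k)`, integrality gives `N ≤ N ^ p`, and
superadditivity of `x ^ (p / s)` gathers the sum. -/
theorem lintegral_sum_rpow_mul_measure_le [IsProbabilityMeasure P]
    (hN : IsPoissonRandomMeasure P N μ)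
    (hQ : IsPredictableCells P N μ n D Q F) {s p : ℝ} (hs : 1 ≤ s) (hsp : s ≤ p) :
    ∫⁻ ω, ∑ k ∈ Finset.range n, ‖F k ω‖ₑ ^ p * μ (Q k) ∂P ≤
      ∫⁻ ω, (∑ k ∈ Finset.range n, (‖F k ω‖ₑ * N ω (Q k)) ^ s) ^ (p / s) ∂P := by
  have hs0 : 0 < s := by linarith
  have hF : ∀ k, Measurable[countingSigma N (D k)] fun ω => ‖F k ω‖ₑ ^ p := fun k =>
    (hQ.stronglyMeasurable k).enorm.pow_const p
  have hF' : ∀ k, Measurable fun ω => ‖F k ω‖ₑ ^ p := fun k =>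
    (hF k).mono (hN.countingSigma_le _) le_rfl
  have hNm : ∀ k, Measurable fun ω => N ω (Q k) := fun k => hN.measurable _ (hQ.measurableSet k)
  rw [lintegral_finsetSum _ fun k _ => (hF' k).mul_const _,
    Finset.sum_congr rfl fun k _ => (hQ.lintegral_mul_count hN k (hF k)).symm,
    ← lintegral_finsetSum _ fun k _ => (hF' k).fun_mul (hNm k)]
  refine lintegral_mono fun ω => ?_
  refine le_trans (Finset.sum_le_sum fun k _ => ?_)
    (ENNReal.sum_rpow_le_rpow_sum ((one_le_div hs0).mpr hsp) _ _)
  rw [← ENNReal.rpow_mul, mul_div_cancel₀ p hs0.ne']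
  exact hQ.mul_count_le_rpow hN (hs.trans hsp) k ω

/-- The dual Doob inequality with exponent `p / s ≥ 1`: `‖F k‖^s μ (Q k)` is the predictable
counterpart of `‖F k‖^s N (Q k)`, and `N ≤ N ^ s`. -/
theorem lintegral_rpow_sum_mul_measure_le [IsProbabilityMeasure P]
    (hN : IsPoissonRandomMeasure P N μ)
    (hQ : IsPredictableCells P N μ n D Q F) {s p : ℝ} (hs : 1 ≤ s) (hsp : s ≤ p) :
    ∫⁻ ω, (∑ k ∈ Finset.range n, ‖F k ω‖ₑ ^ s * μ (Q k)) ^ (p / s) ∂P ≤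
      ENNReal.ofReal (p / s) ^ (p / s) *
        ∫⁻ ω, (∑ k ∈ Finset.range n, (‖F k ω‖ₑ * N ω (Q k)) ^ s) ^ (p / s) ∂P := by
  have hs0 : 0 < s := by linarith
  have hr : 1 ≤ p / s := (one_le_div hs0).mpr hsp
  have hF : ∀ k, Measurable[countingSigma N (D k)] fun ω => ‖F k ω‖ₑ ^ s := fun k =>
    (hQ.stronglyMeasurable k).enorm.pow_const s
  have hF' : ∀ k, Measurable fun ω => ‖F k ω‖ₑ ^ s := fun k =>
    (hF k).mono (hN.countingSigma_le _) le_rfl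
  have hNm : ∀ k, Measurable fun ω => N ω (Q k) := fun k => hN.measurable _ (hQ.measurableSet k)
  refine (lintegral_sum_rpow_le_of_predictable (ℱ := hQ.filtration hN) hr
    (α := fun k ω => ‖F k ω‖ₑ ^ s * μ (Q k)) (a := fun k ω => ‖F k ω‖ₑ ^ s * N ω (Q k))
    (fun k => (hF k).mul_const _) (fun k => ((hF' k).mul (hNm k)).aemeasurable)
    (fun k W hW => ?_) n ?_).trans ?_
  · simp_rw [mul_right_comm _ _ (W _)]
    exact (hQ.lintegral_mul_count hN k ((hF k).mul hW)).ge
  -- Essential boundedness of the coefficients supplies the finiteness required by the dual Doob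
  -- inequality.
  · have hb : ∀ᵐ ω ∂P, (∑ k ∈ Finset.range n, ‖F k ω‖ₑ ^ s * μ (Q k)) ^ (p / s) ≤
        (∑ k ∈ Finset.range n, eLpNorm (F k) ∞ P ^ s * μ (Q k)) ^ (p / s) := by
      have h : ∀ᵐ ω ∂P, ∀ k, ‖F k ω‖ₑ ≤ eLpNorm (F k) ∞ P := ae_all_iff.mpr fun k => by
        rw [eLpNorm_exponent_top]
        exact ae_le_eLpNormEssSup
      filter_upwards [h] with ω hω
      gcongr with k hk
      exact hω k
    refine ((lintegral_mono_ae hb).trans_lt ?_).ne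
    rw [lintegral_const, measure_univ, mul_one]
    refine ENNReal.rpow_lt_top_of_nonneg (by linarith) (ENNReal.sum_ne_top.mpr fun k _ => ?_)
    exact ENNReal.mul_ne_top (ENNReal.rpow_ne_top_of_nonneg hs0.le (hQ.memLp k).2.ne)
      (hQ.measure_ne_top k)
  · gcongr with ω k hk
    exact hQ.mul_count_le_rpow hN hs k ω

end IsPredictableCells

/-! ### Splitting the coefficients when `p < s` -/

/-- The constant in the Davis-type estimates for exponents `r < 1`. -/
noncomputable def davisConst (r : ℝ) : ℝ≥0 :=
  r.toNNReal * 2 ^ (r - 1)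

theorem davisConst_pos {r : ℝ} (hr : 0 < r) : 0 < davisConst r :=
  mul_pos (Real.toNNReal_pos.mpr hr) (NNReal.rpow_pos two_pos)

/-- Concavity bounds the increment of `y ^ r` below by `r * x * (S + x) ^ (r - 1)`. Since `S + x ≤ 2
* max S x` and `r - 1 ≤ 0`, the factor `2 ^ (r - 1)` appears. -/
theorem NNReal.rpow_add_davisConst_le {r : ℝ} (hr0 : 0 < r) (hr1 : r ≤ 1) (S x : ℝ≥0) :
    S ^ r + davisConst r * (x * max S x ^ (r - 1)) ≤ (S + x) ^ r := by
  refine le_trans ?_ (NNReal.rpow_add_mul_le_add_rpow hr0.le hr1 x S)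
  rcases eq_or_ne (S + x) 0 with h | h
  · obtain ⟨rfl, rfl⟩ := add_eq_zero.mp h
    simp
  have h1 : (2 * max S x) ^ (r - 1) ≤ (S + x) ^ (r - 1) := by
    rw [← NNReal.coe_le_coe, NNReal.coe_rpow, NNReal.coe_rpow]
    refine Real.rpow_le_rpow_of_nonpos (NNReal.coe_pos.mpr (pos_iff_ne_zero.mpr h)) ?_
      (by linarith)
    rw [NNReal.coe_le_coe, two_mul]
    exact add_le_add (le_max_left _ _) (le_max_right _ _)
  rw [davisConst, mul_assoc, mul_left_comm (2 ^ (r - 1)), ← NNReal.mul_rpow]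
  gcongr

/-- A nonzero jump `x = f * n ^ s` exceeds `S`, so the gain is a multiple of `x ^ r = f ^ r * n ^ (s
* r)`, and `n ≤ n ^ (s * r)`. In applications `f = ‖F k‖^s` and `n = N(Q k)`. -/
theorem NNReal.rpow_add_davisConst_le_of_lt {r s : ℝ} (hr0 : 0 < r) (hr1 : r ≤ 1) (hs : 0 ≤ s)
    (hrs : 1 ≤ s * r) {f S n : ℝ≥0} (hn : n = 0 ∨ 1 ≤ n) (h : S < f) :
    S ^ r + davisConst r * (f ^ r * n) ≤ (S + f * n ^ s) ^ r := by
  rcases hn with rfl | hn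
  · rw [mul_zero, mul_zero, add_zero]
    exact NNReal.rpow_le_rpow le_self_add hr0.le
  refine le_trans ?_ (NNReal.rpow_add_davisConst_le hr0 hr1 S (f * n ^ s))
  have hx : f ≤ f * n ^ s := le_mul_of_one_le_right zero_le (NNReal.one_le_rpow hn hs)
  have hf : 0 < f := zero_le.trans_lt h
  have hpos : 0 < f * n ^ s := hf.trans_le hx
  rw [max_eq_right (h.le.trans hx)]
  have e : f * n ^ s * (f * n ^ s) ^ (r - 1) = f ^ r * n ^ (s * r) := by
    rw [NNReal.rpow_sub_one hpos.ne', mul_div_cancel₀ _ hpos.ne', NNReal.mul_rpow,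
      NNReal.rpow_mul]
  rw [e]
  gcongr
  nth_rw 1 [← NNReal.rpow_one n]
  exact NNReal.rpow_le_rpow_of_exponent_le hn hrs

/-- If the jump `x = f * n ^ s` stays below `S`, the gain contains `x * S ^ (r - 1)`. Otherwise it
contains `x ^ r`, and `f ≤ S` gives `f ^ (r - 1) ≥ S ^ (r - 1)`. -/
theorem NNReal.rpow_add_davisConst_le_of_le {r s : ℝ} (hr0 : 0 < r) (hr1 : r ≤ 1) (hs : 1 ≤ s)
    (hrs : 1 ≤ s * r) {f S n : ℝ≥0} (hn : n = 0 ∨ 1 ≤ n) (h : f ≤ S) :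
    S ^ r + davisConst r * (f * n * S ^ (r - 1)) ≤ (S + f * n ^ s) ^ r := by
  rcases hn with rfl | hn
  · rw [mul_zero, zero_mul, mul_zero, add_zero]
    exact NNReal.rpow_le_rpow le_self_add hr0.le
  rcases eq_or_ne f 0 with rfl | hf
  · simp
  refine le_trans ?_ (NNReal.rpow_add_davisConst_le hr0 hr1 S (f * n ^ s))
  have hf0 : 0 < f := pos_iff_ne_zero.mpr hf
  have hx : f ≤ f * n ^ s := le_mul_of_one_le_right zero_le (NNReal.one_le_rpow hn (by linarith))
  have hpos : 0 < f * n ^ s := hf0.trans_le hx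
  have hle : ∀ {t : ℝ}, 1 ≤ t → n ≤ n ^ t := fun {t} ht => by
    nth_rw 1 [← NNReal.rpow_one n]
    exact NNReal.rpow_le_rpow_of_exponent_le hn ht
  refine add_le_add le_rfl (mul_le_mul_right ?_ _)
  rcases le_total (f * n ^ s) S with h' | h'
  · rw [max_eq_left h']
    gcongr
    exact hle hs
  · rw [max_eq_right h']
    have e : f * n ^ s * (f * n ^ s) ^ (r - 1) = f * f ^ (r - 1) * n ^ (s * r) := by
      rw [NNReal.rpow_sub_one hpos.ne', mul_div_cancel₀ _ hpos.ne', NNReal.mul_rpow,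
        NNReal.rpow_mul, NNReal.rpow_sub_one hf, mul_div_cancel₀ _ hf]
    rw [e, mul_right_comm]
    have h1 : S ^ (r - 1) ≤ f ^ (r - 1) := by
      rw [← NNReal.coe_le_coe, NNReal.coe_rpow, NNReal.coe_rpow]
      exact Real.rpow_le_rpow_of_nonpos (NNReal.coe_pos.mpr hf0) (NNReal.coe_le_coe.mpr h)
        (by linarith)
    gcongr
    exact hle hrs

theorem ENNReal.mul_sum_le_of_forall_add_le {S y : ℕ → ℝ≥0∞} {κ : ℝ≥0∞} (n : ℕ)
    (h : ∀ k < n, S k + κ * y k ≤ S (k + 1)) : κ * ∑ k ∈ Finset.range n, y k ≤ S n := by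
  induction n with
  | zero => simp
  | succ n ih =>
    rw [Finset.sum_range_succ, mul_add]
    exact (add_le_add (ih fun k hk => h k (by omega)) le_rfl).trans (h n (by omega))

namespace IsPredictableCells

section Parts

variable {Ω : Type w} {E : Type v} [MeasurableSpace E] {N : Ω → Measure E} {X : Type u}
  [NormedAddCommGroup X] {Q : ℕ → Set E} {F : ℕ → Ω → X}

/-- The coefficients which are dominated by the jumps of the past. -/
noncomputable def smallPart (N : Ω → Measure E) (Q : ℕ → Set E) (F : ℕ → Ω → X) (s : ℝ) (k : ℕ) :
    Ω → X :=
  {ω | ‖F k ω‖ₑ ^ s ≤ ∑ i ∈ Finset.range k, (‖F i ω‖ₑ * N ω (Q i)) ^ s}.indicator (F k)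

/-- The coefficients which are larger than the jumps of the past. -/
noncomputable def largePart (N : Ω → Measure E) (Q : ℕ → Set E) (F : ℕ → Ω → X) (s : ℝ) (k : ℕ) :
    Ω → X :=
  {ω | ‖F k ω‖ₑ ^ s ≤ ∑ i ∈ Finset.range k, (‖F i ω‖ₑ * N ω (Q i)) ^ s}ᶜ.indicator (F k)

theorem smallPart_of_le {s : ℝ} {k : ℕ} {ω : Ω}
    (h : ‖F k ω‖ₑ ^ s ≤ ∑ i ∈ Finset.range k, (‖F i ω‖ₑ * N ω (Q i)) ^ s) :
    smallPart N Q F s k ω = F k ω :=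
  indicator_of_mem (s := {ω | ‖F k ω‖ₑ ^ s ≤
    ∑ i ∈ Finset.range k, (‖F i ω‖ₑ * N ω (Q i)) ^ s}) h _

theorem smallPart_of_not_le {s : ℝ} {k : ℕ} {ω : Ω}
    (h : ¬ ‖F k ω‖ₑ ^ s ≤ ∑ i ∈ Finset.range k, (‖F i ω‖ₑ * N ω (Q i)) ^ s) :
    smallPart N Q F s k ω = 0 :=
  indicator_of_notMem (s := {ω | ‖F k ω‖ₑ ^ s ≤
    ∑ i ∈ Finset.range k, (‖F i ω‖ₑ * N ω (Q i)) ^ s}) h _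

theorem largePart_of_le {s : ℝ} {k : ℕ} {ω : Ω}
    (h : ‖F k ω‖ₑ ^ s ≤ ∑ i ∈ Finset.range k, (‖F i ω‖ₑ * N ω (Q i)) ^ s) :
    largePart N Q F s k ω = 0 :=
  indicator_of_notMem (s := {ω | ‖F k ω‖ₑ ^ s ≤
    ∑ i ∈ Finset.range k, (‖F i ω‖ₑ * N ω (Q i)) ^ s}ᶜ) (fun h' => h' h) _

theorem largePart_of_not_le {s : ℝ} {k : ℕ} {ω : Ω}
    (h : ¬ ‖F k ω‖ₑ ^ s ≤ ∑ i ∈ Finset.range k, (‖F i ω‖ₑ * N ω (Q i)) ^ s) :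
    largePart N Q F s k ω = F k ω :=
  indicator_of_mem (s := {ω | ‖F k ω‖ₑ ^ s ≤
    ∑ i ∈ Finset.range k, (‖F i ω‖ₑ * N ω (Q i)) ^ s}ᶜ) h _

theorem smallPart_add_largePart (s : ℝ) (k : ℕ) (ω : Ω) :
    smallPart N Q F s k ω + largePart N Q F s k ω = F k ω := by
  rw [smallPart, largePart, ← Pi.add_apply, Set.indicator_self_add_compl]

theorem sum_jumps_ne_top {s : ℝ} (hs : 0 ≤ s) {ω : Ω} (h : ∀ k, N ω (Q k) ≠ ∞) (k : ℕ) :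
    ∑ i ∈ Finset.range k, (‖F i ω‖ₑ * N ω (Q i)) ^ s ≠ ∞ :=
  ENNReal.sum_ne_top.mpr fun i _ => ENNReal.rpow_ne_top_of_nonneg hs
    (ENNReal.mul_ne_top enorm_ne_top (h i))

end Parts

variable {Ω : Type w} [mΩ : MeasurableSpace Ω] {P : Measure Ω} {E : Type v}
  [MeasurableSpace E] {N : Ω → Measure E} {μ : Measure E} {X : Type u} [NormedAddCommGroup X]
  {n : ℕ} {D Q : ℕ → Set E} {F : ℕ → Ω → X}

theorem measurableSet_small (hQ : IsPredictableCells P N μ n D Q F) (s : ℝ) (k : ℕ) :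
    MeasurableSet[countingSigma N (D k)]
      {ω | ‖F k ω‖ₑ ^ s ≤ ∑ i ∈ Finset.range k, (‖F i ω‖ₑ * N ω (Q i)) ^ s} :=
  @measurableSet_le _ _ _ _ _ (countingSigma N (D k)) _ _ _ _ _
    ((hQ.stronglyMeasurable k).enorm.pow_const s) (hQ.measurable_sum_jumps s k)

theorem stronglyMeasurable_smallPart (hQ : IsPredictableCells P N μ n D Q F) (s : ℝ) (k : ℕ) :
    StronglyMeasurable[countingSigma N (D k)] (smallPart N Q F s k) :=
  (hQ.stronglyMeasurable k).indicator (hQ.measurableSet_small s k)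

theorem stronglyMeasurable_largePart (hQ : IsPredictableCells P N μ n D Q F) (s : ℝ) (k : ℕ) :
    StronglyMeasurable[countingSigma N (D k)] (largePart N Q F s k) :=
  (hQ.stronglyMeasurable k).indicator (hQ.measurableSet_small s k).compl

theorem exists_count_eq (hN : IsPoissonRandomMeasure P N μ)
    (hQ : IsPredictableCells P N μ n D Q F) {ω : Ω} {k : ℕ} (h : N ω (Q k) ≠ ∞) :
    ∃ m : ℝ≥0, (m = 0 ∨ 1 ≤ m) ∧ N ω (Q k) = m := by
  obtain ⟨j, hj⟩ := hN.integer_valued ω (Q k) (hQ.measurableSet k)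
  induction j with
  | top => simp [hj] at h
  | coe j =>
    refine ⟨j, ?_, by simpa using hj⟩
    rcases Nat.eq_zero_or_pos j with rfl | h'
    · simp
    · exact Or.inr (by exact_mod_cast h')

theorem davisConst_mul_sum_largePart_le (hN : IsPoissonRandomMeasure P N μ)
    (hQ : IsPredictableCells P N μ n D Q F) {s p : ℝ} (hp : 1 ≤ p) (hps : p ≤ s) {ω : Ω}
    (h : ∀ k, N ω (Q k) ≠ ∞) :
    davisConst (p / s) * ∑ k ∈ Finset.range n, ‖largePart N Q F s k ω‖ₑ ^ p * N ω (Q k) ≤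
      (∑ k ∈ Finset.range n, (‖F k ω‖ₑ * N ω (Q k)) ^ s) ^ (p / s) := by
  have hp0 : 0 < p := by linarith
  have hs0 : 0 < s := by linarith
  have hr0 : 0 < p / s := by positivity
  have hr1 : p / s ≤ 1 := (div_le_one hs0).mpr hps
  have hrs : s * (p / s) = p := mul_div_cancel₀ p hs0.ne'
  refine ENNReal.mul_sum_le_of_forall_add_le
    (S := fun k => (∑ i ∈ Finset.range k, (‖F i ω‖ₑ * N ω (Q i)) ^ s) ^ (p / s)) n fun k _ => ?_
  have hfin := sum_jumps_ne_top (F := F) hs0.le h k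
  rw [Finset.sum_range_succ]
  by_cases hω : ‖F k ω‖ₑ ^ s ≤ ∑ i ∈ Finset.range k, (‖F i ω‖ₑ * N ω (Q i)) ^ s
  · rw [largePart_of_le hω, enorm_zero, ENNReal.zero_rpow_of_pos hp0,
      zero_mul, mul_zero, add_zero]
    gcongr
    exact le_self_add
  · rw [largePart_of_not_le hω]
    obtain ⟨m, hm, hNm⟩ := hQ.exists_count_eq hN (h k)
    lift ∑ i ∈ Finset.range k, (‖F i ω‖ₑ * N ω (Q i)) ^ s to ℝ≥0 using hfin with S
    rw [hNm]
    have hlt : S < ‖F k ω‖₊ ^ s := by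
      rw [not_le, enorm_eq_nnnorm, ← ENNReal.coe_rpow_of_nonneg _ hs0.le] at hω
      exact_mod_cast hω
    have key := NNReal.rpow_add_davisConst_le_of_lt hr0 hr1 hs0.le (hp.trans_eq hrs.symm) hm hlt
    rw [← NNReal.rpow_mul, hrs, ← NNReal.mul_rpow] at key
    rw [enorm_eq_nnnorm, ← ENNReal.coe_mul, ← ENNReal.coe_rpow_of_nonneg _ hs0.le,
      ← ENNReal.coe_add, ← ENNReal.coe_rpow_of_nonneg _ hr0.le,
      ← ENNReal.coe_rpow_of_nonneg _ hr0.le, ← ENNReal.coe_rpow_of_nonneg _ hp0.le]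
    exact_mod_cast key

theorem davisConst_mul_sum_smallPart_le (hN : IsPoissonRandomMeasure P N μ)
    (hQ : IsPredictableCells P N μ n D Q F) {s p : ℝ} (hp : 1 ≤ p) (hps : p ≤ s) {ω : Ω}
    (h : ∀ k, N ω (Q k) ≠ ∞) :
    davisConst (p / s) * ∑ k ∈ Finset.range n, ‖smallPart N Q F s k ω‖ₑ ^ s *
        (∑ i ∈ Finset.range k, (‖F i ω‖ₑ * N ω (Q i)) ^ s) ^ (p / s - 1) * N ω (Q k) ≤
      (∑ k ∈ Finset.range n, (‖F k ω‖ₑ * N ω (Q k)) ^ s) ^ (p / s) := by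
  have hs0 : 0 < s := by linarith
  have hr0 : 0 < p / s := by positivity
  have hr1 : p / s ≤ 1 := (div_le_one hs0).mpr hps
  have hrs : s * (p / s) = p := mul_div_cancel₀ p hs0.ne'
  refine ENNReal.mul_sum_le_of_forall_add_le
    (S := fun k => (∑ i ∈ Finset.range k, (‖F i ω‖ₑ * N ω (Q i)) ^ s) ^ (p / s)) n fun k _ => ?_
  have hfin := sum_jumps_ne_top (F := F) hs0.le h k
  rw [Finset.sum_range_succ]
  by_cases hω : ‖F k ω‖ₑ ^ s ≤ ∑ i ∈ Finset.range k, (‖F i ω‖ₑ * N ω (Q i)) ^ s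
  · rw [smallPart_of_le hω]
    rcases eq_or_ne (F k ω) 0 with h0 | h0
    · simp [h0, ENNReal.zero_rpow_of_pos hs0]
    obtain ⟨m, hm, hNm⟩ := hQ.exists_count_eq hN (h k)
    lift ∑ i ∈ Finset.range k, (‖F i ω‖ₑ * N ω (Q i)) ^ s to ℝ≥0 using hfin with S
    rw [hNm]
    have hle : ‖F k ω‖₊ ^ s ≤ S := by
      rw [enorm_eq_nnnorm, ← ENNReal.coe_rpow_of_nonneg _ hs0.le] at hω
      exact_mod_cast hω
    have hS : S ≠ 0 := fun h' => by
      rw [h', nonpos_iff_eq_zero, NNReal.rpow_eq_zero hs0.ne', nnnorm_eq_zero] at hle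
      exact h0 hle
    have key := NNReal.rpow_add_davisConst_le_of_le hr0 hr1 (hp.trans hps)
      (hp.trans_eq hrs.symm) hm hle
    rw [← NNReal.mul_rpow, mul_right_comm (‖F k ω‖₊ ^ s)] at key
    rw [enorm_eq_nnnorm, ← ENNReal.coe_mul, ← ENNReal.coe_rpow_of_nonneg _ hs0.le,
      ← ENNReal.coe_rpow_of_nonneg _ hs0.le, ← ENNReal.coe_add,
      ← ENNReal.coe_rpow_of_nonneg _ hr0.le, ← ENNReal.coe_rpow_of_nonneg _ hr0.le,
      ← ENNReal.coe_rpow_of_ne_zero hS]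
    exact_mod_cast key
  · rw [smallPart_of_not_le hω, enorm_zero, ENNReal.zero_rpow_of_pos hs0,
      zero_mul, zero_mul, mul_zero, add_zero]
    gcongr
    exact le_self_add

theorem lintegral_sum_largePart_le [IsProbabilityMeasure P] (hN : IsPoissonRandomMeasure P N μ)
    (hQ : IsPredictableCells P N μ n D Q F) {s p : ℝ} (hp : 1 ≤ p) (hps : p ≤ s) :
    ∫⁻ ω, ∑ k ∈ Finset.range n, ‖largePart N Q F s k ω‖ₑ ^ p * μ (Q k) ∂P ≤
      ((davisConst (p / s))⁻¹ : ℝ≥0) *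
        ∫⁻ ω, (∑ k ∈ Finset.range n, (‖F k ω‖ₑ * N ω (Q k)) ^ s) ^ (p / s) ∂P := by
  have hκ := davisConst_pos (r := p / s) (div_pos (by linarith) (by linarith))
  have hF : ∀ k, Measurable[countingSigma N (D k)] fun ω => ‖largePart N Q F s k ω‖ₑ ^ p :=
    fun k => (hQ.stronglyMeasurable_largePart s k).enorm.pow_const p
  have hF' : ∀ k, Measurable fun ω => ‖largePart N Q F s k ω‖ₑ ^ p := fun k =>
    (hF k).mono (hN.countingSigma_le _) le_rfl
  have hNm : ∀ k, Measurable fun ω => N ω (Q k) := fun k => hN.measurable _ (hQ.measurableSet k)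
  rw [lintegral_finsetSum _ fun k _ => (hF' k).mul_const _,
    Finset.sum_congr rfl fun k _ => (hQ.lintegral_mul_count hN k (hF k)).symm,
    ← lintegral_finsetSum _ fun k _ => (hF' k).fun_mul (hNm k),
    ← lintegral_const_mul' _ _ ENNReal.coe_ne_top]
  refine lintegral_mono_ae ?_
  filter_upwards [hQ.ae_count_ne_top hN] with ω hω
  have := hQ.davisConst_mul_sum_largePart_le hN hp hps hω
  rwa [ENNReal.coe_inv hκ.ne', ← ENNReal.div_eq_inv_mul, ENNReal.le_div_iff_mul_le
    (Or.inl (by simpa using hκ.ne')) (Or.inl ENNReal.coe_ne_top), mul_comm]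

/-- The predictable quantity `G k = ‖smallPart k‖^s (S k)^(r-1)` has a compensated sum bounded in
mean by `E (S n)^r`. As `‖smallPart k‖^s ≤ G k * (S n)^(1-r)`, Hölder with exponents `r` and `1 - r`
gives the result. -/
theorem lintegral_rpow_sum_smallPart_le [IsProbabilityMeasure P]
    (hN : IsPoissonRandomMeasure P N μ) (hQ : IsPredictableCells P N μ n D Q F) {s p : ℝ}
    (hp : 1 ≤ p) (hps : p ≤ s) :
    ∫⁻ ω, (∑ k ∈ Finset.range n, ‖smallPart N Q F s k ω‖ₑ ^ s * μ (Q k)) ^ (p / s) ∂P ≤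
      (((davisConst (p / s))⁻¹) ^ (p / s) : ℝ≥0) *
        ∫⁻ ω, (∑ k ∈ Finset.range n, (‖F k ω‖ₑ * N ω (Q k)) ^ s) ^ (p / s) ∂P := by
  have hs0 : 0 < s := by linarith
  have hr0 : 0 < p / s := div_pos (by linarith) (by linarith)
  have hr1 : p / s ≤ 1 := (div_le_one hs0).mpr hps
  have hκ := davisConst_pos hr0
  set r := p / s with hr_def
  set S : ℕ → Ω → ℝ≥0∞ := fun k ω => ∑ i ∈ Finset.range k, (‖F i ω‖ₑ * N ω (Q i)) ^ s with hS
  have hSm : ∀ k, Measurable[countingSigma N (D k)] (S k) := hQ.measurable_sum_jumps s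
  have hSm' : ∀ k, Measurable (S k) := fun k => (hSm k).mono (hN.countingSigma_le _) le_rfl
  set G : ℕ → Ω → ℝ≥0∞ := fun k ω => ‖smallPart N Q F s k ω‖ₑ ^ s * S k ω ^ (r - 1) with hG
  have hGm : ∀ k, Measurable[countingSigma N (D k)] (G k) := fun k =>
    ((hQ.stronglyMeasurable_smallPart s k).enorm.pow_const s).mul ((hSm k).pow_const _)
  have hGm' : ∀ k, Measurable (G k) := fun k => (hGm k).mono (hN.countingSigma_le _) le_rfl
  have hNm : ∀ k, Measurable fun ω => N ω (Q k) := fun k => hN.measurable _ (hQ.measurableSet k)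
  have hV : ∫⁻ ω, ∑ k ∈ Finset.range n, G k ω * μ (Q k) ∂P ≤
      ((davisConst r)⁻¹ : ℝ≥0) * ∫⁻ ω, S n ω ^ r ∂P := by
    rw [lintegral_finsetSum _ fun k _ => (hGm' k).mul_const _,
      Finset.sum_congr rfl fun k _ => (hQ.lintegral_mul_count hN k (hGm k)).symm,
      ← lintegral_finsetSum _ fun k _ => (hGm' k).fun_mul (hNm k),
      ← lintegral_const_mul' _ _ ENNReal.coe_ne_top]
    refine lintegral_mono_ae ?_
    filter_upwards [hQ.ae_count_ne_top hN] with ω hω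
    have := hQ.davisConst_mul_sum_smallPart_le hN hp hps hω
    rwa [ENNReal.coe_inv hκ.ne', ← ENNReal.div_eq_inv_mul, ENNReal.le_div_iff_mul_le
      (Or.inl (by simpa using hκ.ne')) (Or.inl ENNReal.coe_ne_top), mul_comm]
  have hpath : ∀ᵐ ω ∂P, (∑ k ∈ Finset.range n, ‖smallPart N Q F s k ω‖ₑ ^ s * μ (Q k)) ^ r ≤
      (∑ k ∈ Finset.range n, G k ω * μ (Q k)) ^ r * (S n ω ^ r) ^ (1 - r) := by
    filter_upwards [hQ.ae_count_ne_top hN] with ω hω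
    have h1 : ∑ k ∈ Finset.range n, ‖smallPart N Q F s k ω‖ₑ ^ s * μ (Q k) ≤
        (∑ k ∈ Finset.range n, G k ω * μ (Q k)) * S n ω ^ (1 - r) := by
      rw [Finset.sum_mul]
      refine Finset.sum_le_sum fun k hk => ?_
      rw [mul_right_comm]
      gcongr
      by_cases hsm : ‖F k ω‖ₑ ^ s ≤ S k ω
      swap
      · rw [smallPart_of_not_le hsm, enorm_zero, ENNReal.zero_rpow_of_pos hs0]
        exact zero_le
      rcases eq_or_ne (F k ω) 0 with h0 | h0
      · rw [smallPart_of_le hsm, h0, enorm_zero, ENNReal.zero_rpow_of_pos hs0]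
        exact zero_le
      -- On the small event `S k = 0` forces `F k = 0`, so the negative power of `S k` is harmless.
      have hSk : S k ω ≠ 0 := fun h' => by
        rw [h', nonpos_iff_eq_zero, ENNReal.rpow_eq_zero_iff_of_pos hs0, enorm_eq_zero] at hsm
        exact h0 hsm
      have hSk' : S k ω ≠ ∞ := sum_jumps_ne_top hs0.le hω k
      calc ‖smallPart N Q F s k ω‖ₑ ^ s
          = ‖smallPart N Q F s k ω‖ₑ ^ s * (S k ω ^ (r - 1) * S k ω ^ (1 - r)) := by
            rw [← ENNReal.rpow_add _ _ hSk hSk']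
            simp
        _ ≤ ‖smallPart N Q F s k ω‖ₑ ^ s * (S k ω ^ (r - 1) * S n ω ^ (1 - r)) := by
            have hmono : S k ω ≤ S n ω := Finset.sum_le_sum_of_subset
              (Finset.range_subset_range.mpr (Finset.mem_range.mp hk).le)
            have := ENNReal.rpow_le_rpow hmono (sub_nonneg.mpr hr1)
            gcongr
        _ = G k ω * S n ω ^ (1 - r) := by rw [hG, mul_assoc]
    refine (ENNReal.rpow_le_rpow h1 hr0.le).trans_eq ?_
    rw [ENNReal.mul_rpow_of_nonneg _ _ hr0.le, ← ENNReal.rpow_mul, ← ENNReal.rpow_mul,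
      mul_comm r (1 - r)]
  calc ∫⁻ ω, (∑ k ∈ Finset.range n, ‖smallPart N Q F s k ω‖ₑ ^ s * μ (Q k)) ^ r ∂P
      ≤ ∫⁻ ω, (∑ k ∈ Finset.range n, G k ω * μ (Q k)) ^ r * (S n ω ^ r) ^ (1 - r) ∂P :=
        lintegral_mono_ae hpath
    _ ≤ (∫⁻ ω, ∑ k ∈ Finset.range n, G k ω * μ (Q k) ∂P) ^ r *
          (∫⁻ ω, S n ω ^ r ∂P) ^ (1 - r) :=
        ENNReal.lintegral_mul_norm_pow_le
          (Finset.measurable_fun_sum _ fun k _ => (hGm' k).mul_const _).aemeasurable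
          ((hSm' n).pow_const r).aemeasurable hr0.le (sub_nonneg.mpr hr1) (by ring)
    _ ≤ (((davisConst r)⁻¹ : ℝ≥0) * ∫⁻ ω, S n ω ^ r ∂P) ^ r *
          (∫⁻ ω, S n ω ^ r ∂P) ^ (1 - r) := by gcongr
    _ = _ := by
        rw [ENNReal.mul_rpow_of_nonneg _ _ hr0.le, mul_assoc,
          ← ENNReal.rpow_add_of_nonneg _ _ hr0.le (sub_nonneg.mpr hr1), add_sub_cancel,
          ENNReal.rpow_one, ENNReal.coe_rpow_of_nonneg _ hr0.le]

end IsPredictableCells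

/-! ### Mixed norms of step functions -/

theorem MeasureTheory.lintegral_enorm_sum_indicator_rpow {E : Type v} [MeasurableSpace E]
    (μ : Measure E) {X : Type u} [NormedAddCommGroup X] {Q : ℕ → Set E}
    (hQ : ∀ k, MeasurableSet (Q k)) (hd : Pairwise fun i j => Disjoint (Q i) (Q j)) {q : ℝ}
    (hq : 0 < q) (a : ℕ → X) (n : ℕ) :
    ∫⁻ e, ‖∑ k ∈ Finset.range n, (Q k).indicator (fun _ => a k) e‖ₑ ^ q ∂μ =
      ∑ k ∈ Finset.range n, ‖a k‖ₑ ^ q * μ (Q k) := by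
  have h : ∀ e, ‖∑ k ∈ Finset.range n, (Q k).indicator (fun _ => a k) e‖ₑ ^ q =
      ∑ k ∈ Finset.range n, (Q k).indicator (fun _ => ‖a k‖ₑ ^ q) e := by
    intro e
    by_cases he : ∃ k ∈ Finset.range n, e ∈ Q k
    · obtain ⟨k, hk, hek⟩ := he
      have h0 : ∀ i ∈ Finset.range n, i ≠ k → e ∉ Q i := fun i _ hi hei =>
        disjoint_left.mp (hd hi) hei hek
      rw [Finset.sum_eq_single_of_mem k hk fun i hi hik => indicator_of_notMem (h0 i hi hik) _,
        Finset.sum_eq_single_of_mem k hk fun i hi hik => indicator_of_notMem (h0 i hi hik) _,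
        indicator_of_mem hek, indicator_of_mem hek]
    · push Not at he
      rw [Finset.sum_eq_zero fun i hi => indicator_of_notMem (he i hi) _,
        Finset.sum_eq_zero fun i hi => indicator_of_notMem (he i hi) _, enorm_zero,
        ENNReal.zero_rpow_of_pos hq]
  simp_rw [h]
  rw [lintegral_finsetSum _ fun k _ => measurable_const.indicator (hQ k)]
  exact Finset.sum_congr rfl fun k _ => lintegral_indicator_const (hQ k) _

namespace IsPredictableCells

variable {Ω : Type w} [mΩ : MeasurableSpace Ω] {P : Measure Ω} {E : Type v}
  [MeasurableSpace E] {N : Ω → Measure E} {μ : Measure E} {X : Type u} [NormedAddCommGroup X]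
  {n : ℕ} {D Q : ℕ → Set E} {F : ℕ → Ω → X}

theorem mixedNorm_sum_indicator (hQ : IsPredictableCells P N μ n D Q F) (G : ℕ → Ω → X) (p : ℝ)
    {q : ℝ} (hq : 0 < q) :
    mixedNorm P μ p q (fun ω e => ∑ k ∈ Finset.range n, (Q k).indicator (fun _ => G k ω) e) =
      (∫⁻ ω, (∑ k ∈ Finset.range n, ‖G k ω‖ₑ ^ q * μ (Q k)) ^ (p / q) ∂P) ^ (1 / p) := by
  simp_rw [mixedNorm, lintegral_enorm_sum_indicator_rpow μ hQ.measurableSet hQ.pairwise_disjoint hq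
    fun k => G k _]

theorem interNorm_sum_indicator_le [IsProbabilityMeasure P]
    (hN : IsPoissonRandomMeasure P N μ) (hQ : IsPredictableCells P N μ n D Q F) {s p : ℝ}
    (hs : 1 ≤ s) (hsp : s ≤ p) :
    interNorm P μ p s
        (fun ω e => ∑ k ∈ Finset.range n, (Q k).indicator (fun _ => F k ω) e) ≤
      ((ENNReal.ofReal (p / s) ^ (p / s) + 1) *
        ∫⁻ ω, (∑ k ∈ Finset.range n, (‖F k ω‖ₑ * N ω (Q k)) ^ s) ^ (p / s) ∂P) ^ (1 / p) := by
  have hs0 : 0 < s := by linarith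
  have hp0 : 0 < p := by linarith
  rw [interNorm, hQ.mixedNorm_sum_indicator F p hs0, hQ.mixedNorm_sum_indicator F p hp0,
    div_self hp0.ne', add_mul, one_mul]
  simp_rw [ENNReal.rpow_one]
  refine max_le ?_ ?_
  · exact ENNReal.rpow_le_rpow
      ((hQ.lintegral_rpow_sum_mul_measure_le hN hs hsp).trans le_self_add) (by positivity)
  · exact ENNReal.rpow_le_rpow
      ((hQ.lintegral_sum_rpow_mul_measure_le hN hs hsp).trans le_add_self) (by positivity)

theorem aestronglyMeasurable_sum_indicator (hN : IsPoissonRandomMeasure P N μ)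
    (hQ : IsPredictableCells P N μ n D Q F) {G : ℕ → Ω → X}
    (hG : ∀ k, StronglyMeasurable[countingSigma N (D k)] (G k)) :
    AEStronglyMeasurable
      (fun a : Ω × E => ∑ k ∈ Finset.range n, (Q k).indicator (fun _ => G k a.1) a.2)
      (P.prod μ) := by
  refine (Finset.stronglyMeasurable_fun_sum _ fun k _ => ?_).aestronglyMeasurable
  have h := (((hG k).mono (hN.countingSigma_le _)).comp_measurable
    (measurable_fst (α := Ω) (β := E))).indicator (measurable_snd (hQ.measurableSet k))
  exact h

theorem sumNorm_sum_indicator_le [IsProbabilityMeasure P]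
    (hN : IsPoissonRandomMeasure P N μ) (hQ : IsPredictableCells P N μ n D Q F) {s p : ℝ}
    (hp : 1 ≤ p) (hps : p ≤ s) :
    sumNorm P μ p s
        (fun ω e => ∑ k ∈ Finset.range n, (Q k).indicator (fun _ => F k ω) e) ≤
      ((((davisConst (p / s))⁻¹) ^ (p / s) : ℝ≥0) *
        ∫⁻ ω, (∑ k ∈ Finset.range n, (‖F k ω‖ₑ * N ω (Q k)) ^ s) ^ (p / s) ∂P) ^ (1 / p) +
      (((davisConst (p / s))⁻¹ : ℝ≥0) *
        ∫⁻ ω, (∑ k ∈ Finset.range n, (‖F k ω‖ₑ * N ω (Q k)) ^ s) ^ (p / s) ∂P) ^ (1 / p) := by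
  have hs0 : 0 < s := by linarith
  have hp0 : 0 < p := by linarith
  -- The decomposition `g + h` is read off from the two measurability proofs: small coefficients for
  -- `g`, large ones for `h`.
  refine (iInf₂_le _ _).trans ((iInf₂_le
    (hQ.aestronglyMeasurable_sum_indicator hN (hQ.stronglyMeasurable_smallPart s))
    (hQ.aestronglyMeasurable_sum_indicator hN (hQ.stronglyMeasurable_largePart s))).trans
    ((iInf_le _ (.of_forall fun a => ?_)).trans ?_))
  swap
  · rw [← Finset.sum_add_distrib]
    refine Finset.sum_congr rfl fun k _ => ?_
    by_cases h : a.2 ∈ Q k <;> simp [h, smallPart_add_largePart]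
  · rw [hQ.mixedNorm_sum_indicator _ p hs0, hQ.mixedNorm_sum_indicator _ p hp0,
      div_self hp0.ne']
    simp_rw [ENNReal.rpow_one]
    gcongr
    · exact hQ.lintegral_rpow_sum_smallPart_le hN hp hps
    · exact hQ.lintegral_sum_largePart_le hN hp hps

/-- Cells which are ordered by their starting times. -/
theorem exists_of_fintype {J : Type v} [MeasurableSpace J] {N : Ω → Measure (ℝ≥0 × J)}
    {μ : Measure (ℝ≥0 × J)} {ι : Type*} [Fintype ι] (τ : ι → ℝ≥0) {R : ι → Set (ℝ≥0 × J)}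
    {G : ι → Ω → X} (hR : ∀ c, MeasurableSet (R c)) (hμ : ∀ c, μ (R c) ≤ 2⁻¹)
    (hd : Pairwise fun c c' => Disjoint (R c) (R c')) (hτ : ∀ c, R c ⊆ Ioi (τ c) ×ˢ univ)
    (hG : ∀ c, StronglyMeasurable[countingSigma N (Iic (τ c) ×ˢ univ)] (G c))
    (hG' : ∀ c, MemLp (G c) ∞ P) :
    ∃ (D Q : ℕ → Set (ℝ≥0 × J)) (F : ℕ → Ω → X) (e : Fin (Fintype.card ι) ≃ ι),
      IsPredictableCells P N μ (Fintype.card ι) D Q F ∧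
        ∀ k : Fin (Fintype.card ι), Q k = R (e k) ∧ F k = G (e k) := by
  classical
  set n := Fintype.card ι
  let e₀ : Fin n ≃ ι := (Fintype.equivFin ι).symm
  let e : Fin n ≃ ι := (Tuple.sort (τ ∘ e₀)).trans e₀
  have he : Monotone fun k => τ (e k) := Tuple.monotone_sort (τ ∘ e₀)
  let Q : ℕ → Set (ℝ≥0 × J) := fun k => if h : k < n then R (e ⟨k, h⟩) else ∅
  let F : ℕ → Ω → X := fun k => if h : k < n then G (e ⟨k, h⟩) else 0
  -- Beyond the last cell `Q k` is empty and `F k` is zero, so `univ` keeps `T` increasing at no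
  -- cost.
  let T : ℕ → Set (ℝ≥0 × J) := fun k => if h : k < n then Iic (τ (e ⟨k, h⟩)) ×ˢ univ else univ
  have hT : Monotone T := by
    intro i j hij
    by_cases hj : j < n
    · simp only [T, hj, hij.trans_lt hj, dif_pos]
      exact prod_mono_left (Iic_subset_Iic.mpr (he hij))
    · simp only [T, hj, dif_neg, not_false_eq_true]
      exact subset_univ _
  -- The time slab `T k` carries the information on which `F k` depends; it misses `Q k`, which
  -- starts after `τ`. The earlier cells must be adjoined because several cells can share a starting
  -- time or overlap in time.
  refine ⟨fun k => (⋃ i < k, Q i) ∪ T k, Q, F, e, ⟨?_, ?_, ?_, ?_, ?_, ?_, ?_, ?_⟩, ?_⟩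
  · exact fun i j hij => union_subset_union
      (biUnion_subset_biUnion_left fun k hk => lt_of_lt_of_le hk hij) (hT hij)
  · intro k
    by_cases hk : k < n <;> simp [Q, hk, hR]
  · intro k
    by_cases hk : k < n <;> simp [Q, hk, hμ]
  · exact fun k _ hx => Or.inl (mem_iUnion₂.mpr ⟨k, k.lt_succ_self, hx⟩)
  · intro k
    by_cases hk : k < n
    · refine disjoint_union_left.mpr ⟨disjoint_iUnion₂_left.mpr fun i hi => ?_, ?_⟩
      · simp only [Q, hk, hi.trans hk, dif_pos]
        refine hd fun h => hi.ne ?_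
        simpa using h
      · simp only [Q, T, hk, dif_pos]
        exact (Set.disjoint_prod.mpr (Or.inl (Iic_disjoint_Ioi le_rfl))).mono_right (hτ _)
    · simp [Q, hk]
  · intro k
    by_cases hk : k < n
    · simp only [F, hk, dif_pos]
      exact (hG _).mono (countingSigma_mono N
        (subset_union_of_subset_right (by simp only [T, hk, dif_pos, subset_rfl]) _))
    · simp only [F, hk, dif_neg, not_false_eq_true]
      exact stronglyMeasurable_zero
  · intro k
    by_cases hk : k < n
    · simpa [F, hk] using hG' _
    · simp only [F, hk, dif_neg, not_false_eq_true]
      exact MemLp.zero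
  · intro k hk
    simp [F, hk.not_gt]
  · intro k
    simp [Q, F]

end IsPredictableCells

/-! ### Discretisation of simple processes -/

theorem compensated_iUnion {Ω : Type w} {E : Type v} [MeasurableSpace E] {N : Ω → Measure E}
    {μ : Measure E} {κ : Type*} [Fintype κ] {R : κ → Set E} (hR : ∀ c, MeasurableSet (R c))
    (hd : Pairwise fun c c' => Disjoint (R c) (R c')) (hμ : ∀ c, μ (R c) ≠ ∞) {ω : Ω}
    (hN : ∀ c, N ω (R c) ≠ ∞) :
    compensated N μ (⋃ c, R c) ω = ∑ c, compensated N μ (R c) ω := by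
  simp only [compensated]
  rw [measure_iUnion hd hR, measure_iUnion hd hR, tsum_fintype, tsum_fintype,
    ENNReal.toReal_sum fun c _ => hN c, ENNReal.toReal_sum fun c _ => hμ c,
    Finset.sum_sub_distrib]

theorem indicator_iUnion_eq_sum {E : Type v} {X : Type u} [AddCommMonoid X] {κ : Type*} [Fintype κ]
    {R : κ → Set E} (hd : Pairwise fun c c' => Disjoint (R c) (R c')) (f : E → X) (e : E) :
    (⋃ c, R c).indicator f e = ∑ c, (R c).indicator f e := by
  have h := Finset.indicator_biUnion_apply Finset.univ R (f := f) (fun c _ c' _ h => hd h) e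
  simpa using h

/-- The `κ`-th point of the partition of `(a, b]` into `K` intervals of equal length. -/
noncomputable def uniformGrid (a b : ℝ≥0) (K κ : ℕ) : ℝ≥0 :=
  a + κ * ((b - a) / K)

theorem uniformGrid_mono (a b : ℝ≥0) (K : ℕ) : Monotone (uniformGrid a b K) := fun i j h => by
  unfold uniformGrid
  gcongr

theorem le_uniformGrid (a b : ℝ≥0) (K κ : ℕ) : a ≤ uniformGrid a b K κ := le_self_add

theorem iUnion_Ioc_uniformGrid {a b : ℝ≥0} (h : a ≤ b) {K : ℕ} (hK : K ≠ 0) :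
    ⋃ κ : Fin K, Ioc (uniformGrid a b K κ) (uniformGrid a b K (κ + 1)) = Ioc a b := by
  have h1 := (uniformGrid_mono a b K).biUnion_Ico_Ioc_map_succ 0 K
  have h2 : uniformGrid a b K K = b := by
    rw [uniformGrid, mul_div_cancel₀ _ (by exact_mod_cast hK), add_tsub_cancel_of_le h]
  have h3 : uniformGrid a b K 0 = a := by simp [uniformGrid]
  rw [h2, h3] at h1
  rw [← h1]
  ext x
  simp only [mem_iUnion, Nat.succ_eq_succ, Nat.succ_eq_add_one, exists_prop]
  exact ⟨fun ⟨κ, hκ⟩ => ⟨κ, ⟨Nat.zero_le _, κ.2⟩, hκ⟩, fun ⟨κ, hk, hκ⟩ => ⟨⟨κ, hk.2⟩, hκ⟩⟩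

theorem lebesgueNNReal_Ioc_uniformGrid (a b : ℝ≥0) (K κ : ℕ) :
    lebesgueNNReal (Ioc (uniformGrid a b K κ) (uniformGrid a b K (κ + 1))) =
      ((b - a) / K : ℝ≥0) := by
  rw [lebesgueNNReal_Ioc, ← ENNReal.ofReal_coe_nnreal]
  congr 1
  simp only [uniformGrid]
  push_cast
  ring

theorem ENNReal.coe_div_natCast_mul_le_inv_two {δ : ℝ≥0} {a : ℝ≥0∞} {K : ℕ} (hK : K ≠ 0)
    (h : (δ : ℝ≥0∞) * a * 2 ≤ K) : ((δ / K : ℝ≥0) : ℝ≥0∞) * a ≤ 2⁻¹ := by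
  rw [ENNReal.coe_div (by exact_mod_cast hK), ENNReal.coe_natCast, ← ENNReal.mul_div_right_comm,
    ← one_div, ENNReal.le_div_iff_mul_le (Or.inl two_ne_zero) (Or.inl ENNReal.ofNat_ne_top),
    ← ENNReal.mul_div_right_comm]
  exact ENNReal.div_le_of_le_mul (by rwa [one_mul])

namespace SimpleAdaptedProcess

variable {Ω : Type w} [MeasurableSpace Ω] {P : Measure Ω} {J : Type v} [MeasurableSpace J]
  {ν : Measure J} {N : Ω → Measure (ℝ≥0 × J)} {𝕜 : Type z} [RCLike 𝕜] {X : Type u}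

/-- The blocks of a simple process over `ℝ₊ × B`, divided into `K` pieces along the time axis. -/
def cell (φ : SimpleAdaptedProcess P ν N 𝕜 X) (B : Set J) (K : ℕ) (i : Fin φ.l) (j : Fin φ.m)
    (κ : ℕ) : Set (ℝ≥0 × J) :=
  Ioc (uniformGrid (φ.t i.castSucc) (φ.t i.succ) K κ)
    (uniformGrid (φ.t i.castSucc) (φ.t i.succ) K (κ + 1)) ×ˢ (φ.A j ∩ B)

variable (φ : SimpleAdaptedProcess P ν N 𝕜 X) {B : Set J}

theorem measurableSet_cell (hB : MeasurableSet B) (K : ℕ) (i : Fin φ.l) (j : Fin φ.m) (κ : ℕ) :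
    MeasurableSet (φ.cell B K i j κ) :=
  measurableSet_Ioc.prod ((φ.measurableSet_A j).inter hB)

theorem t_castSucc_le_succ (i : Fin φ.l) : φ.t i.castSucc ≤ φ.t i.succ :=
  φ.t_strictMono.monotone i.castSucc_lt_succ.le

theorem iUnion_cell (B : Set J) {K : ℕ} (hK : K ≠ 0) (i : Fin φ.l) (j : Fin φ.m) :
    ⋃ κ : Fin K, φ.cell B K i j κ = φ.interval i ×ˢ (φ.A j ∩ B) := by
  simp only [cell]
  rw [← iUnion_prod_const, iUnion_Ioc_uniformGrid (φ.t_castSucc_le_succ i) hK, interval]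

theorem disjoint_interval {i i' : Fin φ.l} (h : i ≠ i') :
    Disjoint (φ.interval i) (φ.interval i') := by
  wlog hlt : i < i' generalizing i i'
  · exact (this h.symm (h.lt_or_gt.resolve_left hlt)).symm
  · refine disjoint_left.mpr fun x hx hx' => (hx.2.trans ?_).not_gt hx'.1
    exact φ.t_strictMono.monotone (Fin.succ_le_castSucc_iff.mpr hlt)

theorem disjoint_cell {K : ℕ} (hK : K ≠ 0) :
    Pairwise fun c c' : Fin φ.l × Fin φ.m × Fin K =>
      Disjoint (φ.cell B K c.1 c.2.1 c.2.2) (φ.cell B K c'.1 c'.2.1 c'.2.2) := by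
  rintro ⟨i, j, κ⟩ ⟨i', j', κ'⟩ h
  have hsub : ∀ i j (κ : Fin K), φ.cell B K i j κ ⊆ φ.interval i ×ˢ φ.A j := fun i j κ =>
    ((subset_iUnion (fun κ : Fin K => φ.cell B K i j κ) κ).trans_eq
      (φ.iUnion_cell B hK i j)).trans (prod_mono_right inter_subset_left)
  by_cases hi : i = i'
  swap
  · exact (Set.disjoint_prod.mpr (Or.inl (φ.disjoint_interval hi))).mono (hsub _ _ _) (hsub _ _ _)
  by_cases hj : j = j'
  swap
  · exact (Set.disjoint_prod.mpr (Or.inr (φ.disjoint_A hj))).mono (hsub _ _ _) (hsub _ _ _)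
  subst hi hj
  have hκ : (κ : ℕ) ≠ κ' := fun hκ => h (by rw [Fin.ext hκ])
  exact Set.disjoint_prod.mpr (Or.inl
    ((uniformGrid_mono (φ.t i.castSucc) (φ.t i.succ) K).pairwise_disjoint_on_Ioc_succ hκ))

theorem disjoint_cell_of_ne {K : ℕ} (hK : K ≠ 0) (i : Fin φ.l) (j : Fin φ.m) :
    Pairwise fun κ κ' : Fin K => Disjoint (φ.cell B K i j κ) (φ.cell B K i j κ') :=
  fun κ κ' h => φ.disjoint_cell hK (show (i, j, κ) ≠ (i, j, κ') by simpa using h)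

theorem exists_measure_cell_le [SigmaFinite ν] (B : Set J) :
    ∃ K : ℕ, K ≠ 0 ∧ ∀ i j κ, lebesgueNNReal.prod ν (φ.cell B K i j κ) ≤ 2⁻¹ := by
  let b : Fin φ.l × Fin φ.m → ℝ≥0∞ := fun c =>
    ((φ.t c.1.succ - φ.t c.1.castSucc : ℝ≥0) : ℝ≥0∞) * ν (φ.A c.2) * 2
  have hb : ∑ c, b c ≠ ∞ := ENNReal.sum_ne_top.mpr fun c _ =>
    ENNReal.mul_ne_top (ENNReal.mul_ne_top ENNReal.coe_ne_top (φ.measure_A_lt_top c.2).ne)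
      ENNReal.ofNat_ne_top
  -- Exceeding the sum of all doubled block measures makes one `K` work for every block.
  obtain ⟨K, hK⟩ := ENNReal.exists_nat_gt hb
  have hK0 : K ≠ 0 := by
    rintro rfl
    simp at hK
  refine ⟨K, hK0, fun i j κ => ?_⟩
  have h : b (i, j) ≤ K :=
    (Finset.single_le_sum (fun _ _ => zero_le) (Finset.mem_univ (i, j))).trans hK.le
  rw [cell, Measure.prod_prod, lebesgueNNReal_Ioc_uniformGrid]
  refine le_trans ?_ (ENNReal.coe_div_natCast_mul_le_inv_two hK0 h)
  gcongr
  exact inter_subset_left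

variable [NormedAddCommGroup X] [NormedSpace 𝕜 X]

/-- The value of a simple process on a block of its domain. -/
def coeff (φ : SimpleAdaptedProcess P ν N 𝕜 X) (i : Fin φ.l) (j : Fin φ.m) (ω : Ω) : X :=
  ∑ k, φ.F i j k ω • φ.x i j k

theorem restrict_eq_sum_cell {K : ℕ} (hK : K ≠ 0) (ω : Ω) (e : ℝ≥0 × J) :
    φ.restrict B ω e = ∑ c : Fin φ.l × Fin φ.m × Fin K,
      (φ.cell B K c.1 c.2.1 c.2.2).indicator (fun _ => φ.coeff c.1 c.2.1 ω) e := by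
  have h : ∀ i j, ∑ κ : Fin K, (φ.cell B K i j κ).indicator (fun _ => φ.coeff i j ω) e =
      ((univ : Set ℝ≥0) ×ˢ B).indicator (fun e => ∑ k,
        (φ.interval i ×ˢ φ.A j).indicator (fun _ => φ.F i j k ω • φ.x i j k) e) e := by
    intro i j
    rw [← indicator_iUnion_eq_sum (φ.disjoint_cell_of_ne hK i j), φ.iUnion_cell B hK]
    by_cases h1 : e.2 ∈ B <;> by_cases h2 : e.1 ∈ φ.interval i <;> by_cases h3 : e.2 ∈ φ.A j <;>
      simp [coeff, mem_prod, indicator, h1, h2, h3]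
  simp_rw [Fintype.sum_prod_type, h, restrict]
  by_cases h1 : e.2 ∈ B <;> simp [indicator, h1, toFun]

theorem stochIntegral_eq_sum_cell [NormedSpace ℝ X] [IsScalarTower ℝ 𝕜 X] {K : ℕ} (hK : K ≠ 0)
    (hB : MeasurableSet B)
    (hμ : ∀ i j, ∀ κ : Fin K, lebesgueNNReal.prod ν (φ.cell B K i j κ) ≠ ∞) {ω : Ω}
    (hN : ∀ i j, ∀ κ : Fin K, N ω (φ.cell B K i j κ) ≠ ∞) :
    φ.stochIntegral B ω = ∑ c : Fin φ.l × Fin φ.m × Fin K,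
      compensated N (lebesgueNNReal.prod ν) (φ.cell B K c.1 c.2.1 c.2.2) ω •
        φ.coeff c.1 c.2.1 ω := by
  simp_rw [Fintype.sum_prod_type, stochIntegral]
  refine Finset.sum_congr rfl fun i _ => Finset.sum_congr rfl fun j _ => ?_
  rw [← φ.iUnion_cell B hK, compensated_iUnion (κ := Fin K)
    (fun κ => φ.measurableSet_cell hB K i j κ) (φ.disjoint_cell_of_ne hK i j) (hμ i j) (hN i j),
    ← Finset.sum_smul, coeff, Finset.smul_sum]
  refine Finset.sum_congr rfl fun k _ => ?_
  rw [smul_comm, RCLike.real_smul_eq_coe_smul (K := 𝕜)]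

theorem stronglyMeasurable_coeff (i : Fin φ.l) (j : Fin φ.m) :
    StronglyMeasurable[poissonPast N (φ.t i.castSucc)] (φ.coeff i j) :=
  Finset.stronglyMeasurable_fun_sum _ fun k _ =>
    (φ.measurable_F i j k).stronglyMeasurable.smul_const (φ.x i j k)

theorem memLp_coeff (i : Fin φ.l) (j : Fin φ.m) : MemLp (φ.coeff i j) ∞ P :=
  memLp_finsetSum _ fun k _ => (memLp_top_const (φ.x i j k)).smul (φ.memLp_F i j k)

theorem exists_isPredictableCells [NormedSpace ℝ X] [IsScalarTower ℝ 𝕜 X] [SigmaFinite ν]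
    (hN : IsPoissonRandomMeasure P N (lebesgueNNReal.prod ν)) (hB : MeasurableSet B) :
    ∃ (n : ℕ) (D Q : ℕ → Set (ℝ≥0 × J)) (F : ℕ → Ω → X),
      IsPredictableCells P N (lebesgueNNReal.prod ν) n D Q F ∧
      (φ.restrict B = fun ω e => ∑ k ∈ Finset.range n, (Q k).indicator (fun _ => F k ω) e) ∧
      ∀ᵐ ω ∂P, φ.stochIntegral B ω =
        ∑ k ∈ Finset.range n, compensated N (lebesgueNNReal.prod ν) (Q k) ω • F k ω := by
  obtain ⟨K, hK, hle⟩ := φ.exists_measure_cell_le B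
  have htop : ∀ i j κ, lebesgueNNReal.prod ν (φ.cell B K i j κ) ≠ ∞ := fun i j κ =>
    ((hle i j κ).trans_lt (by simp)).ne
  obtain ⟨D, Q, F, e, hQ, he⟩ := IsPredictableCells.exists_of_fintype (P := P)
    (ι := Fin φ.l × Fin φ.m × Fin K)
    (fun c => uniformGrid (φ.t c.1.castSucc) (φ.t c.1.succ) K c.2.2)
    (fun c => φ.measurableSet_cell hB K c.1 c.2.1 c.2.2) (fun c => hle c.1 c.2.1 c.2.2)
    (φ.disjoint_cell hK) (fun c => prod_mono Ioc_subset_Ioi_self (subset_univ _))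
    (G := fun c => φ.coeff c.1 c.2.1)
    -- A coefficient known at `t i` is known at every later grid point, so subdividing in time
    -- preserves adaptedness.
    (fun c => (φ.stronglyMeasurable_coeff c.1 c.2.1).mono
      ((poissonPast_le_countingSigma N _).trans (countingSigma_mono N
        (prod_mono_left (Iic_subset_Iic.mpr (le_uniformGrid _ _ _ _))))))
    (fun c => φ.memLp_coeff c.1 c.2.1)
  refine ⟨_, D, Q, F, hQ, ?_, ?_⟩
  · funext ω x
    rw [φ.restrict_eq_sum_cell hK, ← Fin.sum_univ_eq_sum_range
      (fun k => (Q k).indicator (fun _ => F k ω) x), ← e.sum_comp]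
    exact Finset.sum_congr rfl fun k _ => by rw [(he k).1, (he k).2]
  · have hfin : ∀ᵐ ω ∂P, ∀ i j, ∀ κ : Fin K, N ω (φ.cell B K i j κ) ≠ ∞ := by
      simp_rw [ae_all_iff]
      exact fun i j κ => hN.ae_count_ne_top (φ.measurableSet_cell hB K i j κ) (htop i j κ)
    filter_upwards [hfin] with ω hω
    rw [φ.stochIntegral_eq_sum_cell hK hB (fun i j κ => htop i j κ) hω,
      ← Fin.sum_univ_eq_sum_range
      (fun k => compensated N (lebesgueNNReal.prod ν) (Q k) ω • F k ω), ← e.sum_comp]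
    exact Finset.sum_congr rfl fun k _ => by rw [(he k).1, (he k).2]

end SimpleAdaptedProcess

/-! ### Conclusion -/

theorem mainTheorem2 {𝕜 : Type z} [RCLike 𝕜] {X : Type u} [NormedAddCommGroup X]
    [NormedSpace ℝ X] [NormedSpace 𝕜 X] [IsScalarTower ℝ 𝕜 X] [CompleteSpace X]
    (s : ℝ) (hs : 2 ≤ s) (hX : HasMartingaleCotype.{u, w} X s) :
    (∀ p : ℝ, s ≤ p → ∃ C : ℝ≥0,
      ∀ (Ω : Type w) [MeasurableSpace Ω] (P : Measure Ω) [IsProbabilityMeasure P]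
        (J : Type v) [MeasurableSpace J] (ν : Measure J) [SigmaFinite ν]
        (N : Ω → Measure (ℝ≥0 × J)), IsPoissonRandomMeasure P N (lebesgueNNReal.prod ν) →
      ∀ (φ : SimpleAdaptedProcess P ν N 𝕜 X) (B : Set J), MeasurableSet B →
        interNorm P (lebesgueNNReal.prod ν) p s (φ.restrict B) ≤
          C * (∫⁻ ω, ‖φ.stochIntegral B ω‖ₑ ^ p ∂P) ^ (1 / p)) ∧
    (∀ p : ℝ, 1 < p → p < s → ∃ C : ℝ≥0,
      ∀ (Ω : Type w) [MeasurableSpace Ω] (P : Measure Ω) [IsProbabilityMeasure P]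
        (J : Type v) [MeasurableSpace J] (ν : Measure J) [SigmaFinite ν]
        (N : Ω → Measure (ℝ≥0 × J)), IsPoissonRandomMeasure P N (lebesgueNNReal.prod ν) →
      ∀ (φ : SimpleAdaptedProcess P ν N 𝕜 X) (B : Set J), MeasurableSet B →
        sumNorm P (lebesgueNNReal.prod ν) p s (φ.restrict B) ≤
          C * (∫⁻ ω, ‖φ.stochIntegral B ω‖ₑ ^ p ∂P) ^ (1 / p)) := by
  have hs1 : 1 ≤ s := by linarith
  refine ⟨fun p hsp => ?_, fun p hp hps => ?_⟩
  · have hp0 : 0 ≤ 1 / p := one_div_nonneg.mpr (by linarith)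
    have hr0 : 0 ≤ p / s := div_nonneg (by linarith) (by linarith)
    obtain ⟨C, hC⟩ := hX.exists_lintegral_jumps_le hs1 (p := p) (by linarith)
    refine ⟨(((p / s).toNNReal ^ (p / s) + 1) * C) ^ (1 / p),
      fun Ω _ P _ J _ ν _ N hN φ B hB => ?_⟩
    obtain ⟨n, D, Q, F, hQ, h1, h2⟩ := φ.exists_isPredictableCells hN hB
    rw [h1, lintegral_congr_ae (h2.mono fun ω h => congrArg (‖·‖ₑ ^ p) h),
      ENNReal.coe_rpow_of_nonneg _ hp0, ← ENNReal.mul_rpow_of_nonneg _ _ hp0]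
    refine (hQ.interNorm_sum_indicator_le hN hs1 hsp).trans (ENNReal.rpow_le_rpow ?_ hp0)
    rw [ENNReal.coe_mul, ENNReal.coe_add, ENNReal.coe_rpow_of_nonneg _ hr0, ENNReal.coe_one,
      mul_assoc]
    exact mul_le_mul_right (hC Ω P _ N _ hN n D Q F hQ) _
  · have hp0 : 0 ≤ 1 / p := one_div_nonneg.mpr (by linarith)
    obtain ⟨C, hC⟩ := hX.exists_lintegral_jumps_le hs1 hp
    refine ⟨((davisConst (p / s))⁻¹ ^ (p / s) * C) ^ (1 / p) +
      ((davisConst (p / s))⁻¹ * C) ^ (1 / p), fun Ω _ P _ J _ ν _ N hN φ B hB => ?_⟩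
    obtain ⟨n, D, Q, F, hQ, h1, h2⟩ := φ.exists_isPredictableCells hN hB
    have h3 := hC Ω P _ N _ hN n D Q F hQ
    rw [h1, lintegral_congr_ae (h2.mono fun ω h => congrArg (‖·‖ₑ ^ p) h), ENNReal.coe_add,
      add_mul, ENNReal.coe_rpow_of_nonneg _ hp0, ENNReal.coe_rpow_of_nonneg _ hp0,
      ← ENNReal.mul_rpow_of_nonneg _ _ hp0, ← ENNReal.mul_rpow_of_nonneg _ _ hp0,
      ENNReal.coe_mul, ENNReal.coe_mul, mul_assoc, mul_assoc]
    refine (hQ.sumNorm_sum_indicator_le hN hp.le hps.le).trans ?_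
    gcongr
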